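/- Let $\Omega\subset\mathbb R^2$ be a domain (open and connected), $u\in C^1(\Omega)$ real-valued, $\vec F=(F_1,F_2)\in C^1(\Omega;\mathbb R^2)$ and $H\in C^0(\Omega)$. Suppose that $\Omega$ is nonsingular for $u$, i.e. $\nabla u+\vec F\neq 0$ everywhere in $\Omega$, and put $$D=|\nabla u+\vec F|,\qquad N=N^u=\frac{\nabla u+\vec F}{|\nabla u+\vec F|},\qquad N^\perp=(N_2,-N_1),\qquad \operatorname{rot}\vec F=(F_2)_x-(F_1)_y .$$ Integral curves of $N^\perp$ are called characteristic curves and integral curves of $N$ are called seed curves. For a real function $h$ on $\Omega$, $(N^\perp h)(p)$ (respectively $(Nh)(p)$) denotes the derivative of $h$ at $p$ along the characteristic (respectively seed) curves through $p$, if it exists. Suppose that $u$ is a weak solution of $\operatorname{div}N^u=H$ in $\Omega$, i.e. $$\int_\Omega N\cdot\nabla\varphi+\int_\Omega H\varphi=0\qquad\text{for all }\varphi\in C_0^\infty(\Omega),$$ and that $N(H)$ exists and is continuous in $\Omega$. Then: 1. Near every point of $\Omega$ there is a continuous function $\theta$ with $N=(\cos\theta,\sin\theta)$, and every continuous $\theta$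 with this property on an open subset of $\Omega$ is of class $C^1$ there. In particular $N\in C^1(\Omega)$. 2. Through every point of $\Omega$ pass a characteristic curve and a seed curve, and all characteristic curves and all seed curves in $\Omega$ are of class $C^2$. 3. $N^\perp D$ and $N^\perp(\log D)$ exist and are continuous in $\Omega$. 4. Near every point of $\Omega$ there are characteristic coordinates, i.e. a $C^1$ diffeomorphism $(x,y)\mapsto(s,t)$ from an open subset of $\Omega$ onto an open subset of $\mathbb R^2$ such that $\nabla s=fN^\perp$ and $\nabla t=gDN$ for some positive continuous functions $f,g$. In any such coordinates, wherever a continuous $\theta$ with $N=(\cos\theta,\sin\theta)$ is defined, $$\theta_t\equiv\frac{\partial\theta}{\partial t}=\frac{\operatorname{rot}\vec F}{gD^2}-\frac{N^\perp(\log D)}{gD}=\frac{1}{gD^2}\bigl(\operatorname{rot}\vec F-N^\perp D\bigr).$$ -/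

import Mathlib

open Set MeasureTheory
open scoped ContDiff

noncomputable section

/-- The Euclidean plane with coordinates `(x, y)`. Lengths and inner products of vectors are
written out in coordinates, so the sup norm of `ℝ × ℝ` never enters. -/
abbrev Plane : Type := ℝ × ℝ

/-- The Euclidean inner product of two plane vectors. -/
def dotP (v w : Plane) : ℝ := v.1 * w.1 + v.2 * w.2

/-- The Euclidean length of a plane vector. -/
def lenP (v : Plane) : ℝ := Real.sqrt (v.1 ^ 2 + v.2 ^ 2)

/-- Rotation by `-π/2`: `(v₁, v₂) ↦ (v₂, -v₁)`. -/
def perpP (v : Plane) : Plane := (v.2, -v.1)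

/-- The gradient `(u_x, u_y)`. -/
def gradP (u : Plane → ℝ) (p : Plane) : Plane :=
  (fderiv ℝ u p (1, 0), fderiv ℝ u p (0, 1))

/-- `rot F = (F₂)_x - (F₁)_y`. -/
def rotP (F : Plane → Plane) (p : Plane) : ℝ :=
  (fderiv ℝ F p (1, 0)).2 - (fderiv ℝ F p (0, 1)).1

/-- The vector field `∇u + F`. -/
def shiftedGrad (u : Plane → ℝ) (F : Plane → Plane) (p : Plane) : Plane := gradP u p + F p

/-- `D = |∇u + F|`. -/
def lenD (u : Plane → ℝ) (F : Plane → Plane) (p : Plane) : ℝ := lenP (shiftedGrad u F p)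

/-- The Legendrian normal `N^u = (∇u + F) / |∇u + F|`. -/
def normalN (u : Plane → ℝ) (F : Plane → Plane) (p : Plane) : Plane :=
  (lenD u F p)⁻¹ • shiftedGrad u F p

/-- The rotated normal `N^⊥`. -/
def normalPerp (u : Plane → ℝ) (F : Plane → Plane) (p : Plane) : Plane :=
  perpP (normalN u F p)

/-- `Ω` is nonsingular for `u`: the singular set `{∇u + F = 0}` does not meet `Ω`. -/
def Nonsingular (Ω : Set Plane) (u : Plane → ℝ) (F : Plane → Plane) : Prop :=
  ∀ p ∈ Ω, shiftedGrad u F p ≠ 0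

/-- `φ ∈ C₀^∞(Ω)`. -/
def IsTestFun (Ω : Set Plane) (φ : Plane → ℝ) : Prop :=
  ContDiff ℝ ∞ φ ∧ HasCompactSupport φ ∧ tsupport φ ⊆ Ω

/-- `u` solves `div N^u = H` weakly in the nonsingular domain `Ω`. -/
def IsWeakSolution (Ω : Set Plane) (u : Plane → ℝ) (F : Plane → Plane) (H : Plane → ℝ) : Prop :=
  ∀ φ : Plane → ℝ, IsTestFun Ω φ →
    (∫ p in Ω, dotP (normalN u F p) (gradP φ p)) + (∫ p in Ω, H p * φ p) = 0

/-- `γ`, on the open interval `(a, b)`, is an integral curve of `V` lying in `Ω`. -/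
def IsCurveIn (V : Plane → Plane) (Ω : Set Plane) (γ : ℝ → Plane) (a b : ℝ) : Prop :=
  IsIntegralCurveOn γ (fun _ => V) (Ioo a b) ∧ MapsTo γ (Ioo a b) Ω

/-- Characteristic curves: the integral curves of `N^⊥`. -/
def IsCharCurve (Ω : Set Plane) (u : Plane → ℝ) (F : Plane → Plane) (γ : ℝ → Plane)
    (a b : ℝ) : Prop :=
  IsCurveIn (normalPerp u F) Ω γ a b

/-- Seed curves: the integral curves of `N`. -/
def IsSeedCurve (Ω : Set Plane) (u : Plane → ℝ) (F : Plane → Plane) (γ : ℝ → Plane)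
    (a b : ℝ) : Prop :=
  IsCurveIn (normalN u F) Ω γ a b

/-- `(Vh)(p)` exists and equals `d`: along every integral curve of `V` in `Ω` through `p`
the function `h` has derivative `d` at `p`. (Through each point of an open set passes
an integral curve of a continuous field.) -/
def HasDerivAlong (V : Plane → Plane) (Ω : Set Plane) (h : Plane → ℝ) (p : Plane) (d : ℝ) : Prop :=
  ∀ (γ : ℝ → Plane) (a b τ : ℝ), IsCurveIn V Ω γ a b → τ ∈ Ioo a b → γ τ = p →
    HasDerivAt (fun r => h (γ r)) d τ

/-- `Vh` exists in `Ω`, equals `k` there, and is continuous. -/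
def HasContDerivAlong (V : Plane → Plane) (Ω : Set Plane) (h k : Plane → ℝ) : Prop :=
  ContinuousOn k Ω ∧ ∀ p ∈ Ω, HasDerivAlong V Ω h p (k p)

/-- `θ` is a continuous angle function on `U`: `N^u = (cos θ, sin θ)` on `U`. -/
def IsAngleOn (u : Plane → ℝ) (F : Plane → Plane) (U : Set Plane) (θ : Plane → ℝ) : Prop :=
  ContinuousOn θ U ∧ ∀ p ∈ U, normalN u F p = (Real.cos (θ p), Real.sin (θ p))

/-- Characteristic coordinates `Ψ = (s, t)` on an open part of `Ω` (the source of `Ψ`): `Ψ` is a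
`C¹` diffeomorphism onto an open set, and `∇s = f N^⊥`, `∇t = g D N` with `f`, `g` continuous and
positive. -/
structure IsCharCoords (Ω : Set Plane) (u : Plane → ℝ) (F : Plane → Plane)
    (Ψ : OpenPartialHomeomorph Plane Plane) (f g : Plane → ℝ) : Prop where
  source_subset : Ψ.source ⊆ Ω
  contDiffOn : ContDiffOn ℝ 1 Ψ Ψ.source
  contDiffOn_symm : ContDiffOn ℝ 1 Ψ.symm Ψ.target
  f_cont : ContinuousOn f Ψ.source
  g_cont : ContinuousOn g Ψ.source
  f_pos : ∀ p ∈ Ψ.source, 0 < f p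
  g_pos : ∀ p ∈ Ψ.source, 0 < g p
  grad_s : ∀ p ∈ Ψ.source, gradP (fun q => (Ψ q).1) p = f p • normalPerp u F p
  grad_t : ∀ p ∈ Ψ.source, gradP (fun q => (Ψ q).2) p = (g p * lenD u F p) • normalN u F p

end

/-! Two continuous fields have a continuous weak divergence: `N`, with divergence `H`, and `D N^⊥`,
the rotation of `∇u + F`, with divergence `rot F`. For such fields mollification gives the
divergence theorem on patches bounded by `C¹` curves and segments (`HasUniformDiv.flux_patch`).
Everything else is extracted from this theorem, since neither `N` nor `D` can be differentiated a
priori.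

Curvature of characteristics. Among all unit fields, `N` has extremal flux through a curve with
velocity `N^⊥`. Translating the curve therefore changes the flux of `N` only to second order, and
the divergence theorem turns this into `N' = H N^⊥` along the curve
(`HasUniformDiv.hasDerivAt_unit_field`).

Coordinates. The flux of a field `X` between two of its trajectories obeys a linear differential
equation governed by the divergence. Trajectories thus depend differentiably on their initial value
although `X` is only continuous, and `X` has a `C¹` first integral whose gradient factor `G`
satisfies `X G = -h G` (`HasUniformDiv.exists_firstIntegral`). The first integrals of `N` and `D
N^⊥` give coordinates with `∇s = f N^⊥` and `∇t = g D N`, where moreover `N f = -H f`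
(`exists_adaptedChart`).

Regularity of `N`. Let `Φ` be the inverse chart, and read vectors as complex numbers, so that `N^⊥ =
-i N`. Then `Φ_s = -i ε n` and `n_s = -i ε H n` with `ε = 1/f`, and both `ε` and `ε H` are `C¹` in
`t`, because `N f` and `N H` exist. Integrating in `s` from `a`, one finds `Φ(s₂, t) - Φ(a, t) = -i
n(a, t) q(t)` with `q ≠ 0` of class `C¹`. The left side is `C¹` in `t`, hence so is `n`
(`exists_transverse_deriv`). This gives `N ∈ C¹`.

Derivative of `D`. With `T = N^⊥` of class `C¹`, the flux of `D T` through translates of a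
characteristic has an integrand whose factor other than `D` vanishes at the curve itself, so it can
be differentiated there without differentiating `D`. The outcome is `N^⊥ D = rot F - D div N^⊥`
(`HasUniformDiv.hasDerivAt_factor`). Since `div N^⊥` is the derivative of `θ` along `N`, and `∂Φ/∂t
= N / (g D)`, the formula for `θ_t` follows. -/

/-! ### Oriented area, divergence and continuity of integrals. -/

/-- The oriented area spanned by two plane vectors. -/
def wedgeP (v w : Plane) : ℝ := v.1 * w.2 - v.2 * w.1

/-- The divergence of a plane vector field. -/
noncomputable def divP (X : Plane → Plane) (p : Plane) : ℝ :=
  (fderiv ℝ X p (1, 0)).1 + (fderiv ℝ X p (0, 1)).2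

/-- `X` has divergence `h` in the sense that on every compact subset of `Ω` both are uniform
limits of `C¹` fields and their divergences. -/
def HasUniformDiv (Ω : Set Plane) (X : Plane → Plane) (h : Plane → ℝ) : Prop :=
  ∀ K ⊆ Ω, IsCompact K → ∀ ε > 0, ∃ Y : Plane → Plane, ContDiff ℝ 1 Y ∧
    ∀ p ∈ K, ‖Y p - X p‖ ≤ ε ∧ |divP Y p - h p| ≤ ε

lemma HasUniformDiv.mono {Ω Ω' : Set Plane} {X : Plane → Plane} {h : Plane → ℝ}
    (H : HasUniformDiv Ω X h) (hs : Ω' ⊆ Ω) : HasUniformDiv Ω' X h :=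
  fun K hK => H K (hK.trans hs)

lemma continuous_wedgeP : Continuous fun z : Plane × Plane => wedgeP z.1 z.2 := by
  unfold wedgeP; fun_prop

lemma ContinuousOn.wedgeP {α : Type*} [TopologicalSpace α] {f g : α → Plane} {s : Set α}
    (hf : ContinuousOn f s) (hg : ContinuousOn g s) :
    ContinuousOn (fun x => wedgeP (f x) (g x)) s :=
  continuous_wedgeP.comp_continuousOn (hf.prodMk hg)

lemma HasDerivAt.fst' {c : ℝ → Plane} {c' : Plane} {s : ℝ} (h : HasDerivAt c c' s) :
    HasDerivAt (fun x => (c x).1) c'.1 s :=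
  (hasFDerivAt_fst (𝕜 := ℝ) (E := ℝ) (F := ℝ)).comp_hasDerivAt s h

lemma HasDerivAt.snd' {c : ℝ → Plane} {c' : Plane} {s : ℝ} (h : HasDerivAt c c' s) :
    HasDerivAt (fun x => (c x).2) c'.2 s :=
  (hasFDerivAt_snd (𝕜 := ℝ) (E := ℝ) (F := ℝ)).comp_hasDerivAt s h

lemma HasDerivAt.wedgeP {f g : ℝ → Plane} {f' g' : Plane} {x : ℝ}
    (hf : HasDerivAt f f' x) (hg : HasDerivAt g g' x) :
    HasDerivAt (fun x => wedgeP (f x) (g x)) (wedgeP f' (g x) + wedgeP (f x) g') x := by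
  unfold _root_.wedgeP
  refine ((hf.fst'.mul hg.snd').sub (hf.snd'.mul hg.fst')).congr_deriv ?_
  ring

lemma plane_eq_smul_add (v : Plane) : v = v.1 • ((1, 0) : Plane) + v.2 • ((0, 1) : Plane) := by
  ext <;> simp

lemma clm_plane_apply {E : Type*} [NormedAddCommGroup E] [NormedSpace ℝ E] (A : Plane →L[ℝ] E)
    (v : Plane) : A v = v.1 • A (1, 0) + v.2 • A (0, 1) := by
  conv_lhs => rw [plane_eq_smul_add v]
  simp only [map_add, map_smul]

/-- The trace is the infinitesimal rate of change of area under a linear map; through this identity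
the divergence enters all flux computations. -/
lemma wedgeP_map_add (A : Plane →L[ℝ] Plane) (v w : Plane) :
    wedgeP (A v) w + wedgeP v (A w) = ((A (1, 0)).1 + (A (0, 1)).2) * wedgeP v w := by
  rw [clm_plane_apply A v, clm_plane_apply A w]
  simp only [wedgeP, Prod.fst_add, Prod.snd_add, Prod.smul_fst, Prod.smul_snd, smul_eq_mul]
  ring

lemma abs_wedgeP_le (v w : Plane) : |wedgeP v w| ≤ 2 * ‖v‖ * ‖w‖ := by
  have h1 : |v.1| ≤ ‖v‖ := norm_fst_le v
  have h2 : |v.2| ≤ ‖v‖ := norm_snd_le v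
  have h3 : |w.1| ≤ ‖w‖ := norm_fst_le w
  have h4 : |w.2| ≤ ‖w‖ := norm_snd_le w
  calc |wedgeP v w| ≤ |v.1 * w.2| + |v.2 * w.1| := abs_sub _ _
    _ = |v.1| * |w.2| + |v.2| * |w.1| := by rw [abs_mul, abs_mul]
    _ ≤ ‖v‖ * ‖w‖ + ‖v‖ * ‖w‖ := by gcongr
    _ = _ := by ring

lemma wedgeP_sub_left (v v' w : Plane) : wedgeP v w - wedgeP v' w = wedgeP (v - v') w := by
  simp only [wedgeP, Prod.fst_sub, Prod.snd_sub]; ring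

/-- A function continuous on a closed rectangle agrees there with a globally continuous one. -/
lemma ContinuousOn.exists_extend_rect {E : Type*} [TopologicalSpace E] {a b c d : ℝ} (hab : a ≤ b)
    (hcd : c ≤ d) {f : ℝ × ℝ → E} (hf : ContinuousOn f (Icc a b ×ˢ Icc c d)) :
    ∃ g : ℝ × ℝ → E, Continuous g ∧ EqOn g f (Icc a b ×ˢ Icc c d) ∧
      ∀ z, ∃ z' ∈ Icc a b ×ˢ Icc c d, g z = f z' := by
  refine ⟨fun z => f ((projIcc a b hab z.1 : ℝ), (projIcc c d hcd z.2 : ℝ)), ?_, ?_, fun z =>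
    ⟨_, ⟨(projIcc a b hab z.1).2, (projIcc c d hcd z.2).2⟩, rfl⟩⟩
  · refine hf.comp_continuous (by fun_prop) fun z => ⟨Subtype.coe_prop _, Subtype.coe_prop _⟩
  · rintro ⟨x, y⟩ ⟨hx, hy⟩
    simp only at hx hy
    simp only [projIcc_of_mem hab hx, projIcc_of_mem hcd hy]

lemma ContinuousOn.slice_right {α β E : Type*} [TopologicalSpace α] [TopologicalSpace β]
    [TopologicalSpace E] {f : α × β → E} {S : Set α} {T : Set β} (hf : ContinuousOn f (S ×ˢ T))
    {s : α} (hs : s ∈ S) : ContinuousOn (fun r => f (s, r)) T :=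
  hf.comp (by fun_prop) fun _ hr => ⟨hs, hr⟩

lemma ContinuousOn.slice_left {α β E : Type*} [TopologicalSpace α] [TopologicalSpace β]
    [TopologicalSpace E] {f : α × β → E} {S : Set α} {T : Set β} (hf : ContinuousOn f (S ×ˢ T))
    {r : β} (hr : r ∈ T) : ContinuousOn (fun s => f (s, r)) S :=
  hf.comp (by fun_prop) fun _ hs => ⟨hs, hr⟩

lemma ContinuousOn.integral_snd {E : Type*} [NormedAddCommGroup E] [NormedSpace ℝ E]
    {a b c d : ℝ} (hab : a ≤ b) (hcd : c ≤ d)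
    {f : ℝ × ℝ → E} (hf : ContinuousOn f (Icc a b ×ˢ Icc c d)) :
    ContinuousOn (fun s => ∫ r in c..d, f (s, r)) (Icc a b) := by
  obtain ⟨g, hg, hgf, -⟩ := hf.exists_extend_rect hab hcd
  have : Continuous fun s => ∫ r in c..d, g (s, r) :=
    intervalIntegral.continuous_parametric_intervalIntegral_of_continuous' (by exact hg) _ _
  refine this.continuousOn.congr fun s hs => ?_
  refine intervalIntegral.integral_congr fun r hr => ?_
  rw [uIcc_of_le hcd] at hr
  exact (hgf ⟨hs, hr⟩).symm

lemma integral_swap_of_continuousOn {a b c d : ℝ} (hab : a ≤ b) (hcd : c ≤ d)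
    {f : ℝ × ℝ → ℝ} (hf : ContinuousOn f (Icc a b ×ˢ Icc c d)) :
    ∫ s in a..b, ∫ r in c..d, f (s, r) = ∫ r in c..d, ∫ s in a..b, f (s, r) := by
  refine intervalIntegral_intervalIntegral_swap (F := fun s r => f (s, r)) ?_
  rw [uIoc_of_le hab, uIoc_of_le hcd]
  exact (hf.integrableOn_compact (isCompact_Icc.prod isCompact_Icc)).mono_set
    (prod_mono Ioc_subset_Icc_self Ioc_subset_Icc_self)

/-! ### The divergence theorem on patches. -/

/-- The divergence theorem on the patch `c s + r • w s`, for a `C¹` field. -/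
lemma flux_patch_of_contDiff {Y : Plane → Plane} (hY : ContDiff ℝ 1 Y) {c w c' w' : ℝ → Plane}
    {a b : ℝ} (hab : a ≤ b) (hc : ∀ s ∈ Icc a b, HasDerivAt c (c' s) s)
    (hw : ∀ s ∈ Icc a b, HasDerivAt w (w' s) s)
    (hc' : ContinuousOn c' (Icc a b)) (hw' : ContinuousOn w' (Icc a b)) :
    (∫ s in a..b, wedgeP (Y (c s + w s)) (c' s + w' s)) - (∫ s in a..b, wedgeP (Y (c s)) (c' s))
      - ((∫ r in (0 : ℝ)..1, wedgeP (Y (c b + r • w b)) (w b))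
        - ∫ r in (0 : ℝ)..1, wedgeP (Y (c a + r • w a)) (w a))
      = ∫ s in a..b, ∫ r in (0 : ℝ)..1,
          divP Y (c s + r • w s) * wedgeP (w s) (c' s + r • w' s) := by
  have hcc : ContinuousOn c (Icc a b) := fun s hs => (hc s hs).continuousAt.continuousWithinAt
  have hwc : ContinuousOn w (Icc a b) := fun s hs => (hw s hs).continuousAt.continuousWithinAt
  set R : Set (ℝ × ℝ) := Icc a b ×ˢ Icc (0 : ℝ) 1 with hR
  have m1 : MapsTo Prod.fst R (Icc a b) := fun z hz => hz.1
  have ec : ContinuousOn (fun z : ℝ × ℝ => c z.1) R := hcc.comp continuousOn_fst m1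
  have ew : ContinuousOn (fun z : ℝ × ℝ => w z.1) R := hwc.comp continuousOn_fst m1
  have ec' : ContinuousOn (fun z : ℝ × ℝ => c' z.1) R := hc'.comp continuousOn_fst m1
  have ew' : ContinuousOn (fun z : ℝ × ℝ => w' z.1) R := hw'.comp continuousOn_fst m1
  have eΓ : ContinuousOn (fun z : ℝ × ℝ => c z.1 + z.2 • w z.1) R :=
    ec.add (continuousOn_snd.smul ew)
  have eΓs : ContinuousOn (fun z : ℝ × ℝ => c' z.1 + z.2 • w' z.1) R :=
    ec'.add (continuousOn_snd.smul ew')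
  have eA : ContinuousOn (fun z : ℝ × ℝ => fderiv ℝ Y (c z.1 + z.2 • w z.1)) R :=
    (hY.continuous_fderiv one_ne_zero).comp_continuousOn eΓ
  have eY : ContinuousOn (fun z : ℝ × ℝ => Y (c z.1 + z.2 • w z.1)) R :=
    hY.continuous.comp_continuousOn eΓ
  -- With `Γ(s, r) = c s + r • w s`, `P` is the `r`-derivative of `wedgeP (Y ∘ Γ) Γ_s` and `Q` the
  -- `s`-derivative of `wedgeP (Y ∘ Γ) Γ_r`. The mixed derivative `w'` occurs in both and cancels in
  -- `P - Q`, which leaves the divergence times the Jacobian.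
  let P : ℝ × ℝ → ℝ := fun z =>
    wedgeP (fderiv ℝ Y (c z.1 + z.2 • w z.1) (w z.1)) (c' z.1 + z.2 • w' z.1)
      + wedgeP (Y (c z.1 + z.2 • w z.1)) (w' z.1)
  let Q : ℝ × ℝ → ℝ := fun z =>
    wedgeP (fderiv ℝ Y (c z.1 + z.2 • w z.1) (c' z.1 + z.2 • w' z.1)) (w z.1)
      + wedgeP (Y (c z.1 + z.2 • w z.1)) (w' z.1)
  have hP : ContinuousOn P R := ((eA.clm_apply ew).wedgeP eΓs).add (eY.wedgeP ew')
  have hQ : ContinuousOn Q R := ((eA.clm_apply eΓs).wedgeP ew).add (eY.wedgeP ew')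
  have hPQ : ∀ z, P z - Q z
      = divP Y (c z.1 + z.2 • w z.1) * wedgeP (w z.1) (c' z.1 + z.2 • w' z.1) := by
    intro z
    rw [divP, ← wedgeP_map_add]
    simp only [P, Q, wedgeP]
    ring
  have I1 : ∀ s ∈ Icc a b, ∫ r in (0 : ℝ)..1, P (s, r)
      = wedgeP (Y (c s + w s)) (c' s + w' s) - wedgeP (Y (c s)) (c' s) := by
    intro s hs
    have := intervalIntegral.integral_eq_sub_of_hasDerivAt
      (f := fun r : ℝ => wedgeP (Y (c s + r • w s)) (c' s + r • w' s))
      (f' := fun r => P (s, r)) (a := 0) (b := 1) ?_ ?_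
    · simpa using this
    · intro r _
      have h1 : ∀ v x : Plane, HasDerivAt (fun r : ℝ => x + r • v) v r := fun v x => by
        simpa using ((hasDerivAt_id r).smul_const v).const_add x
      exact (((hY.differentiable one_ne_zero _).hasFDerivAt.comp_hasDerivAt r (h1 _ _)).wedgeP
        (h1 _ _))
    · refine ContinuousOn.intervalIntegrable ?_
      rw [uIcc_of_le zero_le_one]
      exact hP.slice_right hs
  have I2 : ∀ r ∈ Icc (0 : ℝ) 1, ∫ s in a..b, Q (s, r)
      = wedgeP (Y (c b + r • w b)) (w b) - wedgeP (Y (c a + r • w a)) (w a) := by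
    intro r hr
    refine intervalIntegral.integral_eq_sub_of_hasDerivAt
      (f := fun s : ℝ => wedgeP (Y (c s + r • w s)) (w s))
      (f' := fun s => Q (s, r)) ?_ ?_
    · intro s hs
      rw [uIcc_of_le hab] at hs
      have h1 : HasDerivAt (fun s : ℝ => c s + r • w s) (c' s + r • w' s) s :=
        (hc s hs).add ((hw s hs).const_smul r)
      exact ((hY.differentiable one_ne_zero _).hasFDerivAt.comp_hasDerivAt s h1).wedgeP (hw s hs)
    · refine ContinuousOn.intervalIntegrable ?_
      rw [uIcc_of_le hab]
      exact hQ.slice_left hr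
  have ii : ∀ {f : ℝ → ℝ}, ContinuousOn f (Icc a b) → IntervalIntegrable f volume a b :=
    fun hf => ContinuousOn.intervalIntegrable (by rwa [uIcc_of_le hab])
  have jj : ∀ {f : ℝ → ℝ}, ContinuousOn f (Icc 0 1) → IntervalIntegrable f volume 0 1 :=
    fun hf => ContinuousOn.intervalIntegrable (by rwa [uIcc_of_le zero_le_one])
  symm
  calc ∫ s in a..b, ∫ r in (0 : ℝ)..1,
          divP Y (c s + r • w s) * wedgeP (w s) (c' s + r • w' s)
      = ∫ s in a..b, ((∫ r in (0 : ℝ)..1, P (s, r)) - ∫ r in (0 : ℝ)..1, Q (s, r)) := by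
        refine intervalIntegral.integral_congr fun s hs => ?_
        rw [uIcc_of_le hab] at hs
        rw [← intervalIntegral.integral_sub]
        · simp only [hPQ]
        · exact jj (hP.slice_right hs)
        · exact jj (hQ.slice_right hs)
    _ = (∫ s in a..b, ∫ r in (0 : ℝ)..1, P (s, r)) - ∫ s in a..b, ∫ r in (0 : ℝ)..1, Q (s, r) :=
        intervalIntegral.integral_sub (ii (hP.integral_snd hab zero_le_one))
          (ii (hQ.integral_snd hab zero_le_one))
    _ = _ := by
        congr 1
        · rw [← intervalIntegral.integral_sub]
          · refine intervalIntegral.integral_congr fun s hs => ?_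
            rw [uIcc_of_le hab] at hs
            exact I1 s hs
          · exact ii ((hY.continuous.comp_continuousOn (hcc.add hwc)).wedgeP (hc'.add hw'))
          · exact ii ((hY.continuous.comp_continuousOn hcc).wedgeP hc')
        · rw [integral_swap_of_continuousOn hab zero_le_one hQ, ← intervalIntegral.integral_sub]
          · refine intervalIntegral.integral_congr fun r hr => ?_
            rw [uIcc_of_le zero_le_one] at hr
            exact I2 r hr
          all_goals
            refine Continuous.intervalIntegrable ?_ _ _
            have := hY.continuous
            exact continuous_wedgeP.comp (Continuous.prodMk (by fun_prop) continuous_const)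

lemma abs_integral_sub_le {f g : ℝ → ℝ} {a b η : ℝ} (hab : a ≤ b) (hf : ContinuousOn f (Icc a b))
    (hg : ContinuousOn g (Icc a b)) (h : ∀ x ∈ Icc a b, |f x - g x| ≤ η) :
    |(∫ x in a..b, f x) - ∫ x in a..b, g x| ≤ η * (b - a) := by
  rw [← intervalIntegral.integral_sub]
  · have := intervalIntegral.norm_integral_le_of_norm_le_const (a := a) (b := b) (C := η)
      (f := fun x => f x - g x) fun x hx => h x (by
        rw [uIoc_of_le hab] at hx; exact Ioc_subset_Icc_self hx)
    rwa [abs_of_nonneg (sub_nonneg.2 hab)] at this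
  all_goals exact ContinuousOn.intervalIntegrable (by rwa [uIcc_of_le hab])

lemma abs_sub_combination_le {a₁ a₂ a₃ a₄ a₅ b₁ b₂ b₃ b₄ b₅ x₁ x₂ x₃ x₄ x₅ : ℝ}
    (h₁ : |a₁ - b₁| ≤ x₁) (h₂ : |a₂ - b₂| ≤ x₂) (h₃ : |a₃ - b₃| ≤ x₃) (h₄ : |a₄ - b₄| ≤ x₄)
    (h₅ : |a₅ - b₅| ≤ x₅) (h : b₁ - b₂ - (b₃ - b₄) = b₅) :
    |a₁ - a₂ - (a₃ - a₄) - a₅| ≤ x₁ + x₂ + (x₃ + x₄) + x₅ := by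
  rw [abs_le] at *
  constructor <;> linarith

set_option maxHeartbeats 1000000 in
/-- The divergence theorem on the patch `c s + r • w s`, for a field with uniform divergence. -/
lemma HasUniformDiv.flux_patch {Ω : Set Plane} {X : Plane → Plane} {h : Plane → ℝ}
    (hdiv : HasUniformDiv Ω X h) (hX : ContinuousOn X Ω) (hh : ContinuousOn h Ω)
    {c w c' w' : ℝ → Plane}
    {a b : ℝ} (hab : a ≤ b) (hc : ∀ s ∈ Icc a b, HasDerivAt c (c' s) s)
    (hw : ∀ s ∈ Icc a b, HasDerivAt w (w' s) s)
    (hc' : ContinuousOn c' (Icc a b)) (hw' : ContinuousOn w' (Icc a b))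
    (hΩ : ∀ s ∈ Icc a b, ∀ r ∈ Icc (0 : ℝ) 1, c s + r • w s ∈ Ω) :
    (∫ s in a..b, wedgeP (X (c s + w s)) (c' s + w' s)) - (∫ s in a..b, wedgeP (X (c s)) (c' s))
      - ((∫ r in (0 : ℝ)..1, wedgeP (X (c b + r • w b)) (w b))
        - ∫ r in (0 : ℝ)..1, wedgeP (X (c a + r • w a)) (w a))
      = ∫ s in a..b, ∫ r in (0 : ℝ)..1,
          h (c s + r • w s) * wedgeP (w s) (c' s + r • w' s) := by
  have hcc : ContinuousOn c (Icc a b) := fun s hs => (hc s hs).continuousAt.continuousWithinAt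
  have hwc : ContinuousOn w (Icc a b) := fun s hs => (hw s hs).continuousAt.continuousWithinAt
  set R : Set (ℝ × ℝ) := Icc a b ×ˢ Icc (0 : ℝ) 1 with hR
  have hRc : IsCompact R := isCompact_Icc.prod isCompact_Icc
  have m1 : MapsTo Prod.fst R (Icc a b) := fun z hz => hz.1
  have ew : ContinuousOn (fun z : ℝ × ℝ => w z.1) R := hwc.comp continuousOn_fst m1
  have eΓ : ContinuousOn (fun z : ℝ × ℝ => c z.1 + z.2 • w z.1) R :=
    (hcc.comp continuousOn_fst m1).add (continuousOn_snd.smul ew)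
  have eΓs : ContinuousOn (fun z : ℝ × ℝ => c' z.1 + z.2 • w' z.1) R :=
    (hc'.comp continuousOn_fst m1).add (continuousOn_snd.smul (hw'.comp continuousOn_fst m1))
  have mΓ : MapsTo (fun z : ℝ × ℝ => c z.1 + z.2 • w z.1) R Ω := fun z hz => hΩ _ hz.1 _ hz.2
  obtain ⟨B1, hB1⟩ := hRc.exists_bound_of_continuousOn ew
  obtain ⟨B2, hB2⟩ := hRc.exists_bound_of_continuousOn eΓs
  set B := max 1 (max B1 B2) with hB
  have hB0 : 1 ≤ B := le_max_left _ _
  have bw : ∀ s ∈ Icc a b, ‖w s‖ ≤ B := fun s hs =>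
    (hB1 (s, 0) ⟨hs, by simp⟩).trans ((le_max_left _ _).trans (le_max_right _ _))
  have bΓ : ∀ s ∈ Icc a b, ∀ r ∈ Icc (0 : ℝ) 1, ‖c' s + r • w' s‖ ≤ B := fun s hs r hr =>
    (hB2 (s, r) ⟨hs, hr⟩).trans ((le_max_right _ _).trans (le_max_right _ _))
  have i01 : (0 : ℝ) ∈ Icc (0 : ℝ) 1 := by simp
  have i11 : (1 : ℝ) ∈ Icc (0 : ℝ) 1 := by simp
  have ia : a ∈ Icc a b := left_mem_Icc.2 hab
  have ib : b ∈ Icc a b := right_mem_Icc.2 hab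
  have ew2 : ContinuousOn (fun z : ℝ × ℝ => wedgeP (w z.1) (c' z.1 + z.2 • w' z.1)) R :=
    ew.wedgeP eΓs
  rw [← sub_eq_zero]
  refine abs_eq_zero.1 (le_antisymm (le_of_forall_pos_le_add fun δ hδ => ?_) (abs_nonneg _))
  rw [zero_add]
  -- The summands are the errors made in the five integrals when `X` and `h` are replaced by `Y` and
  -- `divP Y` up to `ε`; `B` bounds `w` and the `s`-derivative of the patch.
  obtain ⟨ε, hε, hεδ⟩ : ∃ ε > 0, 2 * ε * B * (b - a) + 2 * ε * B * (b - a)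
      + (2 * ε * B + 2 * ε * B) + ε * (2 * B * B) * (b - a) ≤ δ := by
    have hC : 0 < 2 * B * (b - a) + 2 * B * (b - a) + (2 * B + 2 * B) + (2 * B * B) * (b - a) := by
      have := sub_nonneg.2 hab
      positivity
    refine ⟨δ / (2 * B * (b - a) + 2 * B * (b - a) + (2 * B + 2 * B) + (2 * B * B) * (b - a)),
      by positivity, le_of_eq ?_⟩
    generalize hCC : 2 * B * (b - a) + 2 * B * (b - a) + (2 * B + 2 * B) + (2 * B * B) * (b - a) = C
      at hC
    have : C ≠ 0 := hC.ne'
    calc _ = δ / C * (2 * B * (b - a) + 2 * B * (b - a) + (2 * B + 2 * B)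
            + (2 * B * B) * (b - a)) := by ring
      _ = δ := by rw [hCC]; field_simp
  obtain ⟨Y, hY, hYX⟩ := hdiv _ mΓ.image_subset (hRc.image_of_continuousOn eΓ) ε hε
  have hYX' : ∀ s ∈ Icc a b, ∀ r ∈ Icc (0 : ℝ) 1, ‖X (c s + r • w s) - Y (c s + r • w s)‖ ≤ ε ∧
      |h (c s + r • w s) - divP Y (c s + r • w s)| ≤ ε := fun s hs r hr => by
    have := hYX _ (mem_image_of_mem (fun z : ℝ × ℝ => c z.1 + z.2 • w z.1)
      (show (s, r) ∈ R from ⟨hs, hr⟩))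
    rwa [norm_sub_rev, abs_sub_comm] at this
  have key := flux_patch_of_contDiff hY hab hc hw hc' hw'
  have wle : ∀ {u v : Plane}, ‖u‖ ≤ ε → ‖v‖ ≤ B → |wedgeP u v| ≤ 2 * ε * B := fun hu hv =>
    (abs_wedgeP_le _ _).trans (by gcongr)
  have c1 : ContinuousOn (fun s => c s + w s) (Icc a b) := hcc.add hwc
  have m0 : ∀ s ∈ Icc a b, c s ∈ Ω := fun s hs => by simpa using hΩ s hs 0 i01
  have m1' : ∀ s ∈ Icc a b, c s + w s ∈ Ω := fun s hs => by simpa using hΩ s hs 1 i11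
  have d1 := abs_integral_sub_le (η := 2 * ε * B) hab
    (f := fun s => wedgeP (X (c s + w s)) (c' s + w' s))
    (g := fun s => wedgeP (Y (c s + w s)) (c' s + w' s))
    ((hX.comp c1 m1').wedgeP (hc'.add hw'))
    ((hY.continuous.comp_continuousOn c1).wedgeP (hc'.add hw')) fun s hs => by
      rw [wedgeP_sub_left]
      exact wle (by simpa using (hYX' s hs 1 i11).1) (by simpa using bΓ s hs 1 i11)
  have d2 := abs_integral_sub_le (η := 2 * ε * B) hab
    (f := fun s => wedgeP (X (c s)) (c' s)) (g := fun s => wedgeP (Y (c s)) (c' s))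
    ((hX.comp hcc m0).wedgeP hc')
    ((hY.continuous.comp_continuousOn hcc).wedgeP hc') fun s hs => by
      rw [wedgeP_sub_left]
      exact wle (by simpa using (hYX' s hs 0 i01).1) (by simpa using bΓ s hs 0 i01)
  have d3 : ∀ s ∈ Icc a b, |(∫ r in (0 : ℝ)..1, wedgeP (X (c s + r • w s)) (w s))
      - ∫ r in (0 : ℝ)..1, wedgeP (Y (c s + r • w s)) (w s)| ≤ 2 * ε * B := fun s hs => by
    have := abs_integral_sub_le (η := 2 * ε * B) zero_le_one
      (f := fun r : ℝ => wedgeP (X (c s + r • w s)) (w s))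
      (g := fun r : ℝ => wedgeP (Y (c s + r • w s)) (w s))
      ((hX.comp (by fun_prop) fun r hr => hΩ s hs r hr).wedgeP continuousOn_const)
      ((hY.continuous.comp_continuousOn (by fun_prop)).wedgeP continuousOn_const) fun r hr => by
        rw [wedgeP_sub_left]
        exact wle (hYX' s hs r hr).1 (bw s hs)
    simpa using this
  have hdY : Continuous (divP Y) := by
    have := hY.continuous_fderiv one_ne_zero
    unfold divP
    fun_prop
  have e1 : ContinuousOn (fun z : ℝ × ℝ => h (c z.1 + z.2 • w z.1)
      * wedgeP (w z.1) (c' z.1 + z.2 • w' z.1)) R := (hh.comp eΓ mΓ).mul ew2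
  have e2 : ContinuousOn (fun z : ℝ × ℝ => divP Y (c z.1 + z.2 • w z.1)
      * wedgeP (w z.1) (c' z.1 + z.2 • w' z.1)) R := (hdY.comp_continuousOn eΓ).mul ew2
  have wBB : ∀ s ∈ Icc a b, ∀ r ∈ Icc (0 : ℝ) 1,
      |wedgeP (w s) (c' s + r • w' s)| ≤ 2 * B * B := fun s hs r hr =>
    (abs_wedgeP_le _ _).trans (by
      have h1 := bw s hs
      have h2 := bΓ s hs r hr
      gcongr)
  have d4 := abs_integral_sub_le (η := ε * (2 * B * B)) hab
    (e1.integral_snd hab zero_le_one) (e2.integral_snd hab zero_le_one) fun s hs => by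
      have := abs_integral_sub_le (η := ε * (2 * B * B)) zero_le_one
        (f := fun r : ℝ => h (c s + r • w s) * wedgeP (w s) (c' s + r • w' s))
        (g := fun r : ℝ => divP Y (c s + r • w s) * wedgeP (w s) (c' s + r • w' s))
        (e1.slice_right hs) (e2.slice_right hs)
        fun r hr => by
          rw [← sub_mul, abs_mul]
          exact mul_le_mul (hYX' s hs r hr).2 (wBB s hs r hr) (abs_nonneg _) hε.le
      simpa using this
  exact (abs_sub_combination_le d1 d2 (d3 b ib) (d3 a ia) d4 key).trans hεδ

/-! ### From weak to uniform divergence, by mollification. -/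

open scoped Convolution in
/-- Mollification of a locally integrable field by a smooth kernel, with its derivative. -/
lemma mollify_hasFDerivAt {η : Plane → ℝ} (hη : ContDiff ℝ ∞ η) (hc : HasCompactSupport η)
    {g : Plane → Plane} (hg : LocallyIntegrable g) :
    ContDiff ℝ 1 (η ⋆[ContinuousLinearMap.lsmul ℝ ℝ, volume] g) ∧
    ∀ p v, fderiv ℝ (η ⋆[ContinuousLinearMap.lsmul ℝ ℝ, volume] g) p v
      = ∫ q, fderiv ℝ η (p - q) v • g q := by
  have h1 : ContDiff ℝ 1 η := hη.of_le (by exact_mod_cast le_top)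
  refine ⟨hc.contDiff_convolution_left _ (n := 1) h1 hg, fun p v => ?_⟩
  rw [← convolution_flip, (hc.hasFDerivAt_convolution_right _ hg h1 p).fderiv,
    convolution_precompR_apply _ hg (hc.fderiv ℝ) (h1.continuous_fderiv one_ne_zero)]
  rfl

lemma setIntegral_eq_integral_of_eqOn {Ω : Set Plane} (hΩ : IsOpen Ω) {f g : Plane → ℝ}
    (h : EqOn f g Ω) (hg : ∀ q ∉ Ω, g q = 0) : ∫ q in Ω, f q = ∫ q, g q := by
  rw [setIntegral_congr_fun hΩ.measurableSet h,
    setIntegral_eq_integral_of_forall_compl_eq_zero hg]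

open scoped Convolution in
/-- A weak divergence is a uniform divergence. -/
lemma hasUniformDiv_of_weak {Ω : Set Plane} (hΩ : IsOpen Ω) {X : Plane → Plane} {h : Plane → ℝ}
    (hX : ContinuousOn X Ω) (hh : ContinuousOn h Ω)
    (hw : ∀ φ : Plane → ℝ, IsTestFun Ω φ →
      (∫ p in Ω, dotP (X p) (gradP φ p)) + (∫ p in Ω, h p * φ p) = 0) :
    HasUniformDiv Ω X h := by
  intro K hKΩ hK ε hε
  obtain ⟨δ, hδ, hδΩ⟩ := hK.exists_cthickening_subset_open hΩ hKΩ
  set K' := Metric.cthickening δ K with hK'def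
  have hK' : IsCompact K' := hK.cthickening
  obtain ⟨δ₁, hδ₁, hu₁⟩ := Metric.uniformContinuousOn_iff.1
    (hK'.uniformContinuousOn_of_continuous (hX.mono hδΩ)) ε hε
  obtain ⟨δ₂, hδ₂, hu₂⟩ := Metric.uniformContinuousOn_iff.1
    (hK'.uniformContinuousOn_of_continuous (hh.mono hδΩ)) ε hε
  set r := min δ (min δ₁ δ₂) with hr
  have hr0 : 0 < r := lt_min hδ (lt_min hδ₁ hδ₂)
  let b : ContDiffBump (0 : Plane) := ⟨r / 2, r, by linarith, by linarith⟩
  set η : Plane → ℝ := b.normed volume with hηdef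
  have hη : ContDiff ℝ ∞ η := b.contDiff_normed
  have hηc : HasCompactSupport η := b.hasCompactSupport_normed
  -- Cutting off outside `K'` makes the fields integrable. The mollification at a point of `K` only
  -- sees values at distance less than `r`, which lie in `K'`.
  set Xi : Plane → Plane := K'.indicator X with hXi
  set hi : Plane → ℝ := K'.indicator h with hhi
  have iX : Integrable Xi :=
    ((hX.mono hδΩ).integrableOn_compact hK').integrable_indicator hK'.measurableSet
  have ih : Integrable hi :=
    ((hh.mono hδΩ).integrableOn_compact hK').integrable_indicator hK'.measurableSet
  obtain ⟨hY, hdY⟩ := mollify_hasFDerivAt hη hηc iX.locallyIntegrable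
  have ball_sub : ∀ p ∈ K, Metric.closedBall p r ⊆ K' := fun p hp q hq =>
    Metric.mem_cthickening_of_dist_le q p δ K hp (le_trans hq (min_le_left _ _))
  refine ⟨_, hY, fun p hp => ?_⟩
  have hpK' : p ∈ K' := ball_sub p hp (Metric.mem_closedBall_self hr0.le)
  have hball : ∀ q ∈ Metric.ball p r, q ∈ K' := fun q hq =>
    ball_sub p hp (Metric.ball_subset_closedBall hq)
  constructor
  · rw [← dist_eq_norm, ← indicator_of_mem hpK' X]
    refine b.dist_normed_convolution_le iX.aestronglyMeasurable fun q hq => ?_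
    rw [hXi, indicator_of_mem (hball q hq), indicator_of_mem hpK']
    exact (hu₁ q (hball q hq) p hpK' (lt_of_lt_of_le hq
      ((min_le_right _ _).trans (min_le_left _ _)))).le
  -- The kernel centred at `p` is an admissible test function, and its gradient in `q` is minus that
  -- of `η` at `p - q`. The weak equation for it says that the divergence of the mollified field at
  -- `p` is the mollification of `h` at `p`.
  · let ψ : Plane → ℝ := fun q => η (p - q)
    have hψs : tsupport ψ ⊆ Metric.closedBall p r := by
      refine closure_minimal (fun q hq => ?_) Metric.isClosed_closedBall
      have : p - q ∈ Function.support (b.normed volume) := hq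
      rw [b.support_normed_eq, mem_ball_zero_iff] at this
      rw [Metric.mem_closedBall, dist_comm, dist_eq_norm]
      exact this.le
    have hψ : IsTestFun Ω ψ := by
      refine ⟨hη.comp (contDiff_const.sub contDiff_id), ?_, ?_⟩
      · exact (isCompact_closedBall p r).of_isClosed_subset (isClosed_tsupport _) hψs
      · exact hψs.trans ((ball_sub p hp).trans hδΩ)
    have hψd : ∀ q v, fderiv ℝ ψ q v = - fderiv ℝ η (p - q) v := by
      intro q v
      have h1 : HasFDerivAt (fun q : Plane => p - q) (-ContinuousLinearMap.id ℝ Plane) q :=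
        (hasFDerivAt_id q).const_sub p
      have h2 : HasFDerivAt ψ ((fderiv ℝ η (p - q)).comp (-ContinuousLinearMap.id ℝ Plane)) q :=
        (hη.differentiable (by simp) (p - q)).hasFDerivAt.comp q h1
      rw [h2.fderiv]
      simp
    have hψ0 : ∀ q ∉ K', ψ q = 0 ∧ ∀ v, fderiv ℝ ψ q v = 0 := by
      intro q hq
      have hq' : q ∉ tsupport ψ := fun hh => hq (ball_sub p hp (hψs hh))
      refine ⟨image_eq_zero_of_notMem_tsupport hq', fun v => ?_⟩
      have : fderiv ℝ ψ q = 0 :=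
        image_eq_zero_of_notMem_tsupport fun hh => hq' (tsupport_fderiv_subset ℝ hh)
      rw [this]; rfl
    have e1 : ∫ q in Ω, dotP (X q) (gradP ψ q) = ∫ q, dotP (Xi q) (gradP ψ q) := by
      refine setIntegral_eq_integral_of_eqOn hΩ (fun q _ => ?_) fun q hq => ?_
      · by_cases hq : q ∈ K'
        · simp only [hXi, indicator_of_mem hq]
        · simp only [dotP, gradP, (hψ0 q hq).2, mul_zero]
      · simp only [dotP, gradP, (hψ0 q fun hh => hq (hδΩ hh)).2, mul_zero, add_zero]
    have e2 : ∫ q in Ω, h q * ψ q = ∫ q, hi q * ψ q := by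
      refine setIntegral_eq_integral_of_eqOn hΩ (fun q _ => ?_) fun q hq => ?_
      · by_cases hq : q ∈ K'
        · simp only [hhi, indicator_of_mem hq]
        · simp only [(hψ0 q hq).1, mul_zero]
      · simp only [(hψ0 q fun hh => hq (hδΩ hh)).1, mul_zero]
    have hwψ := hw ψ hψ
    rw [e1, e2] at hwψ
    have ii : ∀ v, Integrable fun q => fderiv ℝ η (p - q) v • Xi q := by
      intro v
      obtain ⟨C, hC⟩ := (hηc.fderiv ℝ).exists_bound_of_continuous
        (hη.continuous_fderiv (by simp))
      have hc1 : Continuous fun q => fderiv ℝ η (p - q) v :=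
        ((hη.continuous_fderiv (by simp)).comp (continuous_const.sub continuous_id)).clm_apply
          continuous_const
      refine iX.bdd_smul (C := C * ‖v‖) hc1.aestronglyMeasurable
        (Filter.Eventually.of_forall fun q => ?_)
      exact (ContinuousLinearMap.le_opNorm _ _).trans
        (mul_le_mul_of_nonneg_right (hC _) (norm_nonneg _))
    have hdiv : divP (η ⋆[ContinuousLinearMap.lsmul ℝ ℝ, volume] Xi) p = ∫ q, hi q * ψ q := by
      rw [divP, hdY, hdY, fst_integral (ii _), snd_integral (ii _), ← integral_add (ii _).fst
        (ii _).snd]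
      rw [eq_neg_of_add_eq_zero_right hwψ, ← integral_neg]
      refine integral_congr_ae (Filter.Eventually.of_forall fun q => ?_)
      simp only [dotP, gradP, hψd, Prod.smul_fst, Prod.smul_snd, smul_eq_mul]
      ring
    rw [hdiv]
    have e3 : ∫ q, hi q * ψ q = (η ⋆[ContinuousLinearMap.lsmul ℝ ℝ, volume] hi) p := by
      rw [convolution_lsmul_swap]
      refine integral_congr_ae (Filter.Eventually.of_forall fun q => ?_)
      simp only [ψ, smul_eq_mul, mul_comm]
    rw [e3, ← Real.dist_eq, ← indicator_of_mem hpK' h]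
    refine b.dist_normed_convolution_le ih.aestronglyMeasurable fun q hq => ?_
    rw [hhi, indicator_of_mem (hball q hq), indicator_of_mem hpK']
    exact (hu₂ q (hball q hq) p hpK' (lt_of_lt_of_le hq
      ((min_le_right _ _).trans (min_le_right _ _)))).le

/-! ### The weak divergence of the rotated field. -/

/-- Integration by parts against a test function. -/
lemma integral_fderiv_mul_test {Ω : Set Plane} (hΩ : IsOpen Ω) {w : Plane → ℝ}
    (hw : ContDiffOn ℝ 1 w Ω) {φ : Plane → ℝ} (hφ : ContDiff ℝ 1 φ) (hc : HasCompactSupport φ)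
    (hs : tsupport φ ⊆ Ω) (v : Plane) :
    IntegrableOn (fun p => fderiv ℝ w p v * φ p) Ω ∧
    IntegrableOn (fun p => w p * fderiv ℝ φ p v) Ω ∧
    ∫ p in Ω, w p * fderiv ℝ φ p v = - ∫ p in Ω, fderiv ℝ w p v * φ p := by
  have cd : ContinuousOn (fun p => fderiv ℝ w p v) Ω :=
    (hw.continuousOn_fderiv_of_isOpen hΩ le_rfl).clm_apply continuousOn_const
  have cφ : Continuous fun p => fderiv ℝ φ p v :=
    (hφ.continuous_fderiv one_ne_zero).clm_apply continuous_const
  have supp1 : Function.support φ ⊆ tsupport φ := subset_tsupport φ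
  have supp2 : Function.support (fun p => fderiv ℝ φ p v) ⊆ tsupport φ := fun p hp => by
    by_contra h
    apply hp
    have : fderiv ℝ φ p = 0 :=
      image_eq_zero_of_notMem_tsupport fun hh => h (tsupport_fderiv_subset ℝ hh)
    simp [this]
  have key : ∀ {f g : Plane → ℝ}, ContinuousOn f Ω → Continuous g →
      Function.support g ⊆ tsupport φ → Integrable (fun p => f p * g p) := by
    intro f g hf hg hsg
    refine (integrableOn_iff_integrable_of_support_subset (s := tsupport φ) ?_).1
      (((hf.mono hs).mul hg.continuousOn).integrableOn_compact hc)
    exact fun p hp => hsg fun h0 => hp (by simp [h0])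
  have i1 := key cd hφ.continuous supp1
  have i2 := key hw.continuousOn cφ supp2
  have i3 := key hw.continuousOn hφ.continuous supp1
  refine ⟨i1.integrableOn, i2.integrableOn, ?_⟩
  rw [setIntegral_eq_integral_of_forall_compl_eq_zero fun p hp => ?_,
    setIntegral_eq_integral_of_forall_compl_eq_zero fun p hp => ?_]
  · exact integral_mul_fderiv_eq_neg_fderiv_mul_of_integrable i1 i2 i3
      (fun p hp => (hw.differentiableOn one_ne_zero).differentiableAt (hΩ.mem_nhds (hs hp)))
      fun p _ => hφ.differentiable one_ne_zero p
  · by_contra h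
    exact hp (hs (supp1 (right_ne_zero_of_mul h)))
  · by_contra h
    exact hp (hs (supp2 (right_ne_zero_of_mul h)))

/-- The rotated field `(V₂, -V₁)` of `V = ∇u + F` has weak divergence `rot F`. -/
lemma weak_div_perp_shiftedGrad {Ω : Set Plane} (hΩ : IsOpen Ω) {u : Plane → ℝ}
    {F : Plane → Plane} (hu : ContDiffOn ℝ 1 u Ω) (hF : ContDiffOn ℝ 1 F Ω) {φ : Plane → ℝ}
    (hφ : IsTestFun Ω φ) :
    (∫ p in Ω, dotP (perpP (shiftedGrad u F p)) (gradP φ p)) + (∫ p in Ω, rotP F p * φ p) = 0 := by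
  obtain ⟨hφ, hc, hs⟩ := hφ
  have h1 : ContDiff ℝ 1 φ := hφ.of_le (by exact_mod_cast le_top)
  have h2 : ContDiff ℝ 2 φ := contDiff_infty.1 hφ 2
  have hd : ∀ v, ContDiff ℝ 1 fun p => fderiv ℝ φ p v := fun v =>
    (h2.fderiv_right (m := 1) one_add_one_eq_two.le).clm_apply contDiff_const
  have hts : ∀ v, tsupport (fun p => fderiv ℝ φ p v) ⊆ tsupport φ := fun v =>
    (tsupport_fderiv_apply_subset ℝ v)
  have hdc : ∀ v, HasCompactSupport fun p => fderiv ℝ φ p v := fun v =>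
    hc.of_isClosed_subset (isClosed_tsupport _) (hts v)
  -- Since `u` is only `C¹`, the derivatives are moved from `u` onto the first derivatives of `φ`;
  -- the two resulting second-order terms cancel by symmetry (`sym`).
  have A := fun v w => integral_fderiv_mul_test hΩ hu (hd v) (hdc v) ((hts v).trans hs) w
  have B1 := fun v => integral_fderiv_mul_test hΩ hF.fst h1 hc hs v
  have B2 := fun v => integral_fderiv_mul_test hΩ hF.snd h1 hc hs v
  obtain ⟨a1, a2, a3⟩ := A (1, 0) (0, 1)
  obtain ⟨b1, b2, b3⟩ := A (0, 1) (1, 0)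
  obtain ⟨c1, c2, c3⟩ := B1 (0, 1)
  obtain ⟨d1, d2, d3⟩ := B2 (1, 0)
  have sym : ∀ p, fderiv ℝ (fun q => fderiv ℝ φ q (1, 0)) p (0, 1)
      = fderiv ℝ (fun q => fderiv ℝ φ q (0, 1)) p (1, 0) := by
    intro p
    have hdd : DifferentiableAt ℝ (fderiv ℝ φ) p :=
      (h2.fderiv_right (m := 1) one_add_one_eq_two.le).differentiable one_ne_zero p
    have hsym : IsSymmSndFDerivAt ℝ φ p := h2.contDiffAt.isSymmSndFDerivAt (by simp)
    rw [fderiv_clm_apply hdd (by fun_prop), fderiv_clm_apply hdd (by fun_prop)]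
    simpa using hsym _ _
  have e : ∀ p ∈ Ω, dotP (perpP (shiftedGrad u F p)) (gradP φ p)
      = (fderiv ℝ u p (0, 1) * fderiv ℝ φ p (1, 0) - fderiv ℝ u p (1, 0) * fderiv ℝ φ p (0, 1))
        + ((F p).2 * fderiv ℝ φ p (1, 0) - (F p).1 * fderiv ℝ φ p (0, 1)) := by
    intro p _
    simp only [dotP, perpP, shiftedGrad, gradP, Prod.fst_add, Prod.snd_add]
    ring
  have e' : ∀ p ∈ Ω, rotP F p * φ p = fderiv ℝ (fun q => (F q).2) p (1, 0) * φ p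
      - fderiv ℝ (fun q => (F q).1) p (0, 1) * φ p := by
    intro p hp
    have hFp : DifferentiableAt ℝ F p :=
      (hF.differentiableOn one_ne_zero).differentiableAt (hΩ.mem_nhds hp)
    rw [rotP, fderiv.fst hFp, fderiv.snd hFp]
    simp [sub_mul]
  have s1 := integral_add (a1.sub b1) (d2.sub c2)
  have s2 := integral_sub a1 b1
  have s3 := integral_sub d2 c2
  have s4 := integral_sub d1 c1
  simp only [Pi.sub_apply] at s1
  rw [setIntegral_congr_fun hΩ.measurableSet e, setIntegral_congr_fun hΩ.measurableSet e',
    s1, s2, s3, s4]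
  simp only [sym] at a3
  linarith

/-! ### Variation of the flux under translations, and the curvature equation for unit fields. -/

open Filter Topology in
/-- Averages of a continuous function over shrinking segments are continuous. -/
lemma tendsto_integral_integral_mul {a b δ : ℝ} (hab : a ≤ b) (hδ : 0 < δ) {k : ℝ × ℝ → ℝ}
    (hk : ContinuousOn k (Icc (-δ) δ ×ˢ Icc a b)) :
    Tendsto (fun ρ => ∫ s in a..b, ∫ r in (0 : ℝ)..1, k (r * ρ, s)) (𝓝 0)
      (𝓝 (∫ s in a..b, k (0, s))) := by
  obtain ⟨g, hg, hgk, -⟩ := hk.exists_extend_rect (by linarith) hab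
  have h1 : Continuous fun z : ℝ × ℝ => ∫ r in (0 : ℝ)..1, g (r * z.1, z.2) :=
    intervalIntegral.continuous_parametric_intervalIntegral_of_continuous'
      (f := fun (z : ℝ × ℝ) r => g (r * z.1, z.2))
      (hg.comp (by fun_prop)) _ _
  have h2 : Continuous fun ρ : ℝ => ∫ s in a..b, ∫ r in (0 : ℝ)..1, g (r * ρ, s) :=
    intervalIntegral.continuous_parametric_intervalIntegral_of_continuous'
      (f := fun ρ s => ∫ r in (0 : ℝ)..1, g (r * ρ, s)) (by exact h1) _ _
  have h3 := h2.tendsto 0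
  have e0 : ∫ s in a..b, ∫ r in (0 : ℝ)..1, g (r * 0, s) = ∫ s in a..b, k (0, s) := by
    refine intervalIntegral.integral_congr fun s hs => ?_
    rw [uIcc_of_le hab] at hs
    simp only [mul_zero, intervalIntegral.integral_const, sub_zero, one_smul]
    exact hgk ⟨⟨by linarith, hδ.le⟩, hs⟩
  rw [e0] at h3
  refine h3.congr' ?_
  filter_upwards [Icc_mem_nhds (neg_lt_zero.2 hδ) hδ] with ρ hρ
  refine intervalIntegral.integral_congr fun s hs => ?_
  refine intervalIntegral.integral_congr fun r hr => ?_
  rw [uIcc_of_le hab] at hs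
  rw [uIcc_of_le zero_le_one] at hr
  refine hgk ⟨⟨?_, ?_⟩, hs⟩
  · nlinarith [hr.1, hr.2, hρ.1, hρ.2]
  · nlinarith [hr.1, hr.2, hρ.1, hρ.2]

open Filter Topology in
/-- The derivative of the flux through a curve under translation of the curve. -/
lemma HasUniformDiv.hasDerivAt_flux {Ω : Set Plane} (hΩ : IsOpen Ω) {X : Plane → Plane}
    {h : Plane → ℝ} (hdiv : HasUniformDiv Ω X h) (hX : ContinuousOn X Ω) (hh : ContinuousOn h Ω)
    {c c' : ℝ → Plane} {a b : ℝ} (hab : a ≤ b) (hc : ∀ s ∈ Icc a b, HasDerivAt c (c' s) s)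
    (hc' : ContinuousOn c' (Icc a b)) (hcΩ : MapsTo c (Icc a b) Ω) (v : Plane) :
    HasDerivAt (fun ρ : ℝ => ∫ s in a..b, wedgeP (X (c s + ρ • v)) (c' s))
      (wedgeP (X (c b)) v - wedgeP (X (c a)) v + ∫ s in a..b, h (c s) * wedgeP v (c' s)) 0 := by
  have hcc : ContinuousOn c (Icc a b) := fun s hs => (hc s hs).continuousAt.continuousWithinAt
  obtain ⟨δ₀, hδ₀, hδΩ⟩ := (isCompact_Icc.image_of_continuousOn hcc).exists_cthickening_subset_open
    hΩ hcΩ.image_subset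
  set δ := δ₀ / (‖v‖ + 1) with hδdef
  have hv1 : 0 < ‖v‖ + 1 := by positivity
  have hδ : 0 < δ := by positivity
  have hin : ∀ ρ ∈ Icc (-δ) δ, ∀ s ∈ Icc a b, c s + ρ • v ∈ Ω := fun ρ hρ s hs => by
    refine hδΩ (Metric.mem_cthickening_of_dist_le _ (c s) _ _ (mem_image_of_mem _ hs) ?_)
    rw [dist_eq_norm, add_sub_cancel_left, norm_smul, Real.norm_eq_abs]
    calc |ρ| * ‖v‖ ≤ δ * (‖v‖ + 1) := by
          have := abs_le.2 hρ
          gcongr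
          linarith
      _ = δ₀ := by rw [hδdef]; field_simp
  have m2 : MapsTo Prod.snd (Icc (-δ) δ ×ˢ Icc a b) (Icc a b) := fun z hz => hz.2
  have eΓ : ContinuousOn (fun z : ℝ × ℝ => c z.2 + z.1 • v) (Icc (-δ) δ ×ˢ Icc a b) :=
    (hcc.comp continuousOn_snd m2).add (by fun_prop)
  have mΓ : MapsTo (fun z : ℝ × ℝ => c z.2 + z.1 • v) (Icc (-δ) δ ×ˢ Icc a b) Ω :=
    fun z hz => hin _ hz.1 _ hz.2
  have k1 : ContinuousOn (fun z : ℝ × ℝ => wedgeP (X (c z.2 + z.1 • v)) v)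
      (Icc (-δ) δ ×ˢ Icc a b) := (hX.comp eΓ mΓ).wedgeP continuousOn_const
  have k2 : ContinuousOn (fun z : ℝ × ℝ => h (c z.2 + z.1 • v) * wedgeP v (c' z.2))
      (Icc (-δ) δ ×ˢ Icc a b) :=
    (hh.comp eΓ mΓ).mul (continuousOn_const.wedgeP (hc'.comp continuousOn_snd m2))
  have side : ∀ s ∈ Icc a b, Tendsto (fun ρ : ℝ => ∫ r in (0 : ℝ)..1,
      wedgeP (X (c s + (r * ρ) • v)) v) (𝓝 0) (𝓝 (wedgeP (X (c s)) v)) := by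
    intro s hs
    have := tendsto_integral_integral_mul (a := 0) (b := 1) zero_le_one hδ
      (k := fun z => wedgeP (X (c s + z.1 • v)) v)
      ((k1.slice_left hs).comp continuousOn_fst fun z hz => hz.1)
    simpa using this
  have lim := ((side b (right_mem_Icc.2 hab)).sub (side a (left_mem_Icc.2 hab))).add
    (tendsto_integral_integral_mul hab hδ k2)
  simp only [zero_smul, add_zero] at lim
  rw [hasDerivAt_iff_tendsto_slope]
  refine (lim.mono_left nhdsWithin_le_nhds).congr' ?_
  filter_upwards [self_mem_nhdsWithin, mem_nhdsWithin_of_mem_nhds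
    (Icc_mem_nhds (neg_lt_zero.2 hδ) hδ)] with ρ hρ0 hρ
  -- The patch swept out by the translation has constant `w = ρ • v`, so its side and area terms all
  -- carry a factor `ρ`. After division by `ρ` the slope is a sum of averages over shrinking
  -- segments.
  have key := hdiv.flux_patch hX hh (w := fun _ => ρ • v) (w' := fun _ => 0) hab hc
    (fun s _ => hasDerivAt_const s _) hc' continuousOn_const (fun s hs r hr => by
      rw [smul_smul]
      refine hin _ ⟨?_, ?_⟩ s hs
      · nlinarith [hr.1, hr.2, hρ.1, hρ.2]
      · nlinarith [hr.1, hr.2, hρ.1, hρ.2])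
  have wr : ∀ x, wedgeP x (ρ • v) = ρ * wedgeP x v := fun x => by
    simp only [wedgeP, Prod.smul_fst, Prod.smul_snd, smul_eq_mul]; ring
  have wl : ∀ (y : ℝ) x, y * wedgeP (ρ • v) x = ρ * (y * wedgeP v x) := fun y x => by
    simp only [wedgeP, Prod.smul_fst, Prod.smul_snd, smul_eq_mul]; ring
  simp only [smul_zero, add_zero, smul_smul, wr, wl, intervalIntegral.integral_const_mul] at key
  rw [slope_def_field, sub_zero, eq_div_iff hρ0]
  simp only [zero_smul, add_zero]
  linear_combination -key

open Filter Topology in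
lemma hasDerivAt_of_integral_eq {E : Type*} [NormedAddCommGroup E] [NormedSpace ℝ E]
    [CompleteSpace E] {f k : ℝ → E} {a b s : ℝ} (hk : ContinuousOn k (Ioo a b))
    (hs : s ∈ Ioo a b)
    (h : ∀ x ∈ Ioo a b, ∀ y ∈ Ioo a b, x ≤ y → f y - f x = ∫ z in x..y, k z) :
    HasDerivAt f (k s) s := by
  -- The base point lies strictly to the left of `s`, so that all points near `s` are on its right,
  -- where `h` applies.
  obtain ⟨x, hx⟩ := exists_between hs.1
  have hxm : x ∈ Ioo a b := ⟨hx.1, hx.2.trans hs.2⟩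
  have hsub : uIcc x s ⊆ Ioo a b := by
    rw [uIcc_of_le hx.2.le]; exact Icc_subset_Ioo hx.1 hs.2
  have h1 : HasDerivAt (fun y => f x + ∫ z in x..y, k z) (k s) s := by
    refine HasDerivAt.const_add _ (intervalIntegral.integral_hasDerivAt_right
      ((hk.mono hsub).intervalIntegrable) ?_ (hk.continuousAt (Ioo_mem_nhds hs.1 hs.2)))
    exact hk.stronglyMeasurableAtFilter isOpen_Ioo _ hs
  refine h1.congr_of_eventuallyEq ?_
  filter_upwards [Ioo_mem_nhds hx.2 hs.2] with y hy
  rw [← h x hxm y ⟨hx.1.trans hy.1, hy.2⟩ hy.1.le]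
  abel

open Filter Topology in
/-- A continuous unit field `N` with divergence `H` satisfies `N' = e H N^⊥` along every curve
whose velocity is `e N^⊥`, `0 ≤ e`: the flux of `N` through the translates of the curve is
extremal at the curve itself. -/
lemma HasUniformDiv.hasDerivAt_unit_field {Ω : Set Plane} (hΩ : IsOpen Ω) {N : Plane → Plane}
    {H : Plane → ℝ} (hdiv : HasUniformDiv Ω N H) (hN : ContinuousOn N Ω) (hH : ContinuousOn H Ω)
    (hunit : ∀ p ∈ Ω, (N p).1 ^ 2 + (N p).2 ^ 2 = 1)
    {c : ℝ → Plane} {e : ℝ → ℝ} {a b : ℝ} (hcΩ : MapsTo c (Ioo a b) Ω)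
    (hc : ∀ s ∈ Ioo a b, HasDerivAt c (e s • perpP (N (c s))) s)
    (he : ContinuousOn e (Ioo a b)) (he0 : ∀ s ∈ Ioo a b, 0 ≤ e s) {s : ℝ} (hs : s ∈ Ioo a b) :
    HasDerivAt (fun s => N (c s)) ((e s * H (c s)) • perpP (N (c s))) s := by
  have hcc : ContinuousOn c (Ioo a b) := fun s hs => (hc s hs).continuousAt.continuousWithinAt
  have hNc : ContinuousOn (fun s => N (c s)) (Ioo a b) := hN.comp hcc hcΩ
  have hperp : ContinuousOn (fun s => perpP (N (c s))) (Ioo a b) := by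
    unfold perpP; exact hNc.snd.prodMk hNc.fst.neg
  have hc' : ContinuousOn (fun s => e s • perpP (N (c s))) (Ioo a b) := he.smul hperp
  have key : ∀ v : Plane, ∀ x ∈ Ioo a b, ∀ y ∈ Ioo a b, x ≤ y →
      wedgeP (N (c y)) v - wedgeP (N (c x)) v
        = ∫ z in x..y, -(H (c z) * wedgeP v (e z • perpP (N (c z)))) := by
    intro v x hx y hy hxy
    have hsub : Icc x y ⊆ Ioo a b := Icc_subset_Ioo hx.1 hy.2
    have hd := hdiv.hasDerivAt_flux hΩ hN hH hxy (fun s hs => hc s (hsub hs)) (hc'.mono hsub)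
      (hcΩ.mono_left hsub) v
    have hmin : IsLocalMin (fun ρ : ℝ => ∫ s in x..y,
        wedgeP (N (c s + ρ • v)) (e s • perpP (N (c s)))) 0 := by
      obtain ⟨δ₀, hδ₀, hδΩ⟩ := (isCompact_Icc.image_of_continuousOn
        (hcc.mono hsub)).exists_cthickening_subset_open hΩ (hcΩ.mono_left hsub).image_subset
      have hev : ∀ᶠ ρ : ℝ in 𝓝 0, ‖ρ • v‖ ≤ δ₀ := by
        have : Continuous fun ρ : ℝ => ‖ρ • v‖ := by fun_prop
        exact this.continuousAt.eventually (Iic_mem_nhds (by simpa using hδ₀))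
      filter_upwards [hev] with ρ hρ
      have hin : ∀ s ∈ Icc x y, c s + ρ • v ∈ Ω := fun s hs =>
        hδΩ (Metric.mem_cthickening_of_dist_le _ (c s) _ _ (mem_image_of_mem _ hs) (by
          rwa [dist_eq_norm, add_sub_cancel_left]))
      simp only [zero_smul, add_zero]
      refine intervalIntegral.integral_mono_on hxy ?_ ?_ fun s hs => ?_
      · refine ContinuousOn.intervalIntegrable ?_
        rw [uIcc_of_le hxy]
        exact (hNc.mono hsub).wedgeP (hc'.mono hsub)
      · refine ContinuousOn.intervalIntegrable ?_
        rw [uIcc_of_le hxy]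
        exact (hN.comp ((hcc.mono hsub).add continuousOn_const) hin).wedgeP (hc'.mono hsub)
      · have u1 := hunit _ (hcΩ (hsub hs))
        have u2 := hunit _ (hin s hs)
        have := he0 s (hsub hs)
        simp only [wedgeP, perpP, Prod.smul_mk, smul_eq_mul]
        -- For unit vectors the two integrands differ by `e s / 2` times the squared Euclidean
        -- distance of `N (c s)` and `N (c s + ρ • v)`.
        nlinarith [mul_nonneg this (add_nonneg (sq_nonneg ((N (c s)).1 - (N (c s + ρ • v)).1))
          (sq_nonneg ((N (c s)).2 - (N (c s + ρ • v)).2)))]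
    have := hmin.hasDerivAt_eq_zero hd
    rw [intervalIntegral.integral_neg]
    linarith
  have cont : ∀ v : Plane, ContinuousOn
      (fun z => -(H (c z) * wedgeP v (e z • perpP (N (c z))))) (Ioo a b) := fun v =>
    ((hH.comp hcc hcΩ).mul (continuousOn_const.wedgeP hc')).neg
  -- The vectors `(-1, 0)` and `(0, 1)` are chosen because `wedgeP N v` is then the second and the
  -- first component of `N`.
  have d2 := hasDerivAt_of_integral_eq (cont (-1, 0)) hs (key (-1, 0))
  have d1 := hasDerivAt_of_integral_eq (cont (0, 1)) hs (key (0, 1))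
  simp only [wedgeP, mul_one, mul_zero, sub_zero, zero_sub, mul_neg, neg_neg, zero_mul,
    neg_mul, one_mul] at d1 d2
  refine (d1.prodMk d2).congr_deriv ?_
  simp only [perpP, Prod.smul_mk, smul_eq_mul]
  ext <;> simp <;> ring

/-! ### Peano's existence theorem for scalar equations. -/

open Filter Topology NNReal in
-- This is Picard–Lindelöf. The Lipschitz constant of the solution is 1 whatever `K` is, which
-- provides the compactness needed when `K` tends to infinity.
lemma exists_lipschitz_solution {f : ℝ × ℝ → ℝ} (hf : Continuous f) (hb : ∀ z, |f z| ≤ 1)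
    {K : ℝ≥0} (hK : ∀ t, LipschitzWith K fun y => f (t, y)) (σ : ℝ) {ρ : ℝ} (hρ : 0 < ρ) :
    ∃ ξ : ℝ → ℝ, LipschitzWith 1 ξ ∧ ξ 0 = σ ∧
      ∀ x ∈ Icc (-ρ) ρ, ξ x = σ + ∫ t in (0 : ℝ)..x, f (t, ξ t) := by
  have h0 : (0 : ℝ) ∈ Icc (-ρ) ρ := ⟨by linarith, hρ.le⟩
  have hle : -ρ ≤ ρ := by linarith
  have hpl : IsPicardLindelof (fun t y => f (t, y)) (⟨0, h0⟩ : Icc (-ρ) ρ) σ ρ.toNNReal 0 1 K := by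
    refine ⟨fun t _ => (hK t).lipschitzOnWith, fun y _ => (hf.comp (by fun_prop)).continuousOn,
      fun t _ y _ => hb _, ?_⟩
    simp [hρ.le]
  obtain ⟨α, hα0, hα⟩ := hpl.exists_eq_forall_mem_Icc_hasDerivWithinAt₀
  have hlip : LipschitzOnWith 1 α (Icc (-ρ) ρ) :=
    (convex_Icc _ _).lipschitzOnWith_of_nnnorm_hasDerivWithin_le hα fun t _ => by
      rw [← NNReal.coe_le_coe]; exact hb _
  set ξ : ℝ → ℝ := fun x => α (projIcc (-ρ) ρ hle x) with hξ
  have hξeq : ∀ x ∈ Icc (-ρ) ρ, ξ x = α x := fun x hx => by rw [hξ]; simp [projIcc_of_mem hle hx]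
  refine ⟨ξ, ?_, by rw [hξeq 0 h0]; exact hα0, fun x hx => ?_⟩
  · have h2 : LipschitzWith 1 fun x : ℝ => projIcc (-ρ) ρ hle x := LipschitzWith.projIcc hle
    refine LipschitzWith.of_dist_le_mul fun x y => ?_
    refine (hlip.dist_le_mul _ (Subtype.coe_prop _) _ (Subtype.coe_prop _)).trans ?_
    rw [NNReal.coe_one, one_mul, one_mul]
    simpa using! h2.dist_le_mul x y
  · have hsub : uIcc 0 x ⊆ Icc (-ρ) ρ := uIcc_subset_Icc h0 hx
    have hcont : ContinuousOn α (uIcc 0 x) := hlip.continuousOn.mono hsub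
    have h1 : ∫ t in (0 : ℝ)..x, f (t, α t) = α x - α 0 := by
      refine intervalIntegral.integral_eq_sub_of_hasDeriv_right hcont (fun t ht => ?_) ?_
      · have ht' : t ∈ Ioo (-ρ) ρ := by
          constructor
          · exact lt_of_le_of_lt (le_min h0.1 hx.1) ht.1
          · exact ht.2.trans_le (max_le h0.2 hx.2)
        exact ((hα t (Ioo_subset_Icc_self ht')).hasDerivAt
          (Icc_mem_nhds ht'.1 ht'.2)).hasDerivWithinAt
      · exact (hf.comp_continuousOn (continuousOn_id.prodMk hcont)).intervalIntegrable
    have h2 : ∫ t in (0 : ℝ)..x, f (t, ξ t) = ∫ t in (0 : ℝ)..x, f (t, α t) :=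
      intervalIntegral.integral_congr fun t ht => by simp only [hξeq t (hsub ht)]
    rw [h2, h1, hξeq x hx, show α 0 = σ from hα0]
    ring

/-- The averages of `f (t, ·)` over intervals of length `ε` are Lipschitz. -/
lemma lipschitzWith_average {f : ℝ → ℝ} (hf : Continuous f) (hb : ∀ z, |f z| ≤ 1) {ε : ℝ}
    (hε : 0 < ε) : LipschitzWith (2 / ε).toNNReal fun y => ∫ z in (0 : ℝ)..1, f (y + ε * z) := by
  refine LipschitzWith.of_dist_le_mul fun y y' => ?_
  have ii : ∀ a b, IntervalIntegrable f volume a b := fun a b => hf.intervalIntegrable a b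
  have e : ∀ y, ∫ z in (0 : ℝ)..1, f (y + ε * z) = ε⁻¹ * ∫ z in y..(y + ε), f z := fun y => by
    rw [intervalIntegral.integral_comp_add_mul f hε.ne']
    simp
  have hbd : ∀ a b, |∫ z in a..b, f z| ≤ |b - a| := fun a b => by
    simpa using intervalIntegral.norm_integral_le_of_norm_le_const (a := a) (b := b) (C := 1)
      (f := f) fun x _ => hb x
  have h1 : (∫ z in y..(y + ε), f z) - ∫ z in y'..(y' + ε), f z
      = (∫ z in y..y', f z) - ∫ z in (y + ε)..(y' + ε), f z := by
    have a1 := intervalIntegral.integral_add_adjacent_intervals (ii y y') (ii y' (y' + ε))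
    have a2 := intervalIntegral.integral_add_adjacent_intervals (ii y (y + ε))
      (ii (y + ε) (y' + ε))
    linarith
  rw [Real.dist_eq, e, e, ← mul_sub, h1, abs_mul, abs_of_pos (inv_pos.2 hε), Real.dist_eq,
    Real.coe_toNNReal _ (by positivity)]
  have b1 := hbd y y'
  have b2 := hbd (y + ε) (y' + ε)
  rw [show y' + ε - (y + ε) = y' - y by ring] at b2
  rw [abs_sub_comm y' y] at b1 b2
  calc ε⁻¹ * |(∫ z in y..y', f z) - ∫ z in (y + ε)..(y' + ε), f z|
      ≤ ε⁻¹ * (|y - y'| + |y - y'|) := by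
        gcongr
        exact (abs_sub _ _).trans (add_le_add b1 b2)
    _ = 2 / ε * |y - y'| := by ring

open Filter Topology BoundedContinuousFunction in
/-- **Peano's existence theorem** for a scalar equation with a bounded continuous right side. -/
theorem exists_solution_of_continuous {m : ℝ × ℝ → ℝ} (hm : Continuous m) (hb : ∀ z, |m z| ≤ 1)
    (σ : ℝ) {ρ : ℝ} (hρ : 0 < ρ) :
    ∃ ξ : ℝ → ℝ, ξ 0 = σ ∧ LipschitzWith 1 ξ ∧
      ∀ x ∈ Ioo (-ρ) ρ, HasDerivAt ξ (m (x, ξ x)) x := by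
  have h0 : (0 : ℝ) ∈ Icc (-ρ) ρ := ⟨by linarith, hρ.le⟩
  have hle : -ρ ≤ ρ := by linarith
  -- `M ε` averages `m` over a vertical segment of length `ε`. It is Lipschitz in the second
  -- variable for `ε > 0`, equals `m` for `ε = 0`, and is jointly continuous down to `ε = 0`.
  let M : ℝ → ℝ × ℝ → ℝ := fun ε z => ∫ y in (0 : ℝ)..1, m (z.1, z.2 + ε * y)
  have hM : Continuous fun p : ℝ × ℝ × ℝ => M p.1 p.2 :=
    intervalIntegral.continuous_parametric_intervalIntegral_of_continuous'
      (f := fun (p : ℝ × ℝ × ℝ) y => m (p.2.1, p.2.2 + p.1 * y)) (hm.comp (by fun_prop)) _ _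
  have hM1 : ∀ ε z, |M ε z| ≤ 1 := fun ε z => by
    simpa using intervalIntegral.norm_integral_le_of_norm_le_const (a := 0) (b := 1) (C := 1)
      (f := fun y => m (z.1, z.2 + ε * y)) fun x _ => hb (z.1, z.2 + ε * x)
  have hM0 : ∀ z, M 0 z = m z := fun z => by simp [M]
  have hex : ∀ n : ℕ, ∃ ξ : ℝ → ℝ, LipschitzWith 1 ξ ∧ ξ 0 = σ ∧
      ∀ x ∈ Icc (-ρ) ρ, ξ x = σ + ∫ t in (0 : ℝ)..x, M (1 / ((n : ℝ) + 1)) (t, ξ t) := fun n =>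
    exists_lipschitz_solution (hM.comp (continuous_const.prodMk continuous_id)) (hM1 _)
      (fun t => lipschitzWith_average (f := fun y => m (t, y)) (hm.comp (by fun_prop)) (fun z => hb _)
        Nat.one_div_pos_of_nat) σ hρ
  choose ξ hξl hξ0 hξ using hex
  let S := Icc (-ρ) ρ
  let B : ℕ → S →ᵇ ℝ := fun n => mkOfCompact ⟨fun x => ξ n x, (hξl n).continuous.comp (by fun_prop)⟩
  -- All the approximate solutions lie in this set, which is compact by Arzelà–Ascoli.
  let A : Set (S →ᵇ ℝ) := {f | f ⟨0, h0⟩ = σ ∧ ∀ x y, |f x - f y| ≤ |(x : ℝ) - y|}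
  have hAc : IsCompact A := by
    refine arzela_ascoli₂ (Icc (σ - ρ) (σ + ρ)) isCompact_Icc A ?_ ?_ ?_
    · have ev : ∀ x : S, Continuous fun f : S →ᵇ ℝ => f x := fun x => continuous_eval_const x
      have hA : A = {f | f ⟨0, h0⟩ = σ} ∩ ⋂ x : S, ⋂ y : S, {f | |f x - f y| ≤ |(x : ℝ) - y|} := by
        ext f; simp [A]
      rw [hA]
      refine (isClosed_eq (ev _) continuous_const).inter ?_
      exact isClosed_iInter fun x => isClosed_iInter fun y =>
        isClosed_le (((ev x).sub (ev y)).abs) continuous_const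
    · intro f x hf
      have h1 := hf.2 x ⟨0, h0⟩
      rw [hf.1] at h1
      have h2 : |(x : ℝ) - 0| ≤ ρ := by
        rw [sub_zero]; exact abs_le.2 x.2
      have := abs_le.1 (h1.trans h2)
      constructor <;> linarith [this.1, this.2]
    · refine (LipschitzWith.uniformEquicontinuous _ 1 fun f => ?_).equicontinuous
      refine LipschitzWith.of_dist_le_mul fun x y => ?_
      rw [NNReal.coe_one, one_mul]
      exact f.2.2 x y
  have hBA : ∀ n, B n ∈ A := fun n => ⟨hξ0 n, fun x y => by
    simpa [Real.dist_eq] using! (hξl n).dist_le_mul (x : ℝ) y⟩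
  obtain ⟨g, hgA, φ, hφ, hlim⟩ := hAc.tendsto_subseq hBA
  set ζ : ℝ → ℝ := fun x => g (projIcc (-ρ) ρ hle x) with hζ
  have hζl : LipschitzWith 1 ζ := by
    have h2 : LipschitzWith 1 fun x : ℝ => projIcc (-ρ) ρ hle x := LipschitzWith.projIcc hle
    refine LipschitzWith.of_dist_le_mul fun x y => ?_
    refine (hgA.2 _ _).trans ?_
    exact h2.dist_le_mul x y
  have hpt : ∀ x ∈ Icc (-ρ) ρ, Tendsto (fun k => ξ (φ k) x) atTop (𝓝 (ζ x)) := by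
    intro x hx
    have h1 : Tendsto (fun k => B (φ k) ⟨x, hx⟩) atTop (𝓝 (g ⟨x, hx⟩)) :=
      ((continuous_eval_const (⟨x, hx⟩ : S)).tendsto g).comp hlim
    simp only [hζ, projIcc_of_mem hle hx]
    exact h1
  have hint : ∀ x ∈ Icc (-ρ) ρ, ζ x = σ + ∫ t in (0 : ℝ)..x, m (t, ζ t) := by
    intro x hx
    have hsub : uIoc 0 x ⊆ Icc (-ρ) ρ := uIoc_subset_uIcc.trans (uIcc_subset_Icc h0 hx)
    have hε : Tendsto (fun k => 1 / (((φ k : ℕ) : ℝ) + 1)) atTop (𝓝 0) :=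
      tendsto_one_div_add_atTop_nhds_zero_nat.comp hφ.tendsto_atTop
    have h1 : Tendsto (fun k => ∫ t in (0 : ℝ)..x, M (1 / (((φ k : ℕ) : ℝ) + 1)) (t, ξ (φ k) t))
        atTop (𝓝 (∫ t in (0 : ℝ)..x, m (t, ζ t))) := by
      refine intervalIntegral.tendsto_integral_filter_of_dominated_convergence (fun _ => 1)
        (Eventually.of_forall fun k => ?_)
        (Eventually.of_forall fun k => ae_of_all _ fun t _ => hM1 _ _) (by simp)
        (ae_of_all _ fun t ht => ?_)
      · exact (hM.comp (continuous_const.prodMk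
          (continuous_id.prodMk (hξl _).continuous))).aestronglyMeasurable
      · rw [← hM0]
        have h2 : Tendsto (fun k => ((1 / (((φ k : ℕ) : ℝ) + 1), t, ξ (φ k) t) : ℝ × ℝ × ℝ)) atTop
            (𝓝 (0, t, ζ t)) :=
          hε.prodMk_nhds (tendsto_const_nhds.prodMk_nhds (hpt t (hsub ht)))
        exact (hM.tendsto _).comp h2
    refine tendsto_nhds_unique (hpt x hx) ?_
    refine (h1.const_add σ).congr fun k => ?_
    exact (hξ _ x hx).symm
  refine ⟨ζ, ?_, hζl, fun x hx => ?_⟩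
  · rw [hint 0 h0]; simp
  · have hc : Continuous fun t => m (t, ζ t) := hm.comp (continuous_id.prodMk hζl.continuous)
    have h1 : HasDerivAt (fun x => σ + ∫ t in (0 : ℝ)..x, m (t, ζ t)) (m (x, ζ x)) x :=
      (intervalIntegral.integral_hasDerivAt_right (hc.intervalIntegrable _ _)
        (hc.stronglyMeasurableAtFilter _ _) hc.continuousAt).const_add σ
    refine h1.congr_of_eventuallyEq ?_
    filter_upwards [Icc_mem_nhds hx.1 hx.2] with y hy using hint y hy

/-! ### Partial derivatives and the inverse function theorem in the plane. -/

/-- The linear map with columns `a` and `b`. -/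
noncomputable def columnsP {E : Type*} [NormedAddCommGroup E] [NormedSpace ℝ E] (a b : E) :
    Plane →L[ℝ] E :=
  (ContinuousLinearMap.fst ℝ ℝ ℝ).smulRight a + (ContinuousLinearMap.snd ℝ ℝ ℝ).smulRight b

lemma columnsP_apply {E : Type*} [NormedAddCommGroup E] [NormedSpace ℝ E] (a b : E) (v : Plane) :
    columnsP a b v = v.1 • a + v.2 • b := by
  simp [columnsP]

lemma eq_columnsP {E : Type*} [NormedAddCommGroup E] [NormedSpace ℝ E] (A : Plane →L[ℝ] E) :
    A = columnsP (A (1, 0)) (A (0, 1)) := by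
  ext <;> simp [columnsP_apply]

lemma ContinuousOn.columnsP {α E : Type*} [TopologicalSpace α] [NormedAddCommGroup E]
    [NormedSpace ℝ E] {a b : α → E} {s : Set α} (ha : ContinuousOn a s) (hb : ContinuousOn b s) :
    ContinuousOn (fun x => columnsP (a x) (b x)) s := by
  have h1 : ∀ (L : Plane →L[ℝ] ℝ), Continuous fun x : E => L.smulRight x := fun L =>
    (ContinuousLinearMap.smulRightL ℝ Plane E L).continuous
  exact ((h1 _).comp_continuousOn ha).add ((h1 _).comp_continuousOn hb)

lemma contDiffOn_one_of_hasFDerivAt {E F : Type*} [NormedAddCommGroup E] [NormedSpace ℝ E]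
    [NormedAddCommGroup F] [NormedSpace ℝ F] {f : E → F} {f' : E → E →L[ℝ] F} {U : Set E}
    (hU : IsOpen U) (hf : ∀ x ∈ U, HasFDerivAt f (f' x) x) (hf' : ContinuousOn f' U) :
    ContDiffOn ℝ 1 f U := fun _ hx =>
  (contDiffAt_one_iff.2 ⟨f', U, hU.mem_nhds hx, hf', hf⟩).contDiffWithinAt

lemma hasStrictFDerivAt_of_partials {E : Type*} [NormedAddCommGroup E] [NormedSpace ℝ E]
    {f a b : Plane → E} {U : Set Plane} (hU : IsOpen U)
    (ha : ∀ q ∈ U, HasDerivAt (fun x => f (x, q.2)) (a q) q.1)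
    (hb : ∀ q ∈ U, HasDerivAt (fun y => f (q.1, y)) (b q) q.2)
    (hac : ContinuousOn a U) (hbc : ContinuousOn b U) {q : Plane} (hq : q ∈ U) :
    HasStrictFDerivAt f (columnsP (a q) (b q)) q := by
  have hn := hU.mem_nhds hq
  have hT : Continuous fun x : E => ContinuousLinearMap.toSpanSingleton ℝ x :=
    (ContinuousLinearMap.toSpanSingletonCLE (𝕜 := ℝ) (E := E)).continuous
  have := hasStrictFDerivAt_uncurry_coprod (𝕜 := ℝ) (u := q) (f := fun x y => f (x, y))
    (f₁ := fun x y => ContinuousLinearMap.toSpanSingleton ℝ (a (x, y)))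
    (f₂ := fun x y => ContinuousLinearMap.toSpanSingleton ℝ (b (x, y)))
    (by filter_upwards [hn] with z hz using (ha z hz).hasFDerivAt)
    (by filter_upwards [hn] with z hz using (hb z hz).hasFDerivAt)
    (hT.continuousAt.comp (hac.continuousAt hn)) (hT.continuousAt.comp (hbc.continuousAt hn))
  refine this.congr_fderiv ?_
  ext <;> simp [columnsP_apply, Function.HasUncurry.uncurry]

lemma contDiffOn_one_of_partials {E : Type*} [NormedAddCommGroup E] [NormedSpace ℝ E]
    {f a b : Plane → E} {U : Set Plane} (hU : IsOpen U)
    (ha : ∀ q ∈ U, HasDerivAt (fun x => f (x, q.2)) (a q) q.1)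
    (hb : ∀ q ∈ U, HasDerivAt (fun y => f (q.1, y)) (b q) q.2)
    (hac : ContinuousOn a U) (hbc : ContinuousOn b U) : ContDiffOn ℝ 1 f U :=
  contDiffOn_one_of_hasFDerivAt hU
    (fun _ hq => (hasStrictFDerivAt_of_partials hU ha hb hac hbc hq).hasFDerivAt)
    (hac.columnsP hbc)

/-- The linear automorphism of the plane with independent columns `a` and `b`. -/
noncomputable def columnsEquivP (a b : Plane) (h : wedgeP a b ≠ 0) : Plane ≃L[ℝ] Plane :=
  ContinuousLinearEquiv.equivOfInverse (columnsP a b)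
    (columnsP (b.2 / wedgeP a b, -a.2 / wedgeP a b) (-b.1 / wedgeP a b, a.1 / wedgeP a b))
    (fun v => by
      obtain ⟨D, hD⟩ : ∃ D, D = wedgeP a b := ⟨_, rfl⟩
      rw [← hD] at h ⊢
      simp only [columnsP_apply]
      ext <;> simp only [Prod.fst_add, Prod.snd_add, Prod.smul_fst, Prod.smul_snd, smul_eq_mul] <;>
        field_simp <;> rw [hD, wedgeP] <;> ring)
    (fun v => by
      obtain ⟨D, hD⟩ : ∃ D, D = wedgeP a b := ⟨_, rfl⟩
      rw [← hD] at h ⊢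
      simp only [columnsP_apply]
      ext <;> simp only [Prod.fst_add, Prod.snd_add, Prod.smul_fst, Prod.smul_snd, smul_eq_mul] <;>
        field_simp <;> rw [hD, wedgeP] <;> ring)

/-- The inverse function theorem in the plane, in terms of columns of the derivative. -/
lemma exists_openPartialHomeomorph_of_columns {Ξ a b : Plane → Plane} {S : Set Plane}
    (hS : IsOpen S) (hΞ : ∀ z ∈ S, HasFDerivAt Ξ (columnsP (a z) (b z)) z)
    (ha : ContinuousOn a S) (hb : ContinuousOn b S) (hab : ∀ z ∈ S, wedgeP (a z) (b z) ≠ 0)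
    {z₀ : Plane} (hz₀ : z₀ ∈ S) :
    ∃ e : OpenPartialHomeomorph Plane Plane, z₀ ∈ e.source ∧ e.source ⊆ S ∧ (∀ z, e z = Ξ z) ∧
      ContDiffOn ℝ 1 e e.source ∧ ContDiffOn ℝ 1 e.symm e.target ∧
      ∀ q ∈ e.target, HasFDerivAt e.symm
        (columnsP ((b (e.symm q)).2 / wedgeP (a (e.symm q)) (b (e.symm q)),
            -(a (e.symm q)).2 / wedgeP (a (e.symm q)) (b (e.symm q)))
          (-(b (e.symm q)).1 / wedgeP (a (e.symm q)) (b (e.symm q)),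
            (a (e.symm q)).1 / wedgeP (a (e.symm q)) (b (e.symm q)))) q := by
  have hC : ContDiffOn ℝ 1 Ξ S := contDiffOn_one_of_hasFDerivAt hS hΞ (ha.columnsP hb)
  have hst : HasStrictFDerivAt Ξ (columnsEquivP _ _ (hab z₀ hz₀) : Plane →L[ℝ] Plane) z₀ :=
    (hC.contDiffAt (hS.mem_nhds hz₀)).hasStrictFDerivAt' (hΞ z₀ hz₀) one_ne_zero
  let e := (hst.toOpenPartialHomeomorph Ξ).restrOpen S hS
  have hes : e.source ⊆ S := by
    intro z hz
    have : z ∈ (hst.toOpenPartialHomeomorph Ξ).source ∩ S := hz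
    exact this.2
  have hmaps : MapsTo e.symm e.target S := fun q hq => hes (e.map_target hq)
  have hder : ∀ q ∈ e.target, HasFDerivAt e.symm
        (columnsP ((b (e.symm q)).2 / wedgeP (a (e.symm q)) (b (e.symm q)),
            -(a (e.symm q)).2 / wedgeP (a (e.symm q)) (b (e.symm q)))
          (-(b (e.symm q)).1 / wedgeP (a (e.symm q)) (b (e.symm q)),
            (a (e.symm q)).1 / wedgeP (a (e.symm q)) (b (e.symm q)))) q := fun q hq =>
    e.hasFDerivAt_symm (f' := columnsEquivP _ _ (hab _ (hmaps hq))) hq (hΞ _ (hmaps hq))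
  refine ⟨e, ⟨hst.mem_toOpenPartialHomeomorph_source, hz₀⟩, hes, fun z => rfl, hC.mono hes,
    contDiffOn_one_of_hasFDerivAt e.open_target hder ?_, hder⟩
  have hca := ha.comp e.continuousOn_symm hmaps
  have hcb := hb.comp e.continuousOn_symm hmaps
  have hw : ∀ q ∈ e.target, wedgeP (a (e.symm q)) (b (e.symm q)) ≠ 0 := fun q hq =>
    hab _ (hmaps hq)
  exact ((hcb.snd.div (hca.wedgeP hcb) hw).prodMk (hca.snd.neg.div (hca.wedgeP hcb) hw)).columnsP
    ((hcb.fst.neg.div (hca.wedgeP hcb) hw).prodMk (hca.fst.div (hca.wedgeP hcb) hw))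

/-! ### Flux between trajectories and differentiability of the flow. -/

lemma eq_of_hasDerivAt_zero {E : Type*} [NormedAddCommGroup E] [NormedSpace ℝ E] {f : ℝ → E}
    {a b : ℝ} (hf : ∀ x ∈ Ioo a b, HasDerivAt f 0 x) {x y : ℝ} (hx : x ∈ Ioo a b)
    (hy : y ∈ Ioo a b) : f x = f y := by
  have := (convex_Ioo a b).norm_image_sub_le_of_norm_hasDerivWithin_le (C := 0)
    (fun z hz => (hf z hz).hasDerivWithinAt) (fun _ _ => by simp) hy hx
  rw [zero_mul] at this
  exact sub_eq_zero.1 (norm_le_zero_iff.1 this)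

lemma hasDerivAt_primitive {E : Type*} [NormedAddCommGroup E] [NormedSpace ℝ E] [CompleteSpace E]
    {k : ℝ → E} (hk : Continuous k) (a x : ℝ) :
    HasDerivAt (fun x => ∫ z in a..x, k z) (k x) x :=
  intervalIntegral.integral_hasDerivAt_right (hk.intervalIntegrable _ _)
    (hk.stronglyMeasurableAtFilter _ _) hk.continuousAt

lemma eq_mul_exp_of_hasDerivAt {A k : ℝ → ℝ} {a b x₀ : ℝ} (hk : Continuous k)
    (hA : ∀ x ∈ Ioo a b, HasDerivAt A (k x * A x) x) (hx₀ : x₀ ∈ Ioo a b) {x : ℝ}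
    (hx : x ∈ Ioo a b) : A x = A x₀ * Real.exp (∫ z in x₀..x, k z) := by
  have h1 : ∀ x ∈ Ioo a b, HasDerivAt (fun x => A x * Real.exp (-∫ z in x₀..x, k z)) 0 x := by
    intro x hx
    refine ((hA x hx).mul (hasDerivAt_primitive hk x₀ x).neg.exp).congr_deriv ?_
    ring
  have h2 := eq_of_hasDerivAt_zero h1 hx hx₀
  simp only [intervalIntegral.integral_same, neg_zero, Real.exp_zero, mul_one] at h2
  rw [← h2, mul_assoc, ← Real.exp_add]
  simp

/-- The mean of `f` over the vertical segment from `(x, y)` to `(x, y')`, at `z = (x, y, y')`. -/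
noncomputable def segmentMean (f : Plane → ℝ) (z : ℝ × ℝ × ℝ) : ℝ :=
  ∫ r in (0 : ℝ)..1, f (z.1, z.2.1 + r * (z.2.2 - z.2.1))

lemma continuous_segmentMean {f : Plane → ℝ} (hf : Continuous f) : Continuous (segmentMean f) :=
  intervalIntegral.continuous_parametric_intervalIntegral_of_continuous'
    (f := fun (z : ℝ × ℝ × ℝ) r => f (z.1, z.2.1 + r * (z.2.2 - z.2.1)))
    (hf.comp (by fun_prop)) _ _

lemma segmentMean_diag (f : Plane → ℝ) (x y : ℝ) : segmentMean f (x, y, y) = f (x, y) := by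
  simp [segmentMean]

lemma le_segmentMean {f : Plane → ℝ} (hf : Continuous f) {a : ℝ} (h : ∀ z, a ≤ f z)
    (z : ℝ × ℝ × ℝ) : a ≤ segmentMean f z := by
  have := intervalIntegral.integral_mono_on (a := 0) (b := 1) (μ := volume) (f := fun _ => a)
    (g := fun r => f (z.1, z.2.1 + r * (z.2.2 - z.2.1))) zero_le_one (by simp)
    ((hf.comp (by fun_prop)).intervalIntegrable _ _) fun r _ => h _
  simpa [segmentMean] using! this

lemma abs_segmentMean_le {f : Plane → ℝ} {B : ℝ} (h : ∀ z, |f z| ≤ B)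
    (z : ℝ × ℝ × ℝ) : |segmentMean f z| ≤ B := by
  simpa [segmentMean] using! intervalIntegral.norm_integral_le_of_norm_le_const (a := 0) (b := 1) (C := B)
    (f := fun r => f (z.1, z.2.1 + r * (z.2.2 - z.2.1))) fun r _ => h _

/-- The flux of `X` through the vertical segment between two of its trajectories. -/
lemma HasUniformDiv.hasDerivAt_flux_between {ρ r : ℝ} (hr : r ≤ ρ) {X : Plane → Plane}
    {h : Plane → ℝ} (hX : Continuous X) (hh : Continuous h) (hX1 : ∀ z, 0 < (X z).1)
    (hdiv : HasUniformDiv (Ioo (-ρ) ρ ×ˢ Ioo (-ρ) ρ) X h) {ξ₁ ξ₂ : ℝ → ℝ}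
    (h1 : ∀ x ∈ Ioo (-r) r, HasDerivAt ξ₁ ((X (x, ξ₁ x)).2 / (X (x, ξ₁ x)).1) x)
    (h2 : ∀ x ∈ Ioo (-r) r, HasDerivAt ξ₂ ((X (x, ξ₂ x)).2 / (X (x, ξ₂ x)).1) x)
    (m1 : ∀ x ∈ Ioo (-r) r, ξ₁ x ∈ Ioo (-ρ) ρ) (m2 : ∀ x ∈ Ioo (-r) r, ξ₂ x ∈ Ioo (-ρ) ρ)
    {x : ℝ} (hx : x ∈ Ioo (-r) r) :
    HasDerivAt (fun x => segmentMean (fun z => (X z).1) (x, ξ₁ x, ξ₂ x) * (ξ₂ x - ξ₁ x))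
      (segmentMean h (x, ξ₁ x, ξ₂ x) * (ξ₂ x - ξ₁ x)) x := by
  have c1 : ContinuousOn ξ₁ (Ioo (-r) r) := fun x hx => (h1 x hx).continuousAt.continuousWithinAt
  have c2 : ContinuousOn ξ₂ (Ioo (-r) r) := fun x hx => (h2 x hx).continuousAt.continuousWithinAt
  have hm : Continuous fun z : Plane => (X z).2 / (X z).1 :=
    hX.snd.div hX.fst fun z => (hX1 z).ne'
  have cp1 : ContinuousOn (fun x => (x, ξ₁ x)) (Ioo (-r) r) := continuousOn_id.prodMk c1
  have cp2 : ContinuousOn (fun x => (x, ξ₂ x)) (Ioo (-r) r) := continuousOn_id.prodMk c2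
  refine hasDerivAt_of_integral_eq
    (k := fun x => segmentMean h (x, ξ₁ x, ξ₂ x) * (ξ₂ x - ξ₁ x)) ?_ hx fun a ha b hb hab => ?_
  · exact ((continuous_segmentMean hh).comp_continuousOn
      (continuousOn_id.prodMk (c1.prodMk c2))).mul (c2.sub c1)
  have hsub : Icc a b ⊆ Ioo (-r) r := Icc_subset_Ioo ha.1 hb.2
  have key := hdiv.flux_patch hX.continuousOn hh.continuousOn (c := fun x => (x, ξ₁ x))
    (w := fun x => (0, ξ₂ x - ξ₁ x))
    (c' := fun x => (1, (X (x, ξ₁ x)).2 / (X (x, ξ₁ x)).1))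
    (w' := fun x => (0, (X (x, ξ₂ x)).2 / (X (x, ξ₂ x)).1 - (X (x, ξ₁ x)).2 / (X (x, ξ₁ x)).1))
    hab (fun s hs => (hasDerivAt_id s).prodMk (h1 s (hsub hs)))
    (fun s hs => (hasDerivAt_const s 0).prodMk ((h2 s (hsub hs)).sub (h1 s (hsub hs))))
    (continuousOn_const.prodMk ((hm.comp_continuousOn cp1).mono hsub))
    (continuousOn_const.prodMk (((hm.comp_continuousOn cp2).mono hsub).sub
      ((hm.comp_continuousOn cp1).mono hsub))) (fun s hs r hr' => by
        have i1 := m1 s (hsub hs)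
        have i2 := m2 s (hsub hs)
        have i3 := hsub hs
        simp only [Prod.smul_mk, smul_eq_mul, Prod.mk_add_mk, mul_zero, add_zero]
        refine ⟨⟨by linarith [i3.1], by linarith [i3.2]⟩, ?_⟩
        have := (convex_Ioo (-ρ) ρ).add_smul_sub_mem i1 i2 hr'
        simpa using this)
  -- The lower and upper edges of the patch are trajectories, so no flux crosses them; only the
  -- vertical sides contribute.
  have z1 : ∀ q : Plane, wedgeP (X q) (1, (X q).2 / (X q).1) = 0 := fun q => by
    have := (hX1 q).ne'
    simp only [wedgeP]
    field_simp
    ring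
  simp only [Prod.smul_mk, smul_eq_mul, Prod.mk_add_mk, mul_zero, add_zero, add_sub_cancel, z1,
    intervalIntegral.integral_zero, sub_zero, zero_sub] at key
  simp only [wedgeP, mul_zero, sub_zero, zero_mul, zero_sub, mul_one, mul_neg,
    intervalIntegral.integral_neg, intervalIntegral.integral_mul_const, neg_inj] at key
  simpa only [segmentMean, mul_zero, add_zero, mul_one] using key

/-- The trajectories of a field with positive first component and continuous divergence form a
`C¹` family, with an explicit derivative in the initial value. -/
lemma HasUniformDiv.exists_flow {ρ : ℝ} (hρ : 0 < ρ) {X : Plane → Plane}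
    {h : Plane → ℝ} (hX : Continuous X) (hh : Continuous h) {α B : ℝ} (hα : 0 < α)
    (hX1 : ∀ z, α ≤ (X z).1) (hX2 : ∀ z, |(X z).2| ≤ (X z).1) (hB1 : ∀ z, (X z).1 ≤ B)
    (hB2 : ∀ z, |h z| ≤ B)
    (hdiv : HasUniformDiv (Ioo (-ρ) ρ ×ˢ Ioo (-ρ) ρ) X h) :
    ∃ r > 0, r ≤ ρ ∧ ∃ ξ : Plane → ℝ, Continuous ξ ∧
      ∀ z ∈ Ioo (-r) r ×ˢ Ioo (-r) r, ξ z ∈ Ioo (-ρ) ρ ∧ ξ (z.1, 0) = z.1 ∧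
        HasDerivAt (fun x => ξ (z.1, x)) ((X (z.2, ξ z)).2 / (X (z.2, ξ z)).1) z.2 ∧
        HasDerivAt (fun σ => ξ (σ, z.2)) ((X (0, z.1)).1 / (X (z.2, ξ z)).1 *
          Real.exp (∫ x in (0 : ℝ)..z.2, h (x, ξ (z.1, x)) / (X (x, ξ (z.1, x))).1)) z.1 := by
  have hX1' : ∀ z, 0 < (X z).1 := fun z => hα.trans_le (hX1 z)
  have hB : 0 < B := hα.trans_le ((hX1 0).trans (hB1 0))
  have hm : Continuous fun z : Plane => (X z).2 / (X z).1 :=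
    hX.snd.div hX.fst fun z => (hX1' z).ne'
  have hm1 : ∀ z : Plane, |(X z).2 / (X z).1| ≤ 1 := fun z => by
    rw [abs_div, abs_of_pos (hX1' z)]
    exact div_le_one_of_le₀ (hX2 z) (hX1' z).le
  -- Any choice of Peano solutions will do: `diff` controls the distance between whichever solutions
  -- have been chosen.
  choose η hη0 hηl hη using fun σ => exists_solution_of_continuous hm hm1 σ hρ
  set a : ℝ × ℝ × ℝ → ℝ := segmentMean fun z => (X z).1 with ha
  have hac : Continuous a := continuous_segmentMean hX.fst
  have haα : ∀ z, α ≤ a z := le_segmentMean hX.fst hX1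
  have ha0 : ∀ z, 0 < a z := fun z => hα.trans_le (haα z)
  have haB : ∀ z, a z ≤ B := fun z => (le_abs_self _).trans
    (abs_segmentMean_le (fun z => by rw [abs_of_pos (hX1' z)]; exact hB1 z) z)
  set k : ℝ × ℝ × ℝ → ℝ := fun z => segmentMean h z / a z with hk
  have hkc : Continuous k := (continuous_segmentMean hh).div hac fun z => (ha0 z).ne'
  have hkB : ∀ z, |k z| ≤ B / α := fun z => by
    rw [hk, abs_div, abs_of_pos (ha0 z)]
    exact div_le_div₀ hB.le (abs_segmentMean_le hB2 z) hα (haα z)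
  -- A curve with slope at most 1 starting within `ρ / 2` stays in `(-ρ, ρ)` for times below `ρ /
  -- 2`.
  set r₀ := ρ / 2 with hr₀
  have hr₀pos : 0 < r₀ := by positivity
  have hηm : ∀ σ ∈ Ioo (-r₀) r₀, ∀ x ∈ Ioo (-r₀) r₀, η σ x ∈ Ioo (-ρ) ρ := by
    intro σ hσ x hx
    have := (hηl σ).dist_le_mul x 0
    rw [hη0, NNReal.coe_one, one_mul, Real.dist_eq, Real.dist_eq, sub_zero] at this
    have h1 := abs_lt.2 hx
    have h2 := abs_le.1 (this.trans h1.le)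
    constructor <;> linarith [h2.1, h2.2, hσ.1, hσ.2]
  have hηd : ∀ σ, ∀ x ∈ Ioo (-r₀) r₀,
      HasDerivAt (η σ) ((X (x, η σ x)).2 / (X (x, η σ x)).1) x := fun σ x hx =>
    hη σ x ⟨by linarith [hx.1], by linarith [hx.2]⟩
  have h0 : (0 : ℝ) ∈ Ioo (-r₀) r₀ := ⟨by linarith, hr₀pos⟩
  -- The flux `a * (η σ' - η σ)` solves the linear equation `A' = k A`. Solving it exhibits the
  -- difference of two trajectories as `σ' - σ` times an explicit factor that stays continuous up to
  -- `σ' = σ`.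
  have diff : ∀ σ ∈ Ioo (-r₀) r₀, ∀ σ' ∈ Ioo (-r₀) r₀, ∀ x ∈ Ioo (-r₀) r₀,
      η σ' x - η σ x = (σ' - σ) * (a (0, σ, σ') / a (x, η σ x, η σ' x)
        * Real.exp (∫ y in (0 : ℝ)..x, k (y, η σ y, η σ' y))) := by
    intro σ hσ σ' hσ' x hx
    have hkk : Continuous fun y => k (y, η σ y, η σ' y) :=
      hkc.comp (continuous_id.prodMk ((hηl σ).continuous.prodMk (hηl σ').continuous))
    have := eq_mul_exp_of_hasDerivAt (x₀ := 0) hkk (a := -r₀) (b := r₀)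
      (A := fun x => a (x, η σ x, η σ' x) * (η σ' x - η σ x)) (fun x hx => by
        have := hdiv.hasDerivAt_flux_between (r := r₀) (by linarith) hX hh hX1' (hηd σ) (hηd σ')
          (hηm σ hσ) (hηm σ' hσ') hx
        refine this.congr_deriv ?_
        have := (ha0 (x, η σ x, η σ' x)).ne'
        simp only [hk]
        field_simp) h0 hx
    simp only [hη0] at this
    have h2 := (ha0 (x, η σ x, η σ' x)).ne'
    have h3 : η σ' x - η σ x = a (x, η σ x, η σ' x) * (η σ' x - η σ x) / a (x, η σ x, η σ' x) := by
      field_simp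
    rw [h3, this]
    ring
  set C := B / α * Real.exp (B / α * r₀) with hC
  have hC0 : 0 ≤ C := by positivity
  have lip : ∀ σ ∈ Ioo (-r₀) r₀, ∀ σ' ∈ Ioo (-r₀) r₀, ∀ x ∈ Ioo (-r₀) r₀,
      |η σ' x - η σ x| ≤ C * |σ' - σ| := by
    intro σ hσ σ' hσ' x hx
    rw [diff σ hσ σ' hσ' x hx, abs_mul, mul_comm]
    refine mul_le_mul_of_nonneg_right ?_ (abs_nonneg _)
    rw [abs_of_pos (mul_pos (div_pos (ha0 _) (ha0 _)) (Real.exp_pos _))]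
    refine mul_le_mul (div_le_div₀ hB.le (haB _) hα (haα _)) (Real.exp_le_exp.2 ?_)
      (Real.exp_pos _).le (by positivity)
    refine (le_abs_self _).trans ?_
    have := intervalIntegral.norm_integral_le_of_norm_le_const (a := 0) (b := x) (C := B / α)
      (f := fun y => k (y, η σ y, η σ' y)) fun y _ => hkB _
    refine this.trans (mul_le_mul_of_nonneg_left ?_ (by positivity))
    rw [sub_zero]
    exact (abs_lt.2 hx).le
  -- On the closed square of half side `r`, still inside the region of the estimates, the flow is
  -- jointly continuous and so has a continuous extension to the plane.
  set r := r₀ / 2 with hr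
  have hrpos : 0 < r := by positivity
  have hsub : Icc (-r) r ⊆ Ioo (-r₀) r₀ := fun x hx => ⟨by linarith [hx.1], by linarith [hx.2]⟩
  have hηcont : ContinuousOn (fun z : ℝ × ℝ => η z.1 z.2) (Icc (-r) r ×ˢ Icc (-r) r) := by
    intro z hz
    refine tendsto_iff_dist_tendsto_zero.2 ?_
    refine squeeze_zero' (g := fun w : ℝ × ℝ => C * |w.1 - z.1| + |w.2 - z.2|)
      (Filter.Eventually.of_forall fun _ => dist_nonneg) ?_ ?_
    · filter_upwards [self_mem_nhdsWithin] with w hw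
      refine (dist_triangle _ (η z.1 w.2) _).trans (add_le_add ?_ ?_)
      · exact lip _ (hsub hz.1) _ (hsub hw.1) _ (hsub hw.2)
      · simpa [Real.dist_eq] using (hηl z.1).dist_le_mul w.2 z.2
    · have : Continuous fun w : ℝ × ℝ => C * |w.1 - z.1| + |w.2 - z.2| := by fun_prop
      have h1 := this.tendsto z
      simp only [sub_self, abs_zero, mul_zero, add_zero] at h1
      exact h1.mono_left nhdsWithin_le_nhds
  obtain ⟨ξ, hξc, hξ, -⟩ := hηcont.exists_extend_rect (by linarith) (by linarith)
  have hξη : ∀ σ ∈ Icc (-r) r, ∀ x ∈ Icc (-r) r, ξ (σ, x) = η σ x := fun σ hσ x hx =>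
    hξ (show (σ, x) ∈ Icc (-r) r ×ˢ Icc (-r) r from ⟨hσ, hx⟩)
  -- `Q σ' (σ, x)` is the difference quotient of the flow in the initial value. Its value at `σ' =
  -- σ` is the derivative, and there the segment means collapse to point values.
  let Q : ℝ → ℝ × ℝ → ℝ := fun σ' z => a (0, z.1, σ') / a (z.2, ξ z, ξ (σ', z.2))
        * Real.exp (∫ y in (0 : ℝ)..z.2, k (y, ξ (z.1, y), ξ (σ', y)))
  have hQ : Continuous fun p : ℝ × ℝ × ℝ => Q p.1 p.2 := by
    refine ((hac.comp (by fun_prop)).div (hac.comp (by fun_prop)) fun _ => (ha0 _).ne').mul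
      (Real.continuous_exp.comp ?_)
    exact intervalIntegral.continuous_parametric_intervalIntegral_of_continuous
      (f := fun (p : ℝ × ℝ × ℝ) y => k (y, ξ (p.2.1, y), ξ (p.1, y)))
      (hkc.comp (by fun_prop)) (by fun_prop)
  have hr0 : (0 : ℝ) ∈ Icc (-r) r := ⟨by linarith, hrpos.le⟩
  have hξdiff : ∀ σ ∈ Icc (-r) r, ∀ σ' ∈ Icc (-r) r, ∀ x ∈ Icc (-r) r,
      ξ (σ', x) - ξ (σ, x) = (σ' - σ) * Q σ' (σ, x) := by
    intro σ hσ σ' hσ' x hx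
    rw [hξη σ hσ x hx, hξη σ' hσ' x hx, diff σ (hsub hσ) σ' (hsub hσ') x (hsub hx)]
    simp only [Q]
    rw [hξη σ hσ x hx, hξη σ' hσ' x hx]
    congr 3
    refine intervalIntegral.integral_congr fun y hy => ?_
    have hy' : y ∈ Icc (-r) r := uIcc_subset_Icc hr0 hx hy
    simp only [hξη σ hσ y hy', hξη σ' hσ' y hy']
  refine ⟨r, hrpos, by linarith, ξ, hξc, ?_⟩
  rintro ⟨σ, x⟩ ⟨hσ, hx⟩
  have hσ' := Ioo_subset_Icc_self hσ
  have hx' := Ioo_subset_Icc_self hx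
  simp only at hσ hx hσ' hx' ⊢
  refine ⟨?_, ?_, ?_, ?_⟩
  · rw [hξη σ hσ' x hx']
    exact hηm σ (hsub hσ') x (hsub hx')
  · rw [hξη σ hσ' 0 hr0, hη0]
  · rw [hξη σ hσ' x hx']
    refine (hηd σ x (hsub hx')).congr_of_eventuallyEq ?_
    filter_upwards [Icc_mem_nhds hx.1 hx.2] with y hy using hξη σ hσ' y hy
  · have hQσ : Q σ (σ, x) = (X (0, σ)).1 / (X (x, ξ (σ, x))).1 *
          Real.exp (∫ y in (0 : ℝ)..x, h (y, ξ (σ, y)) / (X (y, ξ (σ, y))).1) := by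
      simp only [Q, hk, ha, segmentMean_diag]
    rw [← hQσ, hasDerivAt_iff_tendsto_slope]
    have hlim : Filter.Tendsto (fun σ' => Q σ' (σ, x)) (nhdsWithin σ {σ}ᶜ)
        (nhds (Q σ (σ, x))) :=
      ((hQ.comp (by fun_prop : Continuous fun σ' : ℝ => (σ', σ, x))).tendsto σ).mono_left
        nhdsWithin_le_nhds
    refine hlim.congr' ?_
    filter_upwards [self_mem_nhdsWithin, mem_nhdsWithin_of_mem_nhds (Icc_mem_nhds hσ.1 hσ.2)]
      with σ₁ hne hσ₁
    rw [slope_def_field, hξdiff σ hσ' σ₁ hσ₁ x hx', mul_div_cancel_left₀]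
    exact sub_ne_zero.2 hne

/-! ### First integrals of fields with continuous divergence. -/

open Topology in
/-- `t` is a `C¹` first integral of the field `X` on `U`, with gradient `G` times the rotation
`(-X₂, X₁)` of `X`, where `G` is positive and satisfies `X G = -h G` along trajectories. -/
structure IsFirstIntegral (X : Plane → Plane) (h : Plane → ℝ) (U : Set Plane)
    (t G : Plane → ℝ) : Prop where
  isOpen : IsOpen U
  continuousOn : ContinuousOn G U
  pos : ∀ q ∈ U, 0 < G q
  hasFDerivAt : ∀ q ∈ U, HasFDerivAt t (columnsP (-(G q * (X q).2)) (G q * (X q).1)) q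
  transport : ∀ (c : ℝ → Plane) (β : ℝ → ℝ) (τ₀ : ℝ),
    (∀ᶠ τ in 𝓝 τ₀, c τ ∈ U ∧ HasDerivAt c (β τ • X (c τ)) τ) →
    HasDerivAt (fun τ => G (c τ)) (-(β τ₀ * h (c τ₀) * G (c τ₀))) τ₀

lemma IsFirstIntegral.congr {X X' : Plane → Plane} {h h' : Plane → ℝ} {U : Set Plane}
    {t G : Plane → ℝ} (H : IsFirstIntegral X h U t G) (hX : EqOn X X' U) (hh : EqOn h h' U) :
    IsFirstIntegral X' h' U t G where
  isOpen := H.isOpen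
  continuousOn := H.continuousOn
  pos := H.pos
  hasFDerivAt q hq := hX hq ▸ H.hasFDerivAt q hq
  transport c β τ₀ hc := by
    rw [← hh hc.self_of_nhds.1]
    exact H.transport c β τ₀ (hc.mono fun τ hτ => ⟨hτ.1, by rw [hX hτ.1]; exact hτ.2⟩)

lemma HasUniformDiv.congr {Ω : Set Plane} {X X' : Plane → Plane} {h h' : Plane → ℝ}
    (H : HasUniformDiv Ω X h) (hX : EqOn X X' Ω) (hh : EqOn h h' Ω) : HasUniformDiv Ω X' h' := by
  intro K hK hKc ε hε
  obtain ⟨Y, hY, hYX⟩ := H K hK hKc ε hε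
  exact ⟨Y, hY, fun p hp => by rw [← hX (hK hp), ← hh (hK hp)]; exact hYX p hp⟩

open Topology in
-- The map `(σ, x) ↦ (x, ξ (σ, x))` straightens the trajectories. It is a local `C¹` diffeomorphism
-- because the flow has a positive derivative in `σ`; the first integral is the initial value `σ` as
-- a function of the point.
lemma HasUniformDiv.exists_firstIntegral_of_pos {ρ : ℝ} (hρ : 0 < ρ) {X : Plane → Plane}
    {h : Plane → ℝ} (hX : Continuous X) (hh : Continuous h) {α B : ℝ} (hα : 0 < α)
    (hX1 : ∀ z, α ≤ (X z).1) (hX2 : ∀ z, |(X z).2| ≤ (X z).1) (hB1 : ∀ z, (X z).1 ≤ B)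
    (hB2 : ∀ z, |h z| ≤ B)
    (hdiv : HasUniformDiv (Ioo (-ρ) ρ ×ˢ Ioo (-ρ) ρ) X h) :
    ∃ (U : Set Plane) (t G : Plane → ℝ), (0 : Plane) ∈ U ∧ U ⊆ Ioo (-ρ) ρ ×ˢ Ioo (-ρ) ρ ∧
      IsFirstIntegral X h U t G := by
  obtain ⟨r, hr, hrρ, ξ, hξ, H⟩ := hdiv.exists_flow hρ hX hh hα hX1 hX2 hB1 hB2
  have hX1' : ∀ z, 0 < (X z).1 := fun z => hα.trans_le (hX1 z)
  set S : Set Plane := Ioo (-r) r ×ˢ Ioo (-r) r with hS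
  have hSo : IsOpen S := isOpen_Ioo.prod isOpen_Ioo
  have h0S : (0 : Plane) ∈ S := ⟨⟨by simpa using hr, hr⟩, ⟨by simpa using hr, hr⟩⟩
  let m : Plane → ℝ := fun z => (X (z.2, ξ z)).2 / (X (z.2, ξ z)).1
  let E : Plane → ℝ := fun z =>
    Real.exp (∫ x in (0 : ℝ)..z.2, h (x, ξ (z.1, x)) / (X (x, ξ (z.1, x))).1)
  let d : Plane → ℝ := fun z => (X (0, z.1)).1 / (X (z.2, ξ z)).1 * E z
  have hφ : Continuous fun z : Plane => h (z.2, ξ z) / (X (z.2, ξ z)).1 :=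
    (hh.comp (by fun_prop)).div (hX.fst.comp (by fun_prop)) fun _ => (hX1' _).ne'
  have hE : Continuous E := by
    refine Real.continuous_exp.comp ?_
    exact intervalIntegral.continuous_parametric_intervalIntegral_of_continuous
      (f := fun (z : Plane) x => h (x, ξ (z.1, x)) / (X (x, ξ (z.1, x))).1)
      (hφ.comp (by fun_prop : Continuous fun p : Plane × ℝ => ((p.1.1, p.2) : Plane)))
      continuous_snd
  have hm : Continuous m := (hX.snd.comp (by fun_prop)).div (hX.fst.comp (by fun_prop))
    fun _ => (hX1' _).ne'
  have hd : Continuous d := ((hX.fst.comp (by fun_prop)).div (hX.fst.comp (by fun_prop))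
    fun _ => (hX1' _).ne').mul hE
  have hdpos : ∀ z, 0 < d z := fun z => mul_pos (div_pos (hX1' _) (hX1' _)) (Real.exp_pos _)
  have hΞ : ∀ z ∈ S, HasFDerivAt (fun z : Plane => ((z.2, ξ z) : Plane))
      (columnsP (0, d z) (1, m z)) z := by
    intro z hz
    have h1 := (hasStrictFDerivAt_of_partials hSo (f := ξ) (a := d) (b := m)
      (fun q hq => (H q hq).2.2.2) (fun q hq => (H q hq).2.2.1) hd.continuousOn hm.continuousOn
      hz).hasFDerivAt
    refine (hasFDerivAt_snd.prodMk h1).congr_fderiv ?_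
    ext <;> simp [columnsP_apply]
  have hw : ∀ x y : ℝ, wedgeP (0, x) (1, y) = -x := fun x y => by simp [wedgeP]
  obtain ⟨e, he0, heS, heΞ, -, -, hes⟩ := exists_openPartialHomeomorph_of_columns hSo hΞ
    (by fun_prop) (by fun_prop) (fun z _ => by rw [hw]; exact (neg_neg_of_pos (hdpos z)).ne) h0S
  let t : Plane → ℝ := fun q => (e.symm q).1
  -- The gradient of `t` forces `G = 1 / (d X₁)` (`hGd`). In the product `d X₁` the value of `X₁` at
  -- the point itself cancels, leaving an expression that can be differentiated along trajectories
  -- although `X` is only continuous: there `t` is constant and only `E` varies.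
  let G : Plane → ℝ := fun q => ((X (0, t q)).1 * E (t q, q.1))⁻¹
  have hsymm : ∀ q ∈ e.target, e.symm q ∈ S ∧ q = ((e.symm q).2, ξ (e.symm q)) := fun q hq =>
    ⟨heS (e.map_target hq), by rw [← heΞ, e.right_inv hq]⟩
  have hsq : ∀ q ∈ e.target, e.symm q = (t q, q.1) := fun q hq => by
    have := congrArg Prod.fst (hsymm q hq).2
    exact Prod.ext rfl this.symm
  have hsq2 : ∀ q ∈ e.target, ξ (t q, q.1) = q.2 := fun q hq => by
    rw [← hsq q hq]; exact (congrArg Prod.snd (hsymm q hq).2).symm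
  have hGd : ∀ q ∈ e.target, G q = (d (e.symm q) * (X q).1)⁻¹ := fun q hq => by
    have := (hX1' q).ne'
    have h2 : d (e.symm q) = (X (0, t q)).1 / (X q).1 * E (t q, q.1) := by
      simp only [d]
      rw [← (hsymm q hq).2, hsq q hq]
    simp only [G]
    rw [h2]
    congr 1
    field_simp
  have htd : ∀ q ∈ e.target, HasFDerivAt t (columnsP (-(G q * (X q).2)) (G q * (X q).1)) q := by
    intro q hq
    refine (hasFDerivAt_fst.comp q (hes q hq)).congr_fderiv ?_
    have h1 := (hdpos (e.symm q)).ne'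
    have h2 := (hX1' q).ne'
    have h3 : m (e.symm q) = (X q).2 / (X q).1 := by
      simp only [m]
      rw [← (hsymm q hq).2]
    rw [hGd q hq]
    ext
    · simp only [columnsP_apply, hw, ContinuousLinearMap.comp_apply,
        ContinuousLinearMap.inl_apply, ContinuousLinearMap.coe_fst', smul_eq_mul, h3]
      simp
      field_simp
    · simp only [columnsP_apply, hw, ContinuousLinearMap.comp_apply,
        ContinuousLinearMap.inr_apply, ContinuousLinearMap.coe_fst', smul_eq_mul, h3]
      simp
      field_simp
  refine ⟨e.target, t, G, ?_, ?_, e.open_target, ?_, ?_, htd, ?_⟩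
  · have h1 := e.map_source he0
    rw [heΞ] at h1
    have h2 := (H 0 h0S).2.1
    simp only [Prod.fst_zero] at h2
    have : (((0 : Plane).2, ξ 0) : Plane) = 0 := Prod.ext rfl h2
    rwa [this] at h1
  · intro q hq
    obtain ⟨h1, h2⟩ := hsymm q hq
    rw [h2]
    exact ⟨⟨by linarith [h1.2.1], by linarith [h1.2.2]⟩, (H _ h1).1⟩
  · have ht : ContinuousOn t e.target := continuous_fst.comp_continuousOn e.continuousOn_symm
    refine ContinuousOn.inv₀ ?_ fun q _ => (mul_pos (hX1' _) (Real.exp_pos _)).ne'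
    exact (hX.fst.comp_continuousOn (continuousOn_const.prodMk ht)).mul
      (hE.comp_continuousOn (ht.prodMk continuousOn_fst))
  · exact fun q _ => inv_pos.2 (mul_pos (hX1' _) (Real.exp_pos _))
  · intro c β τ₀ hc
    have htc : ∀ᶠ τ in 𝓝 τ₀, HasDerivAt (fun τ => t (c τ)) 0 τ := by
      filter_upwards [hc] with τ hτ
      refine ((htd _ hτ.1).comp_hasDerivAt τ hτ.2).congr_deriv ?_
      simp only [columnsP_apply, Prod.smul_fst, Prod.smul_snd, smul_eq_mul]
      ring
    obtain ⟨δ, hδ, hball⟩ := Metric.eventually_nhds_iff_ball.1 htc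
    rw [Real.ball_eq_Ioo] at hball
    have hτ₀ : τ₀ ∈ Ioo (τ₀ - δ) (τ₀ + δ) := ⟨by linarith, by linarith⟩
    have hconst : ∀ τ ∈ Ioo (τ₀ - δ) (τ₀ + δ), t (c τ) = t (c τ₀) := fun τ hτ =>
      eq_of_hasDerivAt_zero hball hτ hτ₀
    have hc0 := hc.self_of_nhds
    have hψ : Continuous fun x => h (x, ξ (t (c τ₀), x)) / (X (x, ξ (t (c τ₀), x))).1 :=
      hφ.comp (by fun_prop : Continuous fun x : ℝ => ((t (c τ₀), x) : Plane))
    have h1 : HasDerivAt (fun τ => E (t (c τ₀), (c τ).1))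
        (E (t (c τ₀), (c τ₀).1) * (h (c τ₀) * β τ₀)) τ₀ := by
      refine ((hasDerivAt_primitive hψ 0 (c τ₀).1).comp τ₀ hc0.2.fst').exp.congr_deriv ?_
      simp only [hsq2 _ hc0.1, Prod.smul_fst, smul_eq_mul, E, Function.comp]
      have := (hX1' (c τ₀)).ne'
      field_simp
    have hEpos : E (t (c τ₀), (c τ₀).1) ≠ 0 := (Real.exp_pos _).ne'
    have hXpos := (hX1' (0, t (c τ₀))).ne'
    have h2 := (h1.const_mul (X (0, t (c τ₀))).1).inv (mul_ne_zero hXpos hEpos)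
    have h3 : (fun τ => G (c τ)) =ᶠ[𝓝 τ₀]
        fun τ => ((X (0, t (c τ₀))).1 * E (t (c τ₀), (c τ).1))⁻¹ := by
      filter_upwards [Ioo_mem_nhds hτ₀.1 hτ₀.2] with τ hτ
      simp only [G]
      rw [hconst τ hτ]
    refine (h2.congr_of_eventuallyEq h3).congr_deriv ?_
    simp only [G]
    field_simp

/-- A continuous function is globally continuous and bounded after restriction to a small square
and extension. -/
lemma exists_square_subset {Ω : Set Plane} (hΩ : Ω ∈ nhds (0 : Plane)) :
    ∃ ρ > 0, Icc (-ρ) ρ ×ˢ Icc (-ρ) ρ ⊆ Ω := by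
  obtain ⟨ρ, hρ, h⟩ := Metric.nhds_basis_closedBall.mem_iff.1 hΩ
  refine ⟨ρ, hρ, fun z hz => h ?_⟩
  rw [mem_closedBall_zero_iff, Prod.norm_def]
  exact max_le (abs_le.2 hz.1) (abs_le.2 hz.2)

open Topology in
-- The bounds required on the whole plane hold near `0` by continuity, with `X₁ > 1/2 > |X₂|`.
-- Extension from a small square takes no new values, so they persist.
lemma HasUniformDiv.exists_firstIntegral_at_zero {Ω : Set Plane} (hΩ : IsOpen Ω)
    (h0 : (0 : Plane) ∈ Ω) {X : Plane → Plane} {h : Plane → ℝ} (hdiv : HasUniformDiv Ω X h)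
    (hX : ContinuousOn X Ω) (hh : ContinuousOn h Ω) (hX0 : X 0 = (1, 0)) :
    ∃ (U : Set Plane) (t G : Plane → ℝ), (0 : Plane) ∈ U ∧ U ⊆ Ω ∧
      IsFirstIntegral X h U t G := by
  have hXc : ContinuousAt X 0 := hX.continuousAt (hΩ.mem_nhds h0)
  have e1 : ∀ᶠ z in 𝓝 (0 : Plane), 1 / 2 < (X z).1 :=
    (continuousAt_fst.comp hXc).eventually (lt_mem_nhds (by simp [hX0]; norm_num))
  have e2 : ∀ᶠ z in 𝓝 (0 : Plane), |(X z).2| < 1 / 2 :=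
    (continuous_abs.continuousAt.comp (continuousAt_snd.comp hXc)).eventually
      (gt_mem_nhds (by simp [hX0]))
  obtain ⟨ρ, hρ, hsub⟩ := exists_square_subset ((hΩ.mem_nhds h0 : _) |> fun h3 =>
    Filter.inter_mem h3 (Filter.inter_mem e1 e2))
  have hcomp : IsCompact (Icc (-ρ) ρ ×ˢ Icc (-ρ) ρ) := isCompact_Icc.prod isCompact_Icc
  have hsub' : Icc (-ρ) ρ ×ˢ Icc (-ρ) ρ ⊆ Ω := fun z hz => (hsub hz).1
  obtain ⟨B₁, hB₁⟩ := hcomp.exists_bound_of_continuousOn (hX.mono hsub')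
  obtain ⟨B₂, hB₂⟩ := hcomp.exists_bound_of_continuousOn (hh.mono hsub')
  obtain ⟨g, hg, hgeq, hgval⟩ := ((hX.prodMk hh).mono hsub').exists_extend_rect
    (by linarith) (by linarith)
  have hIoo : Ioo (-ρ) ρ ×ˢ Ioo (-ρ) ρ ⊆ Icc (-ρ) ρ ×ˢ Icc (-ρ) ρ :=
    prod_mono Ioo_subset_Icc_self Ioo_subset_Icc_self
  have q1 : EqOn X (fun z => (g z).1) (Ioo (-ρ) ρ ×ˢ Ioo (-ρ) ρ) := fun z hz => by
    simp only [hgeq (hIoo hz)]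
  have q2 : EqOn h (fun z => (g z).2) (Ioo (-ρ) ρ ×ˢ Ioo (-ρ) ρ) := fun z hz => by
    simp only [hgeq (hIoo hz)]
  obtain ⟨U, t, G, h0U, hU, hI⟩ := ((hdiv.mono (hIoo.trans hsub')).congr q1
    q2).exists_firstIntegral_of_pos hρ hg.fst hg.snd (α := 1 / 2) (B := max B₁ B₂) (by norm_num)
    (fun z => by
      obtain ⟨z', hz', e⟩ := hgval z
      rw [e]; exact (hsub hz').2.1.le)
    (fun z => by
      obtain ⟨z', hz', e⟩ := hgval z
      rw [e]; exact (hsub hz').2.2.le.trans (hsub hz').2.1.le)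
    (fun z => by
      obtain ⟨z', hz', e⟩ := hgval z
      rw [e]
      exact (le_abs_self _).trans ((norm_fst_le (X z')).trans ((hB₁ z' hz').trans
        (le_max_left _ _))))
    (fun z => by
      obtain ⟨z', hz', e⟩ := hgval z
      rw [e]
      exact (hB₂ z' hz').trans (le_max_right _ _))
  exact ⟨U, t, G, h0U, hU.trans (hIoo.trans hsub'), hI.congr (fun z hz => (q1 (hU hz)).symm)
    fun z hz => (q2 (hU hz)).symm⟩

open Topology in
/-- Near every point where it does not vanish, a continuous field with continuous divergence has a
`C¹` first integral with nonvanishing gradient. -/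
theorem HasUniformDiv.exists_firstIntegral {Ω : Set Plane} (hΩ : IsOpen Ω) {X : Plane → Plane}
    {h : Plane → ℝ} (hdiv : HasUniformDiv Ω X h) (hX : ContinuousOn X Ω) (hh : ContinuousOn h Ω)
    {p : Plane} (hp : p ∈ Ω) (hXp : X p ≠ 0) :
    ∃ (U : Set Plane) (t G : Plane → ℝ), p ∈ U ∧ U ⊆ Ω ∧ IsFirstIntegral X h U t G := by
  set ν := X p with hν
  set D := ν.1 ^ 2 + ν.2 ^ 2 with hD
  have hD0 : 0 < D := by
    by_contra hcon
    apply hXp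
    ext <;> simp <;> nlinarith [sq_nonneg ν.1, sq_nonneg ν.2]
  have hwν : wedgeP ν (-ν.2, ν.1) = D := by simp only [wedgeP, hD]; ring
  -- A similarity taking `(1, 0)` to `ν = X p`, with determinant `D`. The transformed field equals
  -- `(1, 0)` at the origin, and divergences are invariant under linear changes of variables.
  let E : Plane ≃L[ℝ] Plane := columnsEquivP ν (-ν.2, ν.1) (hwν ▸ hD0.ne')
  have hE : ∀ v, E v = v.1 • ν + v.2 • ((-ν.2, ν.1) : Plane) := fun v => columnsP_apply _ _ _
  have hEs : ∀ v, E.symm v = ((ν.1 * v.1 + ν.2 * v.2) / D, (-ν.2 * v.1 + ν.1 * v.2) / D) := by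
    intro v
    have : E.symm v = _ := columnsP_apply (ν.1 / wedgeP ν (-ν.2, ν.1), -ν.2 / wedgeP ν (-ν.2, ν.1))
      (-(-ν.2) / wedgeP ν (-ν.2, ν.1), ν.1 / wedgeP ν (-ν.2, ν.1)) v
    rw [this, hwν]
    ext <;> simp <;> ring
  let R : Plane → Plane := fun z => p + E z
  have hR : Continuous R := continuous_const.add E.continuous
  let R' : Plane → Plane := fun q => E.symm (q - p)
  have hR' : Continuous R' := E.symm.continuous.comp (continuous_id.sub continuous_const)
  have hRR' : ∀ q, R (R' q) = q := fun q => by simp [R, R']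
  have hR'R : ∀ z, R' (R z) = z := fun z => by simp [R, R']
  have hdiv' : HasUniformDiv (R ⁻¹' Ω) (fun z => E.symm (X (R z))) fun z => h (R z) := by
    intro K hK hKc ε hε
    obtain ⟨M, hM, hbd⟩ : ∃ M > 0, ∀ v, ‖E.symm v‖ ≤ M * ‖v‖ :=
      ((E.symm : Plane →L[ℝ] Plane)).bound
    obtain ⟨Y, hY, hYX⟩ := hdiv (R '' K) (image_subset_iff.2 hK) (hKc.image hR)
      (min ε (ε / M)) (lt_min hε (div_pos hε hM))
    refine ⟨fun z => E.symm (Y (R z)), E.symm.contDiff.comp (hY.comp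
      (contDiff_const.add E.contDiff)), fun z hz => ?_⟩
    obtain ⟨h1, h2⟩ := hYX _ (mem_image_of_mem R hz)
    constructor
    · rw [← map_sub]
      refine (hbd _).trans ((mul_le_mul_of_nonneg_left (h1.trans (min_le_right _ _)) hM.le).trans ?_)
      rw [mul_div_cancel₀ _ hM.ne']
    · have hder : HasFDerivAt (fun z => E.symm (Y (R z)))
          ((E.symm : Plane →L[ℝ] Plane).comp ((fderiv ℝ Y (R z)).comp (E : Plane →L[ℝ] Plane))) z :=
        E.symm.hasFDerivAt.comp z (((hY.differentiable one_ne_zero _).hasFDerivAt).comp z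
          (E.hasFDerivAt.const_add p))
      have : divP (fun z => E.symm (Y (R z))) z = divP Y (R z) := by
        rw [divP, hder.fderiv, divP]
        simp only [ContinuousLinearMap.comp_apply, ContinuousLinearEquiv.coe_coe]
        rw [clm_plane_apply _ (E (1, 0)), clm_plane_apply _ (E (0, 1)), hEs, hEs, hE, hE]
        generalize fderiv ℝ Y (R z) (1, 0) = a
        generalize fderiv ℝ Y (R z) (0, 1) = b
        simp
        field_simp
        rw [hD]
        ring
      rw [this]
      exact h2.trans (min_le_left _ _)
  have hmaps : MapsTo R (R ⁻¹' Ω) Ω := fun z hz => hz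
  obtain ⟨U, t, G, h0U, hU, hI⟩ := hdiv'.exists_firstIntegral_at_zero (hΩ.preimage hR)
    (by simpa [R] using hp)
    (E.symm.continuous.comp_continuousOn (hX.comp hR.continuousOn hmaps))
    (hh.comp hR.continuousOn hmaps) (by
      simp only [R, map_zero, add_zero]
      rw [← hν, hEs]
      ext
      · simp; field_simp; rw [hD]
      · simp; left; ring)
  -- Rotating by a right angle and changing variables by `E` commute only up to the determinant,
  -- whence the factor `1 / D` in the gradient.
  refine ⟨R' ⁻¹' U, fun q => t (R' q), fun q => G (R' q) / D, by simpa [R'] using h0U,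
    fun q hq => by simpa [hRR'] using hU hq, hI.isOpen.preimage hR', ?_, ?_, ?_, ?_⟩
  · exact (hI.continuousOn.comp hR'.continuousOn fun q hq => hq).div_const D
  · exact fun q hq => div_pos (hI.pos _ hq) hD0
  · intro q hq
    have h1 := (hI.hasFDerivAt _ hq).comp q (E.symm.hasFDerivAt.comp q
      ((hasFDerivAt_id q).sub_const p))
    refine h1.congr_fderiv ?_
    simp only [hRR']
    ext
    · simp [columnsP_apply, hEs]
      field_simp
      rw [hD]
      ring
    · simp [columnsP_apply, hEs]
      field_simp
      rw [hD]
      ring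
  · intro c β τ₀ hc
    have h1 := hI.transport (fun τ => R' (c τ)) β τ₀ (hc.mono fun τ hτ => ⟨hτ.1, by
      have := (E.symm : Plane →L[ℝ] Plane).hasFDerivAt.comp_hasDerivAt τ (hτ.2.sub_const p)
      refine this.congr_deriv ?_
      rw [hRR']
      exact map_smul _ _ _⟩)
    refine (h1.div_const D).congr_deriv ?_
    rw [hRR']
    ring

/-! ### Reparametrization and derivatives along curves. -/

open Topology in
/-- A curve with velocity `b Y`, `b > 0`, is a reparametrized integral curve of `Y`. -/
lemma exists_reparametrization {Y : Plane → Plane} {Ω : Set Plane} {c : ℝ → Plane} {b : ℝ → ℝ}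
    {x₁ x₂ τ₀ : ℝ} (hτ₀ : τ₀ ∈ Ioo x₁ x₂) (hc : ∀ τ ∈ Ioo x₁ x₂, HasDerivAt c (b τ • Y (c τ)) τ)
    (hcΩ : MapsTo c (Ioo x₁ x₂) Ω) (hb : ContinuousOn b (Ioo x₁ x₂))
    (hb0 : ∀ τ ∈ Ioo x₁ x₂, 0 < b τ) :
    ∃ (γ : ℝ → Plane) (y₁ y₂ σ₀ : ℝ) (T : ℝ → ℝ), IsCurveIn Y Ω γ y₁ y₂ ∧ σ₀ ∈ Ioo y₁ y₂ ∧
      γ σ₀ = c τ₀ ∧ T τ₀ = σ₀ ∧ HasDerivAt T (b τ₀) τ₀ ∧ ∀ᶠ τ in 𝓝 τ₀, γ (T τ) = c τ := by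
  obtain ⟨w₁, hw₁⟩ := exists_between hτ₀.1
  obtain ⟨w₂, hw₂⟩ := exists_between hτ₀.2
  have hw : w₁ ≤ w₂ := (hw₁.2.trans hw₂.1).le
  have hsub : Icc w₁ w₂ ⊆ Ioo x₁ x₂ := Icc_subset_Ioo hw₁.1 hw₂.2
  -- Extending `b` by constants makes the new time `P` a primitive on the whole line; its local
  -- inverse is the required change of parameter.
  let bb : ℝ → ℝ := fun x => b (projIcc w₁ w₂ hw x)
  have hbb : Continuous bb :=
    (hb.mono hsub).comp_continuous (by fun_prop) fun x => Subtype.coe_prop _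
  have hbbeq : ∀ x ∈ Icc w₁ w₂, bb x = b x := fun x hx => by simp [bb, projIcc_of_mem hw hx]
  have hbb0 : ∀ x, bb x ≠ 0 := fun x => (hb0 _ (hsub (Subtype.coe_prop _))).ne'
  let P : ℝ → ℝ := fun x => ∫ z in τ₀..x, bb z
  have hP : ∀ x, HasDerivAt P (bb x) x := fun x => hasDerivAt_primitive hbb τ₀ x
  have hPs : HasStrictDerivAt P (bb τ₀) τ₀ :=
    hasStrictDerivAt_of_hasDerivAt_of_continuousAt (Filter.Eventually.of_forall hP)
      hbb.continuousAt
  have hPe := hPs.hasStrictFDerivAt_equiv (hbb0 τ₀)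
  let e := hPe.toOpenPartialHomeomorph P
  have heP : ∀ x, e x = P x := fun _ => rfl
  have hτe : τ₀ ∈ e.source := hPe.mem_toOpenPartialHomeomorph_source
  have hP0 : P τ₀ = 0 := by simp [P]
  have hT : e.target ∩ e.symm ⁻¹' Ioo w₁ w₂ ∈ 𝓝 (0 : ℝ) := by
    refine (e.isOpen_inter_preimage_symm isOpen_Ioo).mem_nhds ⟨?_, ?_⟩
    · rw [← hP0]; exact e.map_source hτe
    · rw [mem_preimage, ← hP0, ← heP, e.left_inv hτe]
      exact ⟨hw₁.2, hw₂.1⟩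
  obtain ⟨δ, hδ, hball⟩ := Metric.mem_nhds_iff.1 hT
  rw [Real.ball_eq_Ioo, zero_sub, zero_add] at hball
  refine ⟨fun y => c (e.symm y), -δ, δ, 0, P, ⟨fun y hy => ?_, fun y hy => ?_⟩,
    ⟨by linarith, hδ⟩, ?_, hP0, ?_, ?_⟩
  · obtain ⟨hy1, hy2⟩ := hball hy
    have hy2' : e.symm y ∈ Ioo w₁ w₂ := hy2
    have h1 : HasDerivAt e.symm (bb (e.symm y))⁻¹ y :=
      e.hasDerivAt_symm hy1 (hbb0 _) (hP _)
    have h2 := (hc _ (hsub (Ioo_subset_Icc_self hy2'))).scomp y h1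
    refine HasDerivAt.hasDerivWithinAt (h2.congr_deriv ?_)
    rw [hbbeq _ (Ioo_subset_Icc_self hy2'), smul_smul, inv_mul_cancel₀, one_smul]
    exact (hb0 _ (hsub (Ioo_subset_Icc_self hy2'))).ne'
  · exact hcΩ (hsub (Ioo_subset_Icc_self (hball hy).2))
  · simp only
    rw [← hP0, ← heP, e.left_inv hτe]
  · rw [← hbbeq τ₀ ⟨hw₁.2.le, hw₂.1.le⟩]
    exact hP τ₀
  · filter_upwards [e.open_source.mem_nhds hτe] with τ hτ
    rw [← heP, e.left_inv hτ]

/-- `HasDerivAlong` speaks of exact integral curves only, whereas coordinate lines of a chart have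
velocity `b Y`. The change of time contributes the factor `b τ₀`. -/
lemma HasDerivAlong.hasDerivAt_comp {Y : Plane → Plane} {Ω : Set Plane} {h : Plane → ℝ}
    {c : ℝ → Plane} {b : ℝ → ℝ} {x₁ x₂ τ₀ d : ℝ} (hd : HasDerivAlong Y Ω h (c τ₀) d)
    (hτ₀ : τ₀ ∈ Ioo x₁ x₂) (hc : ∀ τ ∈ Ioo x₁ x₂, HasDerivAt c (b τ • Y (c τ)) τ)
    (hcΩ : MapsTo c (Ioo x₁ x₂) Ω) (hb : ContinuousOn b (Ioo x₁ x₂))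
    (hb0 : ∀ τ ∈ Ioo x₁ x₂, 0 < b τ) : HasDerivAt (fun τ => h (c τ)) (b τ₀ * d) τ₀ := by
  obtain ⟨γ, y₁, y₂, σ₀, T, hγ, hσ₀, hγσ, hT0, hT, hev⟩ :=
    exists_reparametrization hτ₀ hc hcΩ hb hb0
  have h1 := hd γ y₁ y₂ σ₀ hγ hσ₀ hγσ
  rw [← hT0] at h1
  have h2 : HasDerivAt (fun τ => h (γ (T τ))) (d * b τ₀) τ₀ := h1.comp τ₀ hT
  rw [mul_comm]
  exact h2.congr_of_eventuallyEq (hev.mono fun τ hτ => by simp only [hτ])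

/-! ### Differentiability of the unit field across the characteristics. -/

lemma ContinuousOn.integral_fst {E : Type*} [NormedAddCommGroup E] [NormedSpace ℝ E]
    {a b c d s₁ : ℝ} (hab : a ≤ b) (hcd : c ≤ d) {k : ℝ × ℝ → E}
    (hk : ContinuousOn k (Icc a b ×ˢ Icc c d)) (hs₁ : s₁ ∈ Icc a b) :
    ContinuousOn (fun z : ℝ × ℝ => ∫ s in s₁..z.1, k (s, z.2)) (Icc a b ×ˢ Icc c d) := by
  obtain ⟨g, hg, hgk, -⟩ := hk.exists_extend_rect hab hcd
  have : Continuous fun z : ℝ × ℝ => ∫ s in s₁..z.1, g (s, z.2) :=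
    intervalIntegral.continuous_parametric_intervalIntegral_of_continuous
      (f := fun (z : ℝ × ℝ) s => g (s, z.2)) (hg.comp (by fun_prop)) continuous_fst
  refine this.continuousOn.congr fun z hz => intervalIntegral.integral_congr fun s hs => ?_
  exact (hgk (show (s, z.2) ∈ Icc a b ×ˢ Icc c d from ⟨uIcc_subset_Icc hs₁ hz.1 hs, hz.2⟩)).symm

open Topology in
/-- Differentiation under the integral sign on a rectangle. -/
lemma hasDerivAt_integral_fst {E : Type*} [NormedAddCommGroup E] [NormedSpace ℝ E]
    {a b c d s₁ s₂ : ℝ} {k k' : ℝ × ℝ → E}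
    (hk : ContinuousOn k (Icc a b ×ˢ Icc c d)) (hk' : ContinuousOn k' (Icc a b ×ˢ Icc c d))
    (hd : ∀ s ∈ Icc a b, ∀ t ∈ Ioo c d, HasDerivAt (fun t => k (s, t)) (k' (s, t)) t)
    (hs₁ : s₁ ∈ Icc a b) (hs₂ : s₂ ∈ Icc a b) {t : ℝ} (ht : t ∈ Ioo c d) :
    HasDerivAt (fun t => ∫ s in s₁..s₂, k (s, t)) (∫ s in s₁..s₂, k' (s, t)) t := by
  obtain ⟨M, hM⟩ := (isCompact_Icc.prod isCompact_Icc).exists_bound_of_continuousOn hk'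
  have hsub : uIcc s₁ s₂ ⊆ Icc a b := uIcc_subset_Icc hs₁ hs₂
  have hsub' : uIoc s₁ s₂ ⊆ Icc a b := uIoc_subset_uIcc.trans hsub
  have sl : ∀ {f : ℝ × ℝ → E}, ContinuousOn f (Icc a b ×ˢ Icc c d) → ∀ x ∈ Icc c d,
      ContinuousOn (fun s => f (s, x)) (uIcc s₁ s₂) := fun hf x hx =>
    (hf.slice_left hx).mono hsub
  have ms : ∀ {f : ℝ × ℝ → E}, ContinuousOn f (Icc a b ×ˢ Icc c d) → ∀ x ∈ Icc c d,
      AEStronglyMeasurable (fun s => f (s, x)) (volume.restrict (uIoc s₁ s₂)) := fun hf x hx =>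
    ((hf.slice_left hx).mono hsub').aestronglyMeasurable measurableSet_uIoc
  refine (intervalIntegral.hasDerivAt_integral_of_dominated_loc_of_deriv_le
    (F := fun t s => k (s, t)) (F' := fun t s => k' (s, t)) (bound := fun _ => M)
    (Ioo_mem_nhds ht.1 ht.2) ?_ (sl hk t (Ioo_subset_Icc_self ht)).intervalIntegrable
    (ms hk' t (Ioo_subset_Icc_self ht)) ?_ (by simp) ?_).2
  · filter_upwards [Icc_mem_nhds ht.1 ht.2] with x hx using ms hk x hx
  · exact ae_of_all _ fun s hs x hx => hM (s, x) ⟨hsub' hs, Ioo_subset_Icc_self hx⟩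
  · exact ae_of_all _ fun s hs x hx => hd s (hsub' hs) x hx

open Complex in
/-- Let `∂φ/∂s = -i ε n` and `∂n/∂s = -i η n` with `|n| = 1`, `ε > 0` and `η` real, all of `φ`,
`ε`, `η` being continuously differentiable in `t`. Then so is `n`. -/
lemma exists_transverse_deriv {a b c d : ℝ} (hab : a < b) (hcd : c < d)
    {φ n φ' : ℝ × ℝ → ℂ} {ε η ε' η' : ℝ × ℝ → ℝ}
    (hn : ContinuousOn n (Icc a b ×ˢ Icc c d)) (hφ' : ContinuousOn φ' (Icc a b ×ˢ Icc c d))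
    (hε : ContinuousOn ε (Icc a b ×ˢ Icc c d)) (hη : ContinuousOn η (Icc a b ×ˢ Icc c d))
    (hε' : ContinuousOn ε' (Icc a b ×ˢ Icc c d)) (hη' : ContinuousOn η' (Icc a b ×ˢ Icc c d))
    (hε0 : ∀ z ∈ Icc a b ×ˢ Icc c d, 0 < ε z)
    (dφs : ∀ s ∈ Icc a b, ∀ t ∈ Icc c d, HasDerivAt (fun s => φ (s, t)) (ε (s, t) * (-I * n (s, t))) s)
    (dns : ∀ s ∈ Icc a b, ∀ t ∈ Icc c d, HasDerivAt (fun s => n (s, t)) (-I * η (s, t) * n (s, t)) s)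
    (dφt : ∀ s ∈ Icc a b, ∀ t ∈ Ioo c d, HasDerivAt (fun t => φ (s, t)) (φ' (s, t)) t)
    (dεt : ∀ s ∈ Icc a b, ∀ t ∈ Ioo c d, HasDerivAt (fun t => ε (s, t)) (ε' (s, t)) t)
    (dηt : ∀ s ∈ Icc a b, ∀ t ∈ Ioo c d, HasDerivAt (fun t => η (s, t)) (η' (s, t)) t) :
    ∃ n' : ℝ × ℝ → ℂ, ContinuousOn n' (Ioo a b ×ˢ Ioo c d) ∧
      ∀ s ∈ Ioo a b, ∀ t ∈ Ioo c d, HasDerivAt (fun t => n (s, t)) (n' (s, t)) t := by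
  have ha : a ∈ Icc a b := ⟨le_rfl, hab.le⟩
  let K : ℝ × ℝ → ℝ := fun z => ∫ s in a..z.1, η (s, z.2)
  let K' : ℝ × ℝ → ℝ := fun z => ∫ s in a..z.1, η' (s, z.2)
  have hK : ContinuousOn K (Icc a b ×ˢ Icc c d) := hη.integral_fst hab.le hcd.le ha
  have hK' : ContinuousOn K' (Icc a b ×ˢ Icc c d) := hη'.integral_fst hab.le hcd.le ha
  have dKt : ∀ s ∈ Icc a b, ∀ t ∈ Ioo c d, HasDerivAt (fun t => K (s, t)) (K' (s, t)) t :=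
    fun s hs t ht => hasDerivAt_integral_fst hη hη' dηt ha hs ht
  let ex : ℝ × ℝ → ℂ := fun z => exp (-I * K z)
  have hex : ContinuousOn ex (Icc a b ×ˢ Icc c d) :=
    continuous_exp.comp_continuousOn
      (continuousOn_const.mul (continuous_ofReal.comp_continuousOn hK))
  have dext : ∀ s ∈ Icc a b, ∀ t ∈ Ioo c d,
      HasDerivAt (fun t => ex (s, t)) (ex (s, t) * (-I * K' (s, t))) t := fun s hs t ht =>
    (((dKt s hs t ht).ofReal_comp).const_mul (-I)).cexp
  -- Solving the equation for `n` in `s` reduces the question to the initial values `n (a, t)`,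
  -- since the exponential is already `C¹` in `t`.
  have hsol : ∀ s ∈ Icc a b, ∀ t ∈ Icc c d, n (s, t) = n (a, t) * ex (s, t) := by
    intro s hs t ht
    have hηt : ContinuousOn (fun s => η (s, t)) (Icc a b) := hη.slice_left ht
    obtain ⟨g, hg, hgη⟩ : ∃ g : ℝ → ℝ, Continuous g ∧ EqOn g (fun s => η (s, t)) (Icc a b) :=
      ⟨IccExtend hab.le fun x => η (x, t), hηt.domRestrict.Icc_extend',
        fun x hx => IccExtend_of_mem _ _ hx⟩
    let L : ℝ → ℝ := fun s => ∫ x in a..s, g x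
    have hL : ∀ s ∈ Icc a b, L s = K (s, t) := fun s hs =>
      intervalIntegral.integral_congr fun x hx => hgη (uIcc_subset_Icc ha hs hx)
    have hder : ∀ s ∈ Icc a b, HasDerivWithinAt (fun s => n (s, t) * exp (I * L s)) 0
        (Icc a b) s := by
      intro s hs
      have h1 := (((hasDerivAt_primitive hg a s).ofReal_comp).const_mul I).cexp
      refine (((dns s hs t ht).mul h1).congr_deriv ?_).hasDerivWithinAt
      rw [hgη hs]
      ring
    have := (convex_Icc a b).norm_image_sub_le_of_norm_hasDerivWithin_le (C := 0) hder
      (fun _ _ => by simp) ha hs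
    rw [zero_mul] at this
    have h2 := sub_eq_zero.1 (norm_le_zero_iff.1 this)
    have hL0 : L a = 0 := by simp [L]
    rw [hL0, hL s hs] at h2
    simp only [ofReal_zero, mul_zero, exp_zero, mul_one] at h2
    rw [← h2, mul_assoc, ← exp_add]
    simp
  obtain ⟨M, hM⟩ := (isCompact_Icc.prod isCompact_Icc).exists_bound_of_continuousOn hη
  set M₁ := max M 1 with hM₁
  have hM₁0 : 0 < M₁ := lt_of_lt_of_le one_pos (le_max_right _ _)
  -- On `[a, s₂]` the phase satisfies `|K| ≤ 1 < π / 2`, so the integrand of `q` has positive real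
  -- part and `q` cannot vanish.
  set s₂ := min b (a + 1 / M₁) with hs₂
  have has₂ : a < s₂ := lt_min hab (by linarith [one_div_pos.2 hM₁0])
  have hs₂m : s₂ ∈ Icc a b := ⟨has₂.le, min_le_left _ _⟩
  have hKle : ∀ s ∈ Icc a s₂, ∀ t ∈ Icc c d, |K (s, t)| ≤ 1 := by
    intro s hs t ht
    have := intervalIntegral.norm_integral_le_of_norm_le_const (a := a) (b := s) (C := M₁)
      (f := fun x => η (x, t)) fun x hx => (hM (x, t) ⟨by
        rw [uIoc_of_le hs.1] at hx
        exact ⟨hx.1.le, hx.2.trans (hs.2.trans hs₂m.2)⟩, ht⟩).trans (le_max_left _ _)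
    refine this.trans ?_
    rw [abs_of_nonneg (sub_nonneg.2 hs.1)]
    have h3 : s - a ≤ 1 / M₁ := by linarith [hs.2.trans (min_le_right b (a + 1 / M₁))]
    calc M₁ * (s - a) ≤ M₁ * (1 / M₁) := by gcongr
      _ = 1 := by field_simp
  let k : ℝ × ℝ → ℂ := fun z => ε z * ex z
  let k' : ℝ × ℝ → ℂ := fun z => ε' z * ex z + ε z * (ex z * (-I * K' z))
  have cR : ∀ {f : ℝ × ℝ → ℝ}, ContinuousOn f (Icc a b ×ˢ Icc c d) →
      ContinuousOn (fun z => (f z : ℂ)) (Icc a b ×ˢ Icc c d) := fun hf =>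
    continuous_ofReal.comp_continuousOn hf
  have hk : ContinuousOn k (Icc a b ×ˢ Icc c d) := (cR hε).mul hex
  have hk' : ContinuousOn k' (Icc a b ×ˢ Icc c d) :=
    ((cR hε').mul hex).add ((cR hε).mul (hex.mul (continuousOn_const.mul (cR hK'))))
  have dkt : ∀ s ∈ Icc a b, ∀ t ∈ Ioo c d, HasDerivAt (fun t => k (s, t)) (k' (s, t)) t :=
    fun s hs t ht => ((dεt s hs t ht).ofReal_comp).mul (dext s hs t ht)
  let q : ℝ → ℂ := fun t => ∫ s in a..s₂, k (s, t)
  let q' : ℝ → ℂ := fun t => ∫ s in a..s₂, k' (s, t)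
  have hq : ∀ t ∈ Ioo c d, HasDerivAt q (q' t) t := fun t ht =>
    hasDerivAt_integral_fst hk hk' dkt ha hs₂m ht
  have hqc : ContinuousOn q' (Icc c d) :=
    (hk'.integral_fst hab.le hcd.le ha).slice_right hs₂m
  have hq0 : ∀ t ∈ Icc c d, q t ≠ 0 := by
    intro t ht h0
    have hkt : IntervalIntegrable (fun s => k (s, t)) volume a s₂ := by
      refine ((hk.slice_left ht).mono ?_).intervalIntegrable
      exact uIcc_subset_Icc ha hs₂m
    have hre : 0 < ∫ s in a..s₂, (k (s, t)).re := by
      refine intervalIntegral.intervalIntegral_pos_of_pos_on ?_ (fun s hs => ?_) has₂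
      · exact (continuous_re.comp_continuousOn (((hk.slice_left ht).mono
          (uIcc_subset_Icc ha hs₂m)))).intervalIntegrable
      · have hs' : s ∈ Icc a b := ⟨hs.1.le, hs.2.le.trans hs₂m.2⟩
        have e1 : (k (s, t)).re = ε (s, t) * Real.cos (K (s, t)) := by
          simp only [k, ex]
          rw [re_ofReal_mul, exp_re]
          simp
        rw [e1]
        refine mul_pos (hε0 _ ⟨hs', ht⟩) (Real.cos_pos_of_mem_Ioo ?_)
        have h1 := abs_le.1 (hKle s ⟨hs.1.le, hs.2.le⟩ t ht)
        have := Real.pi_gt_three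
        exact ⟨by linarith [h1.1], by linarith [h1.2]⟩
    have : (q t).re = ∫ s in a..s₂, (k (s, t)).re :=
      (reCLM.intervalIntegral_comp_comm hkt).symm
    rw [h0, zero_re] at this
    linarith
  -- Integrating the equation for `φ` in `s`, `n (a, t)` comes out of the integral; dividing by `q`
  -- expresses it through functions that are `C¹` in `t`.
  have hint : ∀ t ∈ Icc c d, φ (s₂, t) - φ (a, t) = -I * n (a, t) * q t := by
    intro t ht
    have h1 := intervalIntegral.integral_eq_sub_of_hasDerivAt (a := a) (b := s₂)
      (f := fun s => φ (s, t)) (f' := fun s => -I * n (a, t) * k (s, t)) (fun s hs => by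
        have hs' := uIcc_subset_Icc ha hs₂m hs
        refine (dφs s hs' t ht).congr_deriv ?_
        rw [hsol s hs' t ht]
        simp only [k]
        ring) (by
        refine ContinuousOn.intervalIntegrable ?_
        exact continuousOn_const.mul ((hk.slice_left ht).mono (uIcc_subset_Icc ha hs₂m)))
    rw [intervalIntegral.integral_const_mul] at h1
    exact h1.symm
  have hn0 : ∀ t ∈ Icc c d, n (a, t) = I * (φ (s₂, t) - φ (a, t)) / q t := fun t ht => by
    rw [hint t ht, eq_div_iff (hq0 t ht)]
    linear_combination (n (a, t) * q t) * I_mul_I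
  let m : ℝ → ℂ := fun t => ((I * (φ' (s₂, t) - φ' (a, t))) * q t
    - I * (φ (s₂, t) - φ (a, t)) * q' t) / q t ^ 2
  have hm : ∀ t ∈ Ioo c d, HasDerivAt (fun t => n (a, t)) (m t) t := by
    intro t ht
    have h1 := (((dφt s₂ hs₂m t ht).sub (dφt a ha t ht)).const_mul I).div (hq t ht)
      (hq0 t (Ioo_subset_Icc_self ht))
    refine h1.congr_of_eventuallyEq ?_
    filter_upwards [Icc_mem_nhds ht.1 ht.2] with x hx using hn0 x hx
  have hqcont : ContinuousOn q (Ioo c d) := fun t ht => (hq t ht).continuousAt.continuousWithinAt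
  have hmc : ContinuousOn m (Ioo c d) := by
    have h1 : ∀ s ∈ Icc a b, ContinuousOn (fun t => φ' (s, t)) (Ioo c d) := fun s hs =>
      (hφ'.slice_right hs).mono Ioo_subset_Icc_self
    have h2 : ∀ s ∈ Icc a b, ContinuousOn (fun t => φ (s, t)) (Ioo c d) := fun s hs t ht =>
      (dφt s hs t ht).continuousAt.continuousWithinAt
    refine ContinuousOn.div ?_ (hqcont.pow 2)
      fun t ht => pow_ne_zero 2 (hq0 t (Ioo_subset_Icc_self ht))
    exact ((continuousOn_const.mul ((h1 _ hs₂m).sub (h1 _ ha))).mul hqcont).sub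
      ((continuousOn_const.mul ((h2 _ hs₂m).sub (h2 _ ha))).mul (hqc.mono Ioo_subset_Icc_self))
  have hsubR : Ioo a b ×ˢ Ioo c d ⊆ Icc a b ×ˢ Icc c d :=
    prod_mono Ioo_subset_Icc_self Ioo_subset_Icc_self
  refine ⟨fun z => m z.2 * ex z + n (a, z.2) * (ex z * (-I * K' z)), ?_, fun s hs t ht => ?_⟩
  · have hna : ContinuousOn (fun z : ℝ × ℝ => n (a, z.2)) (Ioo a b ×ˢ Ioo c d) :=
      ((hn.slice_right ha).mono Ioo_subset_Icc_self).comp continuousOn_snd fun z hz => hz.2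
    exact ((hmc.comp continuousOn_snd fun z hz => hz.2).mul (hex.mono hsubR)).add
      (hna.mul ((hex.mul (continuousOn_const.mul (cR hK'))).mono hsubR))
  · have hs' := Ioo_subset_Icc_self hs
    refine ((hm t ht).mul (dext s hs' t ht)).congr_of_eventuallyEq ?_
    filter_upwards [Icc_mem_nhds ht.1 ht.2] with x hx using hsol s hs' x hx

/-! ### Characteristic coordinates adapted to `N` and `D`. -/

open Topology in
/-- Characteristic coordinates adapted to a unit field `N` and a positive weight `D`. -/
structure IsAdaptedChart (Ω : Set Plane) (N : Plane → Plane) (D H : Plane → ℝ)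
    (e : OpenPartialHomeomorph Plane Plane) (f g : Plane → ℝ) : Prop where
  source_subset : e.source ⊆ Ω
  contDiffOn : ContDiffOn ℝ 1 e e.source
  contDiffOn_symm : ContDiffOn ℝ 1 e.symm e.target
  f_cont : ContinuousOn f e.source
  g_cont : ContinuousOn g e.source
  f_pos : ∀ p ∈ e.source, 0 < f p
  g_pos : ∀ p ∈ e.source, 0 < g p
  hasFDerivAt : ∀ p ∈ e.source, HasFDerivAt e (columnsP
    (f p * (N p).2, g p * D p * (N p).1) (-(f p * (N p).1), g p * D p * (N p).2)) p
  hasFDerivAt_symm : ∀ z ∈ e.target, HasFDerivAt e.symm (columnsP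
    ((f (e.symm z))⁻¹ • perpP (N (e.symm z)))
    ((g (e.symm z) * D (e.symm z))⁻¹ • N (e.symm z))) z
  transport : ∀ (c : ℝ → Plane) (β : ℝ → ℝ) (τ₀ : ℝ),
    (∀ᶠ τ in 𝓝 τ₀, c τ ∈ e.source ∧ HasDerivAt c (β τ • N (c τ)) τ) →
    HasDerivAt (fun τ => f (c τ)) (-(β τ₀ * H (c τ₀) * f (c τ₀))) τ₀

/-- The coordinates are first integrals of `N` and of `D N^⊥`. The one for `N` has gradient `f (-N₂,
N₁) = -f N^⊥`, so its sign is reversed. The Jacobian of the pair is `f g D > 0`. -/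
lemma exists_adaptedChart {Ω : Set Plane} (hΩ : IsOpen Ω) {N : Plane → Plane} {D H k : Plane → ℝ}
    (hN : ContinuousOn N Ω) (hunit : ∀ p ∈ Ω, (N p).1 ^ 2 + (N p).2 ^ 2 = 1)
    (hD : ContinuousOn D Ω) (hD0 : ∀ p ∈ Ω, 0 < D p)
    (hH : ContinuousOn H Ω) (hk : ContinuousOn k Ω) (hdiv : HasUniformDiv Ω N H)
    (hcurl : HasUniformDiv Ω (fun p => D p • perpP (N p)) k) {p : Plane} (hp : p ∈ Ω) :
    ∃ (e : OpenPartialHomeomorph Plane Plane) (f g : Plane → ℝ), p ∈ e.source ∧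
      IsAdaptedChart Ω N D H e f g := by
  have hN0 : ∀ p ∈ Ω, N p ≠ 0 := fun p hp h0 => by
    have := hunit p hp
    rw [h0] at this
    simp at this
  have hT : ContinuousOn (fun p => perpP (N p)) Ω := by
    unfold perpP; exact hN.snd.prodMk hN.fst.neg
  obtain ⟨U, s, f, hpU, hUΩ, hs⟩ := hdiv.exists_firstIntegral hΩ hN hH hp (hN0 p hp)
  obtain ⟨U', t, g, hpU', hUΩ', ht⟩ := hcurl.exists_firstIntegral hΩ (hD.smul hT) hk hp (by
    refine smul_ne_zero (hD0 p hp).ne' fun h0 => hN0 p hp ?_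
    simp only [perpP, Prod.mk_eq_zero, neg_eq_zero] at h0
    exact Prod.ext h0.2 h0.1)
  set S := U ∩ U' with hS
  have hSo : IsOpen S := hs.isOpen.inter ht.isOpen
  have hSΩ : S ⊆ Ω := inter_subset_left.trans hUΩ
  have hf : ContinuousOn f S := hs.continuousOn.mono inter_subset_left
  have hg : ContinuousOn g S := ht.continuousOn.mono inter_subset_right
  have hNS := hN.mono hSΩ
  have hDS := hD.mono hSΩ
  have hder : ∀ q ∈ S, HasFDerivAt (fun q => ((-s q, t q) : Plane)) (columnsP
      (f q * (N q).2, g q * D q * (N q).1) (-(f q * (N q).1), g q * D q * (N q).2)) q := by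
    intro q hq
    refine ((hs.hasFDerivAt q hq.1).neg.prodMk (ht.hasFDerivAt q hq.2)).congr_fderiv ?_
    ext <;> simp [columnsP_apply, perpP] <;> ring
  have hw : ∀ q ∈ S, wedgeP ((f q * (N q).2, g q * D q * (N q).1) : Plane)
      (-(f q * (N q).1), g q * D q * (N q).2) = f q * (g q * D q) := fun q hq => by
    have := hunit q (hSΩ hq)
    simp only [wedgeP]
    linear_combination (f q * g q * D q) * this
  have hpos : ∀ q ∈ S, f q ≠ 0 ∧ g q ≠ 0 ∧ D q ≠ 0 := fun q hq =>
    ⟨(hs.pos q hq.1).ne', (ht.pos q hq.2).ne', (hD0 q (hSΩ hq)).ne'⟩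
  obtain ⟨e, hpe, heS, heq, he1, he2, he3⟩ := exists_openPartialHomeomorph_of_columns hSo hder
    ((hf.mul hNS.snd).prodMk ((hg.mul hDS).mul hNS.fst))
    ((hf.mul hNS.fst).neg.prodMk ((hg.mul hDS).mul hNS.snd)) (fun q hq => by
      rw [hw q hq]
      obtain ⟨h1, h2, h3⟩ := hpos q hq
      positivity) ⟨hpU, hpU'⟩
  refine ⟨e, f, g, hpe, ⟨heS.trans hSΩ, he1, he2, hf.mono heS, hg.mono heS,
    fun q hq => hs.pos q (heS hq).1, fun q hq => ht.pos q (heS hq).2, fun q hq => ?_, fun z hz => ?_,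
    fun c β τ₀ hc => hs.transport c β τ₀ (hc.mono fun τ hτ => ⟨(heS hτ.1).1, hτ.2⟩)⟩⟩
  · have : (e : Plane → Plane) = fun q => (-s q, t q) := funext heq
    rw [this]
    exact hder q (heS hq)
  · have hzS := heS (e.map_target hz)
    obtain ⟨h1, h2, h3⟩ := hpos _ hzS
    refine (he3 z hz).congr_fderiv ?_
    rw [hw _ hzS]
    congr 1
    · ext
      · simp only [perpP, Prod.smul_mk, smul_eq_mul]
        field_simp
      · simp only [perpP, Prod.smul_mk, smul_eq_mul]
        field_simp
    · ext
      · simp only [Prod.smul_fst, smul_eq_mul]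
        field_simp
      · simp only [Prod.smul_snd, smul_eq_mul]
        field_simp

/-! ### Continuous differentiability of `N`. -/

lemma HasFDerivAt.hasDerivAt_fst {E : Type*} [NormedAddCommGroup E] [NormedSpace ℝ E]
    {f : Plane → E} {a b : E} {z : Plane} (h : HasFDerivAt f (columnsP a b) z) :
    HasDerivAt (fun x => f (x, z.2)) a z.1 := by
  have h1 : HasDerivAt (fun x : ℝ => ((x, z.2) : Plane)) (1, 0) z.1 :=
    (hasDerivAt_id z.1).prodMk (hasDerivAt_const z.1 z.2)
  have h2 : HasFDerivAt f (columnsP a b) ((fun x : ℝ => ((x, z.2) : Plane)) z.1) := h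
  refine (h2.comp_hasDerivAt z.1 h1).congr_deriv ?_
  simp [columnsP_apply]

lemma HasFDerivAt.hasDerivAt_snd {E : Type*} [NormedAddCommGroup E] [NormedSpace ℝ E]
    {f : Plane → E} {a b : E} {z : Plane} (h : HasFDerivAt f (columnsP a b) z) :
    HasDerivAt (fun y => f (z.1, y)) b z.2 := by
  have h1 : HasDerivAt (fun y : ℝ => ((z.1, y) : Plane)) (0, 1) z.2 :=
    (hasDerivAt_const z.2 z.1).prodMk (hasDerivAt_id z.2)
  have h2 : HasFDerivAt f (columnsP a b) ((fun y : ℝ => ((z.1, y) : Plane)) z.2) := h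
  refine (h2.comp_hasDerivAt z.2 h1).congr_deriv ?_
  simp [columnsP_apply]

open Topology in
/-- Every point of an open subset of the plane is interior to a closed rectangle inside it. -/
lemma exists_rect_subset {S : Set Plane} (hS : IsOpen S) {z : Plane} (hz : z ∈ S) :
    ∃ δ > 0, Icc (z.1 - δ) (z.1 + δ) ×ˢ Icc (z.2 - δ) (z.2 + δ) ⊆ S := by
  obtain ⟨δ, hδ, h⟩ := Metric.nhds_basis_closedBall.mem_iff.1 (hS.mem_nhds hz)
  refine ⟨δ, hδ, ?_⟩
  rw [← Real.closedBall_eq_Icc, ← Real.closedBall_eq_Icc, closedBall_prod_same]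
  exact h

/-- The complex number with the given real and imaginary parts. -/
noncomputable def toComplexP : Plane ≃L[ℝ] ℂ := Complex.equivRealProdCLM.symm

lemma toComplexP_apply (v : Plane) : toComplexP v = v.1 + v.2 * Complex.I := by
  rw [toComplexP, Complex.equivRealProdCLM_symm_apply]

lemma toComplexP_perpP (v : Plane) : toComplexP (perpP v) = -Complex.I * toComplexP v := by
  simp only [toComplexP_apply, perpP]
  push_cast
  linear_combination (v.2 : ℂ) * Complex.I_mul_I

open Topology in
/-- The unit field is `C¹` on the domain of an adapted chart. -/
lemma IsAdaptedChart.contDiffOn_normal {Ω : Set Plane} (hΩ : IsOpen Ω) {N : Plane → Plane}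
    {D H NH : Plane → ℝ} (hN : ContinuousOn N Ω)
    (hunit : ∀ p ∈ Ω, (N p).1 ^ 2 + (N p).2 ^ 2 = 1)
    (hD : ContinuousOn D Ω) (hD0 : ∀ p ∈ Ω, 0 < D p) (hH : ContinuousOn H Ω)
    (hdiv : HasUniformDiv Ω N H) (hNH : HasContDerivAlong N Ω H NH)
    {e : OpenPartialHomeomorph Plane Plane} {f g : Plane → ℝ}
    (he : IsAdaptedChart Ω N D H e f g) : ContDiffOn ℝ 1 N e.source := by
  have hcs : ContinuousOn e.symm e.target := e.continuousOn_symm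
  have hms : MapsTo e.symm e.target e.source := fun z hz => e.map_target hz
  have hmΩ : MapsTo e.symm e.target Ω := fun z hz => he.source_subset (e.map_target hz)
  let ε : Plane → ℝ := fun z => (f (e.symm z))⁻¹
  -- The speed of the `t`-lines. It is merely continuous, and is never differentiated in what
  -- follows.
  let b : Plane → ℝ := fun z => (g (e.symm z) * D (e.symm z))⁻¹
  have hε0 : ∀ z ∈ e.target, 0 < ε z := fun z hz => inv_pos.2 (he.f_pos _ (hms hz))
  have hb0 : ∀ z ∈ e.target, 0 < b z := fun z hz =>
    inv_pos.2 (mul_pos (he.g_pos _ (hms hz)) (hD0 _ (hmΩ hz)))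
  have hε : ContinuousOn ε e.target := (he.f_cont.comp hcs hms).inv₀
    fun z hz => (he.f_pos _ (hms hz)).ne'
  have hb : ContinuousOn b e.target := ((he.g_cont.comp hcs hms).mul (hD.comp hcs hmΩ)).inv₀
    fun z hz => (mul_pos (he.g_pos _ (hms hz)) (hD0 _ (hmΩ hz))).ne'
  have hNc : ContinuousOn (fun z => N (e.symm z)) e.target := hN.comp hcs hmΩ
  have hHc : ContinuousOn (fun z => H (e.symm z)) e.target := hH.comp hcs hmΩ
  have hNHc : ContinuousOn (fun z => NH (e.symm z)) e.target := hNH.1.comp hcs hmΩ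
  have dΦs : ∀ z ∈ e.target, HasDerivAt (fun s => e.symm (s, z.2))
      (ε z • perpP (N (e.symm z))) z.1 := fun z hz => (he.hasFDerivAt_symm z hz).hasDerivAt_fst
  have dΦt : ∀ z ∈ e.target, HasDerivAt (fun t => e.symm (z.1, t))
      (b z • N (e.symm z)) z.2 := fun z hz => (he.hasFDerivAt_symm z hz).hasDerivAt_snd
  have near_s : ∀ z ∈ e.target, ∃ δ > 0, ∀ s ∈ Ioo (z.1 - δ) (z.1 + δ), (s, z.2) ∈ e.target := by
    intro z hz
    obtain ⟨δ, hδ, h⟩ := exists_rect_subset e.open_target hz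
    exact ⟨δ, hδ, fun s hs => h ⟨Ioo_subset_Icc_self hs, by simp [hδ.le]⟩⟩
  have near_t : ∀ z ∈ e.target, ∃ δ > 0, ∀ t ∈ Ioo (z.2 - δ) (z.2 + δ), (z.1, t) ∈ e.target := by
    intro z hz
    obtain ⟨δ, hδ, h⟩ := exists_rect_subset e.open_target hz
    exact ⟨δ, hδ, fun t ht => h ⟨by simp [hδ.le], Ioo_subset_Icc_self ht⟩⟩
  have slice_s : ∀ {k : Plane → ℝ}, ContinuousOn k e.target → ∀ {J : Set ℝ} {t : ℝ},
      (∀ s ∈ J, (s, t) ∈ e.target) → ContinuousOn (fun s => k (s, t)) J :=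
    fun hk J t h => hk.comp (by fun_prop) h
  have slice_t : ∀ {k : Plane → ℝ}, ContinuousOn k e.target → ∀ {J : Set ℝ} {s : ℝ},
      (∀ t ∈ J, (s, t) ∈ e.target) → ContinuousOn (fun t => k (s, t)) J :=
    fun hk J s h => hk.comp (by fun_prop) h
  have dNs : ∀ z ∈ e.target, HasDerivAt (fun s => N (e.symm (s, z.2)))
      ((ε z * H (e.symm z)) • perpP (N (e.symm z))) z.1 := by
    intro z hz
    obtain ⟨δ, hδ, h⟩ := near_s z hz
    exact hdiv.hasDerivAt_unit_field hΩ hN hH hunit (c := fun s => e.symm (s, z.2))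
      (e := fun s => ε (s, z.2)) (a := z.1 - δ) (b := z.1 + δ) (fun s hs => hmΩ (h s hs))
      (fun s hs => dΦs _ (h s hs)) (slice_s hε h) (fun s hs => (hε0 _ (h s hs)).le)
      ⟨by linarith, by linarith⟩
  have dHt : ∀ z ∈ e.target, HasDerivAt (fun t => H (e.symm (z.1, t)))
      (b z * NH (e.symm z)) z.2 := by
    intro z hz
    obtain ⟨δ, hδ, h⟩ := near_t z hz
    exact (hNH.2 _ (hmΩ hz)).hasDerivAt_comp (c := fun t => e.symm (z.1, t))
      (b := fun t => b (z.1, t)) (x₁ := z.2 - δ) (x₂ := z.2 + δ) ⟨by linarith, by linarith⟩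
      (fun t ht => dΦt _ (h t ht)) (fun t ht => hmΩ (h t ht)) (slice_t hb h)
      (fun t ht => hb0 _ (h t ht))
  -- As `ε = 1 / f`, the law `N f = -H f` makes `ε` differentiable in `t`, with logarithmic
  -- derivative `b H`.
  have dεt : ∀ z ∈ e.target, HasDerivAt (fun t => ε (z.1, t))
      (b z * H (e.symm z) * ε z) z.2 := by
    intro z hz
    obtain ⟨δ, hδ, h⟩ := near_t z hz
    have h1 := he.transport (fun t => e.symm (z.1, t)) (fun t => b (z.1, t)) z.2 (by
      filter_upwards [Ioo_mem_nhds (show z.2 - δ < z.2 by linarith)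
        (show z.2 < z.2 + δ by linarith)] with t ht
      exact ⟨hms (h t ht), dΦt _ (h t ht)⟩)
    have hf0 : f (e.symm z) ≠ 0 := (he.f_pos _ (hms hz)).ne'
    refine (h1.inv hf0).congr_deriv ?_
    simp only [ε]
    field_simp
  let Nc : Plane → Plane := fun z => N (e.symm z)
  have hNcC : ContDiffOn ℝ 1 Nc e.target := by
    intro z₀ hz₀
    obtain ⟨δ, hδ, hR⟩ := exists_rect_subset e.open_target hz₀
    set R := Icc (z₀.1 - δ) (z₀.1 + δ) ×ˢ Icc (z₀.2 - δ) (z₀.2 + δ) with hRdef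
    set R' := Ioo (z₀.1 - δ) (z₀.1 + δ) ×ˢ Ioo (z₀.2 - δ) (z₀.2 + δ) with hR'def
    have hR'R : R' ⊆ R := prod_mono Ioo_subset_Icc_self Ioo_subset_Icc_self
    have hR'o : IsOpen R' := isOpen_Ioo.prod isOpen_Ioo
    have hC : Continuous toComplexP := toComplexP.continuous
    have dC : ∀ {c : ℝ → Plane} {c' : Plane} {x : ℝ}, HasDerivAt c c' x →
        HasDerivAt (fun x => toComplexP (c x)) (toComplexP c') x := fun hc =>
      (toComplexP.hasFDerivAt).comp_hasDerivAt _ hc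
    -- In complex notation `N^⊥ = -i N`. Here `η = ε H` is differentiable in `t` because both `N f`
    -- and `N H` exist; `NH` enters only through `η'`.
    obtain ⟨n', hn'c, hn'⟩ := exists_transverse_deriv (a := z₀.1 - δ) (b := z₀.1 + δ)
      (c := z₀.2 - δ) (d := z₀.2 + δ) (by linarith) (by linarith)
      (φ := fun z => toComplexP (e.symm z)) (n := fun z => toComplexP (N (e.symm z)))
      (φ' := fun z => toComplexP (b z • N (e.symm z))) (ε := ε)
      (η := fun z => ε z * H (e.symm z)) (ε' := fun z => b z * H (e.symm z) * ε z)
      (η' := fun z => b z * H (e.symm z) * ε z * H (e.symm z) + ε z * (b z * NH (e.symm z)))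
      (hC.comp_continuousOn (hNc.mono hR)) (hC.comp_continuousOn ((hb.smul hNc).mono hR))
      (hε.mono hR) ((hε.mul hHc).mono hR) (((hb.mul hHc).mul hε).mono hR)
      (((((hb.mul hHc).mul hε).mul hHc).add (hε.mul (hb.mul hNHc))).mono hR)
      (fun z hz => hε0 z (hR hz))
      (fun s hs t ht => (dC (dΦs (s, t) (hR ⟨hs, ht⟩))).congr_deriv (by
        rw [map_smul, toComplexP_perpP, Complex.real_smul]))
      (fun s hs t ht => (dC (dNs (s, t) (hR ⟨hs, ht⟩))).congr_deriv (by
        rw [map_smul, toComplexP_perpP, Complex.real_smul]; push_cast; ring))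
      (fun s hs t ht => dC (dΦt (s, t) (hR ⟨hs, Ioo_subset_Icc_self ht⟩)))
      (fun s hs t ht => dεt (s, t) (hR ⟨hs, Ioo_subset_Icc_self ht⟩))
      (fun s hs t ht => (dεt (s, t) (hR ⟨hs, Ioo_subset_Icc_self ht⟩)).mul
        (dHt (s, t) (hR ⟨hs, Ioo_subset_Icc_self ht⟩)))
    have hcd : ContDiffOn ℝ 1 Nc R' := by
      have hTc : ContinuousOn (fun z => perpP (N (e.symm z))) e.target := by
        unfold perpP; exact hNc.snd.prodMk hNc.fst.neg
      refine contDiffOn_one_of_partials hR'o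
        (a := fun z => (ε z * H (e.symm z)) • perpP (N (e.symm z)))
        (b := fun z => toComplexP.symm (n' z)) (fun z hz => dNs z (hR (hR'R hz))) (fun z hz => ?_)
        (((hε.mul hHc).smul hTc).mono (hR'R.trans hR))
        (toComplexP.symm.continuous.comp_continuousOn hn'c)
      have h1 := (toComplexP.symm.hasFDerivAt).comp_hasDerivAt _ (hn' z.1 hz.1 z.2 hz.2)
      simpa [Function.comp_def] using! h1
    exact (hcd.contDiffAt (hR'o.mem_nhds ⟨⟨by linarith, by linarith⟩, ⟨by linarith, by linarith⟩⟩)).contDiffWithinAt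
  refine (hNcC.comp he.contDiffOn fun q hq => e.map_source hq).congr fun q hq => ?_
  simp only [Nc, Function.comp, e.left_inv hq]

/-! ### Differentiability of `D` along the characteristics. -/

open Filter Topology in
/-- The derivative of `∫ m k` at a parameter where `k` vanishes; `m` need only be continuous. -/
lemma hasDerivAt_integral_mul_of_eq_zero {a b δ : ℝ} (hab : a ≤ b) (hδ : 0 < δ)
    {m k k' : ℝ × ℝ → ℝ} (hm : ContinuousOn m (Icc (-δ) δ ×ˢ Icc a b))
    (hk' : ContinuousOn k' (Icc (-δ) δ ×ˢ Icc a b)) (hk0 : ∀ s ∈ Icc a b, k (0, s) = 0)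
    (hd : ∀ ρ ∈ Icc (-δ) δ, ∀ s ∈ Icc a b, HasDerivAt (fun ρ => k (ρ, s)) (k' (ρ, s)) ρ) :
    HasDerivAt (fun ρ => ∫ s in a..b, m (ρ, s) * k (ρ, s)) (∫ s in a..b, m (0, s) * k' (0, s))
      0 := by
  have hδ' : -δ ≤ δ := by linarith
  have h0 : (0 : ℝ) ∈ Icc (-δ) δ := ⟨by linarith, hδ.le⟩
  obtain ⟨m₁, hm₁, hmm, -⟩ := hm.exists_extend_rect hδ' hab
  obtain ⟨k₁, hk₁, hkk, -⟩ := hk'.exists_extend_rect hδ' hab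
  have h1 : Continuous fun z : ℝ × ℝ => ∫ r in (0 : ℝ)..1, k₁ (r * z.1, z.2) :=
    intervalIntegral.continuous_parametric_intervalIntegral_of_continuous'
      (f := fun (z : ℝ × ℝ) r => k₁ (r * z.1, z.2)) (hk₁.comp (by fun_prop)) _ _
  have h2 : Continuous fun ρ : ℝ => ∫ s in a..b, m₁ (ρ, s) * ∫ r in (0 : ℝ)..1, k₁ (r * ρ, s) :=
    intervalIntegral.continuous_parametric_intervalIntegral_of_continuous'
      (f := fun ρ s => m₁ (ρ, s) * ∫ r in (0 : ℝ)..1, k₁ (r * ρ, s)) (hm₁.mul h1) _ _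
  have h3 := h2.tendsto 0
  have e0 : ∫ s in a..b, m₁ (0, s) * ∫ r in (0 : ℝ)..1, k₁ (r * 0, s)
      = ∫ s in a..b, m (0, s) * k' (0, s) := by
    refine intervalIntegral.integral_congr fun s hs => ?_
    rw [uIcc_of_le hab] at hs
    simp only [mul_zero, intervalIntegral.integral_const, sub_zero, one_smul]
    rw [← hmm (show ((0 : ℝ), s) ∈ _ from ⟨h0, hs⟩), ← hkk (show ((0 : ℝ), s) ∈ _ from ⟨h0, hs⟩)]
  rw [e0] at h3
  rw [hasDerivAt_iff_tendsto_slope]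
  refine (h3.mono_left nhdsWithin_le_nhds).congr' ?_
  filter_upwards [self_mem_nhdsWithin, mem_nhdsWithin_of_mem_nhds
    (Icc_mem_nhds (neg_lt_zero.2 hδ) hδ)] with ρ hρ0 hρ
  have hz : ∫ s in a..b, m (0, s) * k (0, s) = 0 := by
    rw [intervalIntegral.integral_congr (g := fun _ => (0 : ℝ)) fun s hs => by
      rw [uIcc_of_le hab] at hs
      simp only [hk0 s hs, mul_zero]]
    simp
  rw [slope_def_field, sub_zero, hz, sub_zero, eq_div_iff hρ0, mul_comm,
    ← intervalIntegral.integral_const_mul]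
  refine intervalIntegral.integral_congr fun s hs => ?_
  rw [uIcc_of_le hab] at hs
  have hr : ∀ r ∈ uIcc (0 : ℝ) 1, r * ρ ∈ Icc (-δ) δ := fun r hr => by
    rw [uIcc_of_le zero_le_one] at hr
    constructor <;> nlinarith [hr.1, hr.2, hρ.1, hρ.2]
  -- As `k` vanishes at `ρ = 0`, it equals `ρ` times an average of `k'`; dividing by `ρ` leaves a
  -- continuous function, so `m` need not be differentiated.
  have ftc : ∫ r in (0 : ℝ)..1, ρ * k₁ (r * ρ, s) = k (1 * ρ, s) - k (0 * ρ, s) := by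
    refine intervalIntegral.integral_eq_sub_of_hasDerivAt (f := fun r => k (r * ρ, s))
      (fun r hrm => ?_) ?_
    · rw [hkk ⟨hr r hrm, hs⟩, mul_comm]
      have h4 : HasDerivAt (fun r : ℝ => r * ρ) ρ r := by
        simpa using (hasDerivAt_id r).mul_const ρ
      exact (hd _ (hr r hrm) s hs).comp r h4
    · exact (continuous_const.mul (hk₁.comp (by fun_prop))).intervalIntegrable _ _
  rw [intervalIntegral.integral_const_mul, one_mul, zero_mul, hk0 s hs, sub_zero] at ftc
  rw [← ftc, ← hmm (show (ρ, s) ∈ _ from ⟨hρ, hs⟩)]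
  ring

open Filter Topology in
/-- If `T` is `C¹` and `D T` has divergence `k`, with `D` merely continuous, then `D` is
differentiable along the integral curves of `T`, with derivative `k - D div T`. -/
lemma HasUniformDiv.hasDerivAt_factor {Ω : Set Plane} (hΩ : IsOpen Ω) {T : Plane → Plane}
    {D k : Plane → ℝ} (hT : ContDiffOn ℝ 1 T Ω) (hT0 : ∀ p ∈ Ω, T p ≠ 0)
    (hD : ContinuousOn D Ω) (hk : ContinuousOn k Ω)
    (hdiv : HasUniformDiv Ω (fun p => D p • T p) k) {c : ℝ → Plane} {a b : ℝ}
    (hc : ∀ s ∈ Ioo a b, HasDerivAt c (T (c s)) s) (hcΩ : MapsTo c (Ioo a b) Ω) {s : ℝ}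
    (hs : s ∈ Ioo a b) :
    HasDerivAt (fun s => D (c s)) (k (c s) - D (c s) * divP T (c s)) s := by
  have hcc : ContinuousOn c (Ioo a b) := fun s hs => (hc s hs).continuousAt.continuousWithinAt
  have hTc : ContinuousOn (fun s => T (c s)) (Ioo a b) := hT.continuousOn.comp hcc hcΩ
  have hDc : ContinuousOn (fun s => D (c s)) (Ioo a b) := hD.comp hcc hcΩ
  have hkc : ContinuousOn (fun s => k (c s)) (Ioo a b) := hk.comp hcc hcΩ
  have hfd : ∀ p ∈ Ω, HasFDerivAt T (fderiv ℝ T p) p := fun p hp =>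
    ((hT.differentiableOn one_ne_zero).differentiableAt (hΩ.mem_nhds hp)).hasFDerivAt
  have hfc : ContinuousOn (fderiv ℝ T) Ω := hT.continuousOn_fderiv_of_isOpen hΩ le_rfl
  -- The derivative of the flux of `D T` under translation is computed twice: by the divergence
  -- theorem, and directly, using that `wedgeP (T (c s + ρ • v)) (T (c s))` vanishes at `ρ = 0`.
  -- Equating the results gives the increments of `D wedgeP T v`.
  have key : ∀ v : Plane, ∀ x ∈ Ioo a b, ∀ y ∈ Ioo a b, x ≤ y →
      D (c y) * wedgeP (T (c y)) v - D (c x) * wedgeP (T (c x)) v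
        = ∫ z in x..y, (D (c z) * wedgeP (fderiv ℝ T (c z) v) (T (c z))
            - k (c z) * wedgeP v (T (c z))) := by
    intro v x hx y hy hxy
    have hsub : Icc x y ⊆ Ioo a b := Icc_subset_Ioo hx.1 hy.2
    have hd := hdiv.hasDerivAt_flux hΩ (hD.smul hT.continuousOn) hk hxy
      (fun s hs => hc s (hsub hs)) (hTc.mono hsub) (hcΩ.mono_left hsub) v
    obtain ⟨δ₀, hδ₀, hδΩ⟩ := (isCompact_Icc.image_of_continuousOn
      (hcc.mono hsub)).exists_cthickening_subset_open hΩ (hcΩ.mono_left hsub).image_subset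
    have hev : ∀ᶠ ρ : ℝ in 𝓝 0, ‖ρ • v‖ ≤ δ₀ := by
      have : Continuous fun ρ : ℝ => ‖ρ • v‖ := by fun_prop
      exact this.continuousAt.eventually (Iic_mem_nhds (by simpa using hδ₀))
    obtain ⟨δ, hδ, hball⟩ := Metric.nhds_basis_closedBall.eventually_iff.1 hev
    rw [Real.closedBall_eq_Icc, zero_sub, zero_add] at hball
    have hin : ∀ z ∈ Icc (-δ) δ ×ˢ Icc x y, c z.2 + z.1 • v ∈ Ω := fun z hz =>
      hδΩ (Metric.mem_cthickening_of_dist_le _ (c z.2) _ _ (mem_image_of_mem _ hz.2) (by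
        rw [dist_eq_norm, add_sub_cancel_left]
        exact hball hz.1))
    have m2 : MapsTo Prod.snd (Icc (-δ) δ ×ˢ Icc x y) (Icc x y) := fun z hz => hz.2
    have eΓ : ContinuousOn (fun z : ℝ × ℝ => c z.2 + z.1 • v) (Icc (-δ) δ ×ˢ Icc x y) :=
      ((hcc.mono hsub).comp continuousOn_snd m2).add (by fun_prop)
    have hd' := hasDerivAt_integral_mul_of_eq_zero hxy hδ
      (m := fun z => D (c z.2 + z.1 • v))
      (k := fun z => wedgeP (T (c z.2 + z.1 • v)) (T (c z.2)))
      (k' := fun z => wedgeP (fderiv ℝ T (c z.2 + z.1 • v) v) (T (c z.2)))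
      (hD.comp eΓ hin)
      (((hfc.comp eΓ hin).clm_apply continuousOn_const).wedgeP
        ((hTc.mono hsub).comp continuousOn_snd m2))
      (fun s _ => by simp only [zero_smul, add_zero, wedgeP]; ring)
      (fun ρ hρ s hs => by
        have h1 : HasDerivAt (fun ρ : ℝ => c s + ρ • v) v ρ := by
          simpa using ((hasDerivAt_id ρ).smul_const v).const_add (c s)
        have h2 := (hfd _ (hin (ρ, s) ⟨hρ, hs⟩)).comp_hasDerivAt ρ h1
        refine (h2.wedgeP (hasDerivAt_const ρ (T (c s)))).congr_deriv ?_
        simp [wedgeP])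
    have hfun : (fun ρ : ℝ => ∫ s in x..y, wedgeP (D (c s + ρ • v) • T (c s + ρ • v)) (T (c s)))
        = fun ρ => ∫ s in x..y, D (c s + ρ • v) * wedgeP (T (c s + ρ • v)) (T (c s)) := by
      funext ρ
      refine intervalIntegral.integral_congr fun s _ => ?_
      simp only [wedgeP, Prod.smul_fst, Prod.smul_snd, smul_eq_mul]
      ring
    rw [hfun] at hd
    have huniq := hd.unique hd'
    simp only [zero_smul, add_zero] at huniq
    have i1 : IntervalIntegrable (fun z => D (c z) * wedgeP (fderiv ℝ T (c z) v) (T (c z)))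
        volume x y := by
      refine ContinuousOn.intervalIntegrable ?_
      rw [uIcc_of_le hxy]
      exact (hDc.mul (((hfc.comp hcc hcΩ).clm_apply continuousOn_const).wedgeP hTc)).mono hsub
    have i2 : IntervalIntegrable (fun z => k (c z) * wedgeP v (T (c z))) volume x y := by
      refine ContinuousOn.intervalIntegrable ?_
      rw [uIcc_of_le hxy]
      exact (hkc.mul (continuousOn_const.wedgeP hTc)).mono hsub
    rw [intervalIntegral.integral_sub i1 i2, ← huniq]
    simp only [wedgeP, Prod.smul_fst, Prod.smul_snd, smul_eq_mul]
    ring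
  -- With this fixed vector `wedgeP (T (c z)) v` is minus the squared length of `T (c s)` at `z =
  -- s`, so it is nonzero nearby; it is differentiable, and dividing by it isolates `D`.
  set v := perpP (T (c s)) with hv
  have d1 := hasDerivAt_of_integral_eq (k := fun z => D (c z) * wedgeP (fderiv ℝ T (c z) v) (T (c z))
      - k (c z) * wedgeP v (T (c z))) (f := fun z => D (c z) * wedgeP (T (c z)) v)
    ((hDc.mul (((hfc.comp hcc hcΩ).clm_apply continuousOn_const).wedgeP hTc)).sub
      (hkc.mul (continuousOn_const.wedgeP hTc))) hs (key v)
  have d2 : HasDerivAt (fun z => wedgeP (T (c z)) v)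
      (wedgeP (fderiv ℝ T (c s) (T (c s))) v) s := by
    refine (((hfd _ (hcΩ hs)).comp_hasDerivAt s (hc s hs)).wedgeP
      (hasDerivAt_const s v)).congr_deriv ?_
    simp [wedgeP]
  have hw : wedgeP (T (c s)) v ≠ 0 := by
    intro h0
    simp only [hv, wedgeP, perpP] at h0
    refine hT0 _ (hcΩ hs) (Prod.ext ?_ ?_)
    · show (T (c s)).1 = 0
      nlinarith [sq_nonneg (T (c s)).1, sq_nonneg (T (c s)).2]
    · show (T (c s)).2 = 0
      nlinarith [sq_nonneg (T (c s)).1, sq_nonneg (T (c s)).2]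
  have hne : ∀ᶠ z in 𝓝 s, wedgeP (T (c z)) v ≠ 0 := d2.continuousAt.eventually_ne hw
  refine ((d1.div d2 hw).congr_of_eventuallyEq (hne.mono fun z hz => ?_)).congr_deriv ?_
  · exact (mul_div_cancel_right₀ _ hz).symm
  · have tr := wedgeP_map_add (fderiv ℝ T (c s)) (T (c s)) v
    have anti1 : wedgeP v (T (c s)) = -wedgeP (T (c s)) v := by simp only [wedgeP]; ring
    have anti2 : wedgeP (fderiv ℝ T (c s) v) (T (c s)) = -wedgeP (T (c s)) (fderiv ℝ T (c s) v) := by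
      simp only [wedgeP]; ring
    rw [anti1, anti2, div_eq_iff (pow_ne_zero 2 hw)]
    simp only [divP]
    linear_combination (-(D (c s)) * wedgeP (T (c s)) v) * tr

/-! ### Regularity of integral curves and of angle functions. -/

lemma contDiffOn_two_of_isCurveIn {X : Plane → Plane} {Ω : Set Plane} {γ : ℝ → Plane} {a b : ℝ}
    (hX : ContDiffOn ℝ 1 X Ω) (hγ : IsCurveIn X Ω γ a b) : ContDiffOn ℝ 2 γ (Ioo a b) := by
  have hd : ∀ s ∈ Ioo a b, HasDerivAt γ (X (γ s)) s := fun s hs =>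
    (hγ.1 s hs).hasDerivAt (isOpen_Ioo.mem_nhds hs)
  have hdiff : DifferentiableOn ℝ γ (Ioo a b) := fun s hs =>
    (hd s hs).differentiableAt.differentiableWithinAt
  have hderiv : ∀ s ∈ Ioo a b, deriv γ s = X (γ s) := fun s hs => (hd s hs).deriv
  have h1 : ContDiffOn ℝ 1 γ (Ioo a b) := by
    rw [show (1 : WithTop ℕ∞) = 0 + 1 from (zero_add 1).symm,
      contDiffOn_succ_iff_deriv_of_isOpen isOpen_Ioo]
    refine ⟨hdiff, by simp, ?_⟩
    rw [contDiffOn_zero]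
    exact (hX.continuousOn.comp hdiff.continuousOn hγ.2).congr hderiv
  rw [show (2 : WithTop ℕ∞) = 1 + 1 from one_add_one_eq_two.symm,
    contDiffOn_succ_iff_deriv_of_isOpen isOpen_Ioo]
  exact ⟨hdiff, by simp, (hX.comp h1 hγ.2).congr hderiv⟩

lemma exists_cos_sin_eq {x y : ℝ} (h : x ^ 2 + y ^ 2 = 1) :
    ∃ θ : ℝ, x = Real.cos θ ∧ y = Real.sin θ := by
  have hn : ‖(⟨x, y⟩ : ℂ)‖ = 1 := by
    rw [Complex.norm_def, Complex.normSq_mk, ← sq, ← sq, h, Real.sqrt_one]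
  have h0 : (⟨x, y⟩ : ℂ) ≠ 0 := fun h0 => by rw [h0] at hn; simp at hn
  exact ⟨Complex.arg ⟨x, y⟩, by rw [Complex.cos_arg h0, hn, div_one],
    by rw [Complex.sin_arg, hn, div_one]⟩

/-- Local existence of continuous angle functions for a continuous unit field. -/
lemma exists_continuousOn_angle {Ω : Set Plane} (hΩ : IsOpen Ω) {N : Plane → Plane}
    (hN : ContinuousOn N Ω) (hunit : ∀ p ∈ Ω, (N p).1 ^ 2 + (N p).2 ^ 2 = 1) {p : Plane}
    (hp : p ∈ Ω) : ∃ (U : Set Plane) (θ : Plane → ℝ), IsOpen U ∧ p ∈ U ∧ U ⊆ Ω ∧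
      ContinuousOn θ U ∧ ∀ q ∈ U, N q = (Real.cos (θ q), Real.sin (θ q)) := by
  obtain ⟨α, h1, h2⟩ := exists_cos_sin_eq (hunit p hp)
  have hsq := Real.sin_sq_add_cos_sq α
  -- `C` and `S` are the cosine and sine of the angle from `N p` to `N q`; where `C` is positive,
  -- `arcsin` recovers this angle.
  let C : Plane → ℝ := fun q => (N q).1 * Real.cos α + (N q).2 * Real.sin α
  let S : Plane → ℝ := fun q => (N q).2 * Real.cos α - (N q).1 * Real.sin α
  have hC : ContinuousOn C Ω := (hN.fst.mul continuousOn_const).add (hN.snd.mul continuousOn_const)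
  have hS : ContinuousOn S Ω := (hN.snd.mul continuousOn_const).sub (hN.fst.mul continuousOn_const)
  refine ⟨Ω ∩ C ⁻¹' Ioi 0, fun q => α + Real.arcsin (S q), hC.isOpen_inter_preimage hΩ isOpen_Ioi,
    ⟨hp, ?_⟩, inter_subset_left,
    continuousOn_const.add (Real.continuous_arcsin.comp_continuousOn (hS.mono inter_subset_left)),
    fun q hq => ?_⟩
  · show 0 < (N p).1 * Real.cos α + (N p).2 * Real.sin α
    rw [h1, h2]
    nlinarith
  · have hCS : C q ^ 2 + S q ^ 2 = 1 := by
      have := hunit q hq.1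
      simp only [C, S]
      linear_combination ((N q).1 ^ 2 + (N q).2 ^ 2) * hsq + this
    have hCpos : 0 < C q := hq.2
    have hcos : Real.cos (Real.arcsin (S q)) = C q := by
      rw [Real.cos_arcsin, ← hCS, add_sub_cancel_right, Real.sqrt_sq hCpos.le]
    have hsin : Real.sin (Real.arcsin (S q)) = S q :=
      Real.sin_arcsin (by nlinarith) (by nlinarith)
    ext
    · show (N q).1 = Real.cos (α + Real.arcsin (S q))
      rw [Real.cos_add, hcos, hsin]
      simp only [C, S]
      linear_combination (-(N q).1) * hsq
    · show (N q).2 = Real.sin (α + Real.arcsin (S q))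
      rw [Real.sin_add, hcos, hsin]
      simp only [C, S]
      linear_combination (-(N q).2) * hsq

open Topology in
/-- A continuous angle function of a `C¹` field is `C¹`. -/
lemma ContDiffOn.angle {U : Set Plane} (hU : IsOpen U) {N : Plane → Plane} {θ : Plane → ℝ}
    (hN : ContDiffOn ℝ 1 N U) (hθ : ContinuousOn θ U)
    (h : ∀ q ∈ U, N q = (Real.cos (θ q), Real.sin (θ q))) : ContDiffOn ℝ 1 θ U := by
  intro p hp
  have hUp := hU.mem_nhds hp
  have hNp : ContDiffAt ℝ 1 N p := hN.contDiffAt hUp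
  have hS : ContDiffAt ℝ 1
      (fun q => (N q).2 * Real.cos (θ p) - (N q).1 * Real.sin (θ p)) p :=
    (hNp.snd.mul contDiffAt_const).sub (hNp.fst.mul contDiffAt_const)
  have h0 : (N p).2 * Real.cos (θ p) - (N p).1 * Real.sin (θ p) = 0 := by
    rw [h p hp]; ring
  have harc : ContDiffAt ℝ 1
      (fun q => θ p + Real.arcsin ((N q).2 * Real.cos (θ p) - (N q).1 * Real.sin (θ p))) p := by
    refine contDiffAt_const.add (ContDiffAt.comp (g := Real.arcsin) p ?_ hS)
    exact Real.contDiffAt_arcsin (by rw [h0]; norm_num) (by rw [h0]; norm_num)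
  refine (harc.congr_of_eventuallyEq ?_).contDiffWithinAt
  -- Continuity keeps `θ q` within `π / 2` of `θ p`, so `arcsin` inverts the sine and the given `θ`
  -- coincides with the `C¹` expression in `N`.
  have hnear : ∀ᶠ q in 𝓝 p, |θ q - θ p| < Real.pi / 2 := by
    have hc : ContinuousAt (fun q => |θ q - θ p|) p :=
      ((hθ.continuousAt hUp).sub continuousAt_const).abs
    exact hc.eventually (Iio_mem_nhds (by simp [Real.pi_pos]))
  filter_upwards [hnear, hUp] with q hq hqU
  rw [h q hqU]
  simp only
  rw [← Real.sin_sub, Real.arcsin_sin (by linarith [(abs_lt.1 hq).1]) (abs_lt.1 hq).2.le]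
  ring

/-! ### The fields `N` and `D N^⊥` of the problem. -/

lemma lenP_pos {v : Plane} (hv : v ≠ 0) : 0 < lenP v := by
  refine Real.sqrt_pos.2 (lt_of_le_of_ne (by positivity) fun h => hv ?_)
  ext
  · show v.1 = 0
    nlinarith [sq_nonneg v.1, sq_nonneg v.2]
  · show v.2 = 0
    nlinarith [sq_nonneg v.1, sq_nonneg v.2]

lemma lenP_sq (v : Plane) : lenP v ^ 2 = v.1 ^ 2 + v.2 ^ 2 := Real.sq_sqrt (by positivity)

lemma lenD_pos {Ω : Set Plane} {u : Plane → ℝ} {F : Plane → Plane} (hns : Nonsingular Ω u F)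
    {p : Plane} (hp : p ∈ Ω) : 0 < lenD u F p := lenP_pos (hns p hp)

lemma normalN_sq {Ω : Set Plane} {u : Plane → ℝ} {F : Plane → Plane} (hns : Nonsingular Ω u F)
    {p : Plane} (hp : p ∈ Ω) : (normalN u F p).1 ^ 2 + (normalN u F p).2 ^ 2 = 1 := by
  have h0 := (lenD_pos hns hp).ne'
  have h1 : lenD u F p ^ 2 = _ := lenP_sq (shiftedGrad u F p)
  simp only [normalN, Prod.smul_fst, Prod.smul_snd, smul_eq_mul]
  field_simp
  exact h1.symm

lemma lenD_smul_normalPerp {Ω : Set Plane} {u : Plane → ℝ} {F : Plane → Plane}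
    (hns : Nonsingular Ω u F) {p : Plane} (hp : p ∈ Ω) :
    lenD u F p • perpP (normalN u F p) = perpP (shiftedGrad u F p) := by
  have h0 := (lenD_pos hns hp).ne'
  simp only [normalN, perpP, Prod.smul_fst, Prod.smul_snd, smul_eq_mul, Prod.smul_mk]
  ext
  · simp only; field_simp
  · simp only; field_simp

lemma continuousOn_shiftedGrad {Ω : Set Plane} (hΩ : IsOpen Ω) {u : Plane → ℝ} {F : Plane → Plane}
    (hu : ContDiffOn ℝ 1 u Ω) (hF : ContDiffOn ℝ 1 F Ω) : ContinuousOn (shiftedGrad u F) Ω := by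
  have h := hu.continuousOn_fderiv_of_isOpen hΩ le_rfl
  exact ((h.clm_apply continuousOn_const).prodMk (h.clm_apply continuousOn_const)).add
    hF.continuousOn

lemma continuousOn_lenD {Ω : Set Plane} (hΩ : IsOpen Ω) {u : Plane → ℝ} {F : Plane → Plane}
    (hu : ContDiffOn ℝ 1 u Ω) (hF : ContDiffOn ℝ 1 F Ω) : ContinuousOn (lenD u F) Ω := by
  have h := continuousOn_shiftedGrad hΩ hu hF
  exact ((h.fst.pow 2).add (h.snd.pow 2)).sqrt

lemma continuousOn_normalN {Ω : Set Plane} (hΩ : IsOpen Ω) {u : Plane → ℝ} {F : Plane → Plane}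
    (hu : ContDiffOn ℝ 1 u Ω) (hF : ContDiffOn ℝ 1 F Ω) (hns : Nonsingular Ω u F) :
    ContinuousOn (normalN u F) Ω :=
  ((continuousOn_lenD hΩ hu hF).inv₀ fun _ hp => (lenD_pos hns hp).ne').smul
    (continuousOn_shiftedGrad hΩ hu hF)

lemma continuousOn_rotP {Ω : Set Plane} (hΩ : IsOpen Ω) {F : Plane → Plane}
    (hF : ContDiffOn ℝ 1 F Ω) : ContinuousOn (rotP F) Ω := by
  have h := hF.continuousOn_fderiv_of_isOpen hΩ le_rfl
  exact (h.clm_apply continuousOn_const).snd.sub (h.clm_apply continuousOn_const).fst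

lemma continuousOn_divP {Ω : Set Plane} (hΩ : IsOpen Ω) {X : Plane → Plane}
    (hX : ContDiffOn ℝ 1 X Ω) : ContinuousOn (divP X) Ω := by
  have h := hX.continuousOn_fderiv_of_isOpen hΩ le_rfl
  exact (h.clm_apply continuousOn_const).fst.add (h.clm_apply continuousOn_const).snd

/-- `D N^⊥` is the rotation of `∇u + F`, and the rotation of `∇u` has zero weak divergence. This
stands in for the second derivatives of `u`. -/
lemma hasUniformDiv_lenD_smul_perpP {Ω : Set Plane} (hΩ : IsOpen Ω) {u : Plane → ℝ}
    {F : Plane → Plane} (hu : ContDiffOn ℝ 1 u Ω) (hF : ContDiffOn ℝ 1 F Ω)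
    (hns : Nonsingular Ω u F) :
    HasUniformDiv Ω (fun p => lenD u F p • perpP (normalN u F p)) (rotP F) := by
  have hV := continuousOn_shiftedGrad hΩ hu hF
  have h1 : HasUniformDiv Ω (fun p => perpP (shiftedGrad u F p)) (rotP F) :=
    hasUniformDiv_of_weak hΩ (hV.snd.prodMk hV.fst.neg) (continuousOn_rotP hΩ hF)
      fun φ hφ => weak_div_perp_shiftedGrad hΩ hu hF hφ
  intro K hK hKc ε hε
  obtain ⟨Y, hY, hYK⟩ := h1 K hK hKc ε hε
  exact ⟨Y, hY, fun p hp => by simpa only [lenD_smul_normalPerp hns (hK hp)] using hYK p hp⟩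

/-! ### Curves through points and coordinate vectors in characteristic coordinates. -/

lemma IsAdaptedChart.isCharCoords {Ω : Set Plane} {u : Plane → ℝ} {F : Plane → Plane}
    {H : Plane → ℝ} {e : OpenPartialHomeomorph Plane Plane} {f g : Plane → ℝ}
    (he : IsAdaptedChart Ω (normalN u F) (lenD u F) H e f g) : IsCharCoords Ω u F e f g := by
  refine ⟨he.source_subset, he.contDiffOn, he.contDiffOn_symm, he.f_cont, he.g_cont, he.f_pos,
    he.g_pos, fun p hp => ?_, fun p hp => ?_⟩
  · rw [gradP, (he.hasFDerivAt p hp).fst.fderiv]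
    simp [columnsP_apply, normalPerp, perpP]
  · rw [gradP, (he.hasFDerivAt p hp).snd.fderiv]
    ext <;> simp [columnsP_apply]

/-- Integral curves of `N` and of `N^⊥` through the points of an adapted chart. -/
lemma IsAdaptedChart.exists_isCurveIn {Ω : Set Plane} {N : Plane → Plane} {D H : Plane → ℝ}
    (hD : ContinuousOn D Ω) (hD0 : ∀ p ∈ Ω, 0 < D p)
    {e : OpenPartialHomeomorph Plane Plane} {f g : Plane → ℝ}
    (he : IsAdaptedChart Ω N D H e f g) {p : Plane} (hp : p ∈ e.source) :
    (∃ (γ : ℝ → Plane) (a b τ : ℝ), IsCurveIn (fun q => perpP (N q)) Ω γ a b ∧ τ ∈ Ioo a b ∧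
      γ τ = p) ∧
    ∃ (γ : ℝ → Plane) (a b τ : ℝ), IsCurveIn N Ω γ a b ∧ τ ∈ Ioo a b ∧ γ τ = p := by
  obtain ⟨δ, hδ, hR⟩ := exists_rect_subset e.open_target (e.map_source hp)
  have hcs : ContinuousOn e.symm e.target := e.continuousOn_symm
  have hms : MapsTo e.symm e.target e.source := fun z hz => e.map_target hz
  have hmΩ : MapsTo e.symm e.target Ω := fun z hz => he.source_subset (e.map_target hz)
  set z := e p with hz
  have hsym : e.symm (z.1, z.2) = p := e.left_inv hp
  have line_s : ∀ s ∈ Ioo (z.1 - δ) (z.1 + δ), (s, z.2) ∈ e.target := fun s hs =>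
    hR ⟨Ioo_subset_Icc_self hs, by simp [hδ.le]⟩
  have line_t : ∀ t ∈ Ioo (z.2 - δ) (z.2 + δ), (z.1, t) ∈ e.target := fun t ht =>
    hR ⟨by simp [hδ.le], Ioo_subset_Icc_self ht⟩
  have hε : ContinuousOn (fun z => (f (e.symm z))⁻¹) e.target := (he.f_cont.comp hcs hms).inv₀
    fun z hz => (he.f_pos _ (hms hz)).ne'
  have hb : ContinuousOn (fun z => (g (e.symm z) * D (e.symm z))⁻¹) e.target :=
    ((he.g_cont.comp hcs hms).mul (hD.comp hcs hmΩ)).inv₀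
      fun z hz => (mul_pos (he.g_pos _ (hms hz)) (hD0 _ (hmΩ hz))).ne'
  constructor
  · obtain ⟨γ, a, b, σ, -, hγ, hσ, hγσ, -⟩ := exists_reparametrization
      (Y := fun q => perpP (N q)) (Ω := Ω) (c := fun s => e.symm (s, z.2))
      (b := fun s => (f (e.symm (s, z.2)))⁻¹) (x₁ := z.1 - δ) (x₂ := z.1 + δ) (τ₀ := z.1)
      ⟨by linarith, by linarith⟩
      (fun s hs => (he.hasFDerivAt_symm _ (line_s s hs)).hasDerivAt_fst)
      (fun s hs => hmΩ (line_s s hs)) (hε.comp (by fun_prop) line_s)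
      (fun s hs => inv_pos.2 (he.f_pos _ (hms (line_s s hs))))
    exact ⟨γ, a, b, σ, hγ, hσ, hγσ.trans hsym⟩
  · obtain ⟨γ, a, b, σ, -, hγ, hσ, hγσ, -⟩ := exists_reparametrization
      (Y := N) (Ω := Ω) (c := fun t => e.symm (z.1, t))
      (b := fun t => (g (e.symm (z.1, t)) * D (e.symm (z.1, t)))⁻¹) (x₁ := z.2 - δ)
      (x₂ := z.2 + δ) (τ₀ := z.2) ⟨by linarith, by linarith⟩
      (fun t ht => (he.hasFDerivAt_symm _ (line_t t ht)).hasDerivAt_snd)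
      (fun t ht => hmΩ (line_t t ht)) (hb.comp (by fun_prop) line_t)
      (fun t ht => inv_pos.2 (mul_pos (he.g_pos _ (hms (line_t t ht))) (hD0 _ (hmΩ (line_t t ht)))))
    exact ⟨γ, a, b, σ, hγ, hσ, hγσ.trans hsym⟩

open Filter Topology in
/-- In characteristic coordinates `(s, t)`, the coordinate vector of `t` is `N / (g D)`. -/
lemma IsCharCoords.hasDerivAt_symm {Ω : Set Plane} {u : Plane → ℝ} {F : Plane → Plane}
    (hns : Nonsingular Ω u F) {Ψ : OpenPartialHomeomorph Plane Plane} {f g : Plane → ℝ}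
    (hΨ : IsCharCoords Ω u F Ψ f g) {p : Plane} (hp : p ∈ Ψ.source) :
    HasDerivAt (fun t => Ψ.symm ((Ψ p).1, t)) ((g p * lenD u F p)⁻¹ • normalN u F p)
      (Ψ p).2 := by
  have hz := Ψ.map_source hp
  have hA : HasFDerivAt Ψ (fderiv ℝ Ψ p) p :=
    ((hΨ.contDiffOn.differentiableOn one_ne_zero).differentiableAt
      (Ψ.open_source.mem_nhds hp)).hasFDerivAt
  have hB : HasFDerivAt Ψ.symm (fderiv ℝ Ψ.symm (Ψ p)) (Ψ p) :=
    ((hΨ.contDiffOn_symm.differentiableOn one_ne_zero).differentiableAt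
      (Ψ.open_target.mem_nhds hz)).hasFDerivAt
  set A := fderiv ℝ Ψ p
  set B := fderiv ℝ Ψ.symm (Ψ p)
  have hAB : A.comp B = ContinuousLinearMap.id ℝ Plane := by
    have hA' : HasFDerivAt Ψ A (Ψ.symm (Ψ p)) := by rwa [Ψ.left_inv hp]
    refine (hA'.comp (Ψ p) hB).unique ((hasFDerivAt_id (Ψ p)).congr_of_eventuallyEq ?_)
    filter_upwards [Ψ.open_target.mem_nhds hz] with w hw
    exact Ψ.right_inv hw
  have hB' := hB
  rw [eq_columnsP B] at hB'
  refine hB'.hasDerivAt_snd.congr_deriv ?_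
  have hw : A (B (0, 1)) = (0, 1) := DFunLike.congr_fun hAB (0, 1)
  rw [clm_plane_apply A (B (0, 1))] at hw
  have hs := hΨ.grad_s p hp
  have ht := hΨ.grad_t p hp
  rw [gradP, hA.fst.fderiv] at hs
  rw [gradP, hA.snd.fderiv] at ht
  have hpΩ := hΨ.source_subset hp
  have hf := (hΨ.f_pos p hp).ne'
  have hg := (hΨ.g_pos p hp).ne'
  have hD := (lenD_pos hns hpΩ).ne'
  have hu := normalN_sq hns hpΩ
  set w := B (0, 1)
  have s1 := congrArg Prod.fst hs
  have s2 := congrArg Prod.snd hs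
  have t1 := congrArg Prod.fst ht
  have t2 := congrArg Prod.snd ht
  have w1 := congrArg Prod.fst hw
  have w2 := congrArg Prod.snd hw
  simp only [normalPerp, perpP, ContinuousLinearMap.comp_apply, ContinuousLinearMap.coe_fst',
    ContinuousLinearMap.coe_snd', Prod.smul_fst, Prod.smul_snd, smul_eq_mul, Prod.fst_add,
    Prod.snd_add] at s1 s2 t1 t2 w1 w2
  rw [s1, s2] at w1
  rw [t1, t2] at w2
  -- The coordinate vector `w` is dual to the gradients: `∇s · w = 0` and `∇t · w = 1`. Since `N`,
  -- `N^⊥` are orthonormal, this determines `w`.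
  have e1 : w.1 * (normalN u F p).2 - w.2 * (normalN u F p).1 = 0 :=
    mul_left_cancel₀ hf (by linear_combination w1)
  have e2 : w.1 * (normalN u F p).1 + w.2 * (normalN u F p).2 = (g p * lenD u F p)⁻¹ := by
    rw [← one_div, eq_div_iff (mul_ne_zero hg hD)]
    linear_combination w2
  rw [← e2]
  ext
  · simp only [Prod.smul_fst, smul_eq_mul]
    linear_combination (-w.1) * hu + (normalN u F p).2 * e1
  · simp only [Prod.smul_snd, smul_eq_mul]
    linear_combination (-w.2) * hu - (normalN u F p).1 * e1

open Topology in
/-- The derivative of an angle function along the field is the divergence of the rotated field. -/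
lemma fderiv_angle_apply {U : Set Plane} (hU : IsOpen U) {N : Plane → Plane} {θ : Plane → ℝ}
    (hθ : ContDiffOn ℝ 1 θ U) (h : ∀ q ∈ U, N q = (Real.cos (θ q), Real.sin (θ q))) {p : Plane}
    (hp : p ∈ U) : fderiv ℝ θ p (N p) = divP (fun q => perpP (N q)) p := by
  have hd : HasFDerivAt θ (fderiv ℝ θ p) p :=
    ((hθ.differentiableOn one_ne_zero).differentiableAt (hU.mem_nhds hp)).hasFDerivAt
  have hT : HasFDerivAt (fun q => perpP (N q)) _ p :=
    (hd.sin.prodMk hd.cos.neg).congr_of_eventuallyEq (by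
      filter_upwards [hU.mem_nhds hp] with q hq
      rw [h q hq]
      rfl)
  rw [divP, hT.fderiv, clm_plane_apply, h p hp]
  simp

/-! ### Assembly of the theorem. -/

theorem theoremD (Ω : Set Plane) (hΩo : IsOpen Ω) (hΩc : IsConnected Ω)
    (u : Plane → ℝ) (F : Plane → Plane) (H : Plane → ℝ)
    (hu : ContDiffOn ℝ 1 u Ω) (hF : ContDiffOn ℝ 1 F Ω) (hH : ContinuousOn H Ω)
    (hns : Nonsingular Ω u F) (hweak : IsWeakSolution Ω u F H)
    (hNH : ∃ NH : Plane → ℝ, HasContDerivAlong (normalN u F) Ω H NH) :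
    -- angle functions exist near every point, and each of them is of class C¹, as is the normal
    (∀ p ∈ Ω, ∃ (U : Set Plane) (θ : Plane → ℝ), IsOpen U ∧ p ∈ U ∧ U ⊆ Ω ∧ IsAngleOn u F U θ) ∧
    (∀ (U : Set Plane) (θ : Plane → ℝ), IsOpen U → U ⊆ Ω → IsAngleOn u F U θ →
      ContDiffOn ℝ 1 θ U) ∧
    ContDiffOn ℝ 1 (normalN u F) Ω ∧
    -- characteristic and seed curves pass through every point, and all of them are of class C²
    (∀ p ∈ Ω, ∃ (γ : ℝ → Plane) (a b τ : ℝ), IsCharCurve Ω u F γ a b ∧ τ ∈ Ioo a b ∧ γ τ = p) ∧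
    (∀ p ∈ Ω, ∃ (γ : ℝ → Plane) (a b τ : ℝ), IsSeedCurve Ω u F γ a b ∧ τ ∈ Ioo a b ∧ γ τ = p) ∧
    (∀ (γ : ℝ → Plane) (a b : ℝ), IsCharCurve Ω u F γ a b → ContDiffOn ℝ 2 γ (Ioo a b)) ∧
    (∀ (γ : ℝ → Plane) (a b : ℝ), IsSeedCurve Ω u F γ a b → ContDiffOn ℝ 2 γ (Ioo a b)) ∧
    -- characteristic coordinates exist near every point
    (∀ p ∈ Ω, ∃ (Ψ : OpenPartialHomeomorph Plane Plane) (f g : Plane → ℝ),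
      p ∈ Ψ.source ∧ IsCharCoords Ω u F Ψ f g) ∧
    -- the derivatives of D and log D along the characteristic curves exist and are continuous,
    -- and the formula for θ_t holds in all characteristic coordinates
    (∃ ND NlogD : Plane → ℝ,
      HasContDerivAlong (normalPerp u F) Ω (lenD u F) ND ∧
      HasContDerivAlong (normalPerp u F) Ω (fun p => Real.log (lenD u F p)) NlogD ∧
      ∀ (Ψ : OpenPartialHomeomorph Plane Plane) (f g : Plane → ℝ), IsCharCoords Ω u F Ψ f g →
        ∀ (U : Set Plane) (θ : Plane → ℝ), IsOpen U → U ⊆ Ω → IsAngleOn u F U θ →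
          ∀ p ∈ U ∩ Ψ.source,
            HasDerivAt (fun t => θ (Ψ.symm ((Ψ p).1, t)))
              (rotP F p / (g p * lenD u F p ^ 2) - NlogD p / (g p * lenD u F p)) (Ψ p).2 ∧
            rotP F p / (g p * lenD u F p ^ 2) - NlogD p / (g p * lenD u F p)
              = 1 / (g p * lenD u F p ^ 2) * (rotP F p - ND p)) := by
  have hN := continuousOn_normalN hΩo hu hF hns
  have hunit : ∀ p ∈ Ω, (normalN u F p).1 ^ 2 + (normalN u F p).2 ^ 2 = 1 := fun p hp =>
    normalN_sq hns hp
  have hD := continuousOn_lenD hΩo hu hF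
  have hD0 : ∀ p ∈ Ω, 0 < lenD u F p := fun p hp => lenD_pos hns hp
  have hrot := continuousOn_rotP hΩo hF
  have hdiv : HasUniformDiv Ω (normalN u F) H := hasUniformDiv_of_weak hΩo hN hH hweak
  have hcurl := hasUniformDiv_lenD_smul_perpP hΩo hu hF hns
  have charts : ∀ p ∈ Ω, ∃ (e : OpenPartialHomeomorph Plane Plane) (f g : Plane → ℝ),
      p ∈ e.source ∧ IsAdaptedChart Ω (normalN u F) (lenD u F) H e f g := fun p hp =>
    exists_adaptedChart hΩo hN hunit hD hD0 hH hrot hdiv hcurl hp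
  have hNC : ContDiffOn ℝ 1 (normalN u F) Ω := fun p hp => by
    obtain ⟨NH, hNH⟩ := hNH
    obtain ⟨e, f, g, hpe, he⟩ := charts p hp
    exact ((he.contDiffOn_normal hΩo hN hunit hD hD0 hH hdiv hNH).contDiffAt
      (e.open_source.mem_nhds hpe)).contDiffWithinAt
  have hTC : ContDiffOn ℝ 1 (normalPerp u F) Ω := hNC.snd.prodMk hNC.fst.neg
  have hT0 : ∀ p ∈ Ω, normalPerp u F p ≠ 0 := fun p hp h0 => by
    have h1 := hunit p hp
    simp only [normalPerp, perpP, Prod.mk_eq_zero, neg_eq_zero] at h0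
    rw [h0.1, h0.2] at h1
    norm_num at h1
  have hangle : ∀ (U : Set Plane) (θ : Plane → ℝ), IsOpen U → U ⊆ Ω → IsAngleOn u F U θ →
      ContDiffOn ℝ 1 θ U := fun U θ hU hUΩ hθ => (hNC.mono hUΩ).angle hU hθ.1 hθ.2
  -- The divergence of the product `D N^⊥` is `rot F`, which yields `N^⊥ D = rot F - D div N^⊥`.
  have hND : HasContDerivAlong (normalPerp u F) Ω (lenD u F)
      (fun p => rotP F p - lenD u F p * divP (normalPerp u F) p) := by
    refine ⟨hrot.sub (hD.mul (continuousOn_divP hΩo hTC)), fun p hp γ a b τ hγ hτ hγτ => ?_⟩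
    subst hγτ
    exact HasUniformDiv.hasDerivAt_factor hΩo hTC hT0 hD hrot hcurl
      (fun s hs => (hγ.1 s hs).hasDerivAt (isOpen_Ioo.mem_nhds hs)) hγ.2 hτ
  refine ⟨fun p hp => exists_continuousOn_angle hΩo hN hunit hp, hangle, hNC,
    fun p hp => ?_, fun p hp => ?_, fun γ a b hγ => contDiffOn_two_of_isCurveIn hTC hγ,
    fun γ a b hγ => contDiffOn_two_of_isCurveIn hNC hγ, fun p hp => ?_,
    _, fun p => (rotP F p - lenD u F p * divP (normalPerp u F) p) / lenD u F p, hND,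
    ⟨hND.1.div hD fun p hp => (hD0 p hp).ne', fun p hp γ a b τ hγ hτ hγτ => ?_⟩,
    fun Ψ f g hΨ U θ hU hUΩ hθ p hp => ?_⟩
  · obtain ⟨e, f, g, hpe, he⟩ := charts p hp
    exact (he.exists_isCurveIn hD hD0 hpe).1
  · obtain ⟨e, f, g, hpe, he⟩ := charts p hp
    exact (he.exists_isCurveIn hD hD0 hpe).2
  · obtain ⟨e, f, g, hpe, he⟩ := charts p hp
    exact ⟨e, f, g, hpe, he.isCharCoords⟩
  · have h1 := (hND.2 p hp γ a b τ hγ hτ hγτ).log (by rw [hγτ]; exact (hD0 p hp).ne')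
    rwa [hγτ] at h1
  · have hg := (hΨ.g_pos p hp.2).ne'
    have hDp := (hD0 p (hUΩ hp.1)).ne'
    constructor
    · have hθC := hangle U θ hU hUΩ hθ
      have hd : HasFDerivAt θ (fderiv ℝ θ p) (Ψ.symm ((Ψ p).1, (Ψ p).2)) := by
        rw [Prod.mk.eta, Ψ.left_inv hp.2]
        exact ((hθC.differentiableOn one_ne_zero).differentiableAt
          (hU.mem_nhds hp.1)).hasFDerivAt
      -- Thus `θ_t` is the derivative of `θ` along `N` divided by `g D`, and that derivative is `div
      -- N^⊥ = (rot F - N^⊥ D) / D`.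
      refine (hd.comp_hasDerivAt (Ψ p).2 (hΨ.hasDerivAt_symm hns hp.2)).congr_deriv ?_
      rw [map_smul, fderiv_angle_apply hU hθC hθ.2 hp.1, smul_eq_mul]
      change _ * divP (normalPerp u F) p = _
      field_simp
      ring
    · field_simp
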